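/- **Setting.** Let $n,m\ge 1$ and let $\phi:\mathbb{R}^n\to\mathbb{R}^m$ be a map with $\phi(0)=0$ that is Lipschitz with constant $L$ for the Euclidean norms. Let $\bar A\in\mathbb{R}^{n\times m}$ have rows $\bar a_1^T,\dots,\bar a_n^T$ and spectral norm $\rho=\|\bar A\|_2$, with $\rho L<1$. Let $$x_{t+1}=\bar A\phi(x_t)+w_t,\qquad t\ge 0,$$ be observed for $t=0,\dots,T$, where $T\ge 1$, and let $\mathcal F_t$ be the $\sigma$-algebra generated by $x_0,\dots,x_t$. For a real random variable $X$ put $\|X\|_{\psi_2}=\inf\{k>0:\mathbb{E}\exp(X^2/k^2)\le e\}$; the conditional norm $\|X\mid\mathcal F\|_{\psi_2}$ is the infimum of the $k>0$ with $\mathbb{E}[\exp(X^2/k^2)\mid\mathcal F]\le e$ almost surely. Write $v^{(i)}$ for the $i$-th entry of a vector $v$. For $\mu>0$ let $H_\mu(z)=\frac12z^2$ if $|z|\le\mu$ and $H_\mu(z)=\mu|z|-\frac12\mu^2$ if $|z|>\mu$. A Huber minimizer is any minimizer $(\hat a_1,\dots,\hat a_n)\in(\mathbb{R}^m)^n$ of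 $$\sum_{t=0}^{T-1}\sum_{i=1}^n H_\mu\bigl(x_{t+1}^{(i)}-a_i^T\phi(x_t)\bigr).$$ **Assumptions.** There are constants $\sigma,\lambda,q>0$ such that: * $\|x_0^{(i)}\|_{\psi_2}\le\sigma$ and $\|w_t^{(i)}\mid\mathcal F_t\|_{\psi_2}\le\sigma$ for all $t\ge0$ and all $i$; * the random vectors $x_0,w_0,w_1,w_2,\dots$ are independent and have mean zero; * $\mathbb{E}[\phi(x_t)\phi(x_t)^T\mid\mathcal F_{t-1}]\succeq\lambda^2I$ almost surely for $t=1,\dots,T$; * $\mathbb{P}(|w_t^{(i)}|\le\mu/2)\ge q$ for all $t\ge0$ and all $i$; * either $w_t$ and $-w_t$ have the same distribution for every $t\ge0$, or $\phi(x)=\bar Bx$ for some $\bar B\in\mathbb{R}^{m\times n}$ with $\|\bar B\|_2\le L$. **Theorem.** There are absolute constants $C_1,C_2>0$ with the following property. Under the assumptions above, let $\delta\in(0,1)$, and if $n=1$ let $\delta\le\frac12$. If $$T\ \ge\ C_1\,\frac{n^2L^4\sigma^4}{q^2\lambda^4(1-\rho L)^4}\,\log^2\!\Bigl(\frac{mn}{\delta}\Bigr)\log\!\Bigl(\frac{nL\sigma}{q\lambda(1-\rho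 L)\delta}\Bigr),$$ then with probability at least $1-\delta$ every Huber minimizer $(\hat a_1,\dots,\hat a_n)$ satisfies $$\|\bar a_i-\hat a_i\|_2\ \le\ C_2\,\frac{\mu\sqrt n\,L\sigma}{\sqrt T\,q\lambda^2(1-\rho L)}\,\log\!\Bigl(\frac n\delta\Bigr)\qquad\text{for all } i\in\{1,\dots,n\}.$$ -/

import Mathlib

open MeasureTheory ProbabilityTheory
open scoped NNReal ENNReal Matrix Matrix.Norms.L2Operator

namespace HuberSysId

noncomputable section

/-- The Huber loss with threshold `μ`. -/
def huber (μ z : ℝ) : ℝ :=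
  if |z| ≤ μ then z ^ 2 / 2 else μ * |z| - μ ^ 2 / 2

/-- The `i`-th row of a matrix, as a Euclidean vector. -/
def row {n m : ℕ} (A : Matrix (Fin n) (Fin m) ℝ) (i : Fin n) : EuclideanSpace ℝ (Fin m) :=
  WithLp.toLp 2 (A i)

/-- A matrix acting on Euclidean vectors. -/
def act {n m : ℕ} (A : Matrix (Fin n) (Fin m) ℝ) (v : EuclideanSpace ℝ (Fin m)) :
    EuclideanSpace ℝ (Fin n) :=
  WithLp.toLp 2 (A *ᵥ v.ofLp)

/-- The Huber objective of the candidate rows `a`, for a trajectory `x 0, …, x T`. -/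
def huberObjective {n m : ℕ} (μ : ℝ) (φ : EuclideanSpace ℝ (Fin n) → EuclideanSpace ℝ (Fin m))
    (T : ℕ) (x : ℕ → EuclideanSpace ℝ (Fin n)) (a : Fin n → EuclideanSpace ℝ (Fin m)) : ℝ :=
  ∑ t ∈ Finset.range T, ∑ i : Fin n, huber μ (x (t + 1) i - inner ℝ (a i) (φ (x t)))

/-- `a` is a minimizer (not necessarily the only one) of the Huber objective. -/
def IsHuberMinimizer {n m : ℕ} (μ : ℝ)
    (φ : EuclideanSpace ℝ (Fin n) → EuclideanSpace ℝ (Fin m))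
    (T : ℕ) (x : ℕ → EuclideanSpace ℝ (Fin n)) (a : Fin n → EuclideanSpace ℝ (Fin m)) : Prop :=
  ∀ b : Fin n → EuclideanSpace ℝ (Fin m), huberObjective μ φ T x a ≤ huberObjective μ φ T x b

section Probability

variable {Ω : Type*} [MeasurableSpace Ω]

/-- The `ψ₂`-norm `inf {k > 0 : 𝔼 exp (X² / k²) ≤ e}`; it is `∞` when there is no such `k`. -/
def psi2Norm (X : Ω → ℝ) (P : Measure Ω) : ℝ≥0∞ :=
  ⨅ (k : ℝ) (_ : 0 < k)
    (_ : ∫⁻ ω, ENNReal.ofReal (Real.exp (X ω ^ 2 / k ^ 2)) ∂P ≤ ENNReal.ofReal (Real.exp 1)),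
    ENNReal.ofReal k

/-- The `ψ₂`-norm conditional on the sigma-algebra `𝓖`: the infimum of the constants `k > 0` with
`𝔼[exp (X² / k²) | 𝓖] ≤ e` almost surely; it is `∞` when there is no such `k`. -/
def condPsi2Norm (X : Ω → ℝ) (P : Measure Ω) (𝓖 : MeasurableSpace Ω) : ℝ≥0∞ :=
  ⨅ (k : ℝ) (_ : 0 < k)
    (_ : Integrable (fun ω => Real.exp (X ω ^ 2 / k ^ 2)) P ∧
      ∀ᵐ ω ∂P, (P[fun ω => Real.exp (X ω ^ 2 / k ^ 2) | 𝓖]) ω ≤ Real.exp 1),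
    ENNReal.ofReal k

/-- The sigma-algebra generated by `x 0, …, x t`. -/
abbrev pastSigma {n : ℕ} (x : ℕ → Ω → EuclideanSpace ℝ (Fin n)) (t : ℕ) : MeasurableSpace Ω :=
  ⨆ s ∈ Set.Iic t, MeasurableSpace.comap (x s) inferInstance

/-- The trajectories of `x_{t+1} = A φ(x_t) + w_t`, with random initial state and disturbances. -/
structure IsSystem {n m : ℕ} (A : Matrix (Fin n) (Fin m) ℝ)
    (φ : EuclideanSpace ℝ (Fin n) → EuclideanSpace ℝ (Fin m))
    (x w : ℕ → Ω → EuclideanSpace ℝ (Fin n)) : Prop where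
  measurable_init : Measurable (x 0)
  measurable_noise : ∀ t, Measurable (w t)
  dynamics : ∀ t ω, x (t + 1) ω = act A (φ (x t ω)) + w t ω

/-- Stability: `L` is a Lipschitz constant of `φ`, `φ 0 = 0`, and the spectral norm of `A`
times `L` is less than one. -/
structure IsStableSystem {n m : ℕ} (A : Matrix (Fin n) (Fin m) ℝ)
    (φ : EuclideanSpace ℝ (Fin n) → EuclideanSpace ℝ (Fin m)) (L : ℝ≥0) : Prop where
  lipschitz : LipschitzWith L φ
  map_zero : φ 0 = 0
  lt_one : ‖A‖ * L < 1

/-- Sub-Gaussian initial state and disturbances, the latter conditionally on the past. -/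
structure IsSubGaussian {n : ℕ} (x w : ℕ → Ω → EuclideanSpace ℝ (Fin n)) (σ : ℝ)
    (P : Measure Ω) : Prop where
  init : ∀ i, psi2Norm (fun ω => x 0 ω i) P ≤ ENNReal.ofReal σ
  noise : ∀ t i, condPsi2Norm (fun ω => w t ω i) P (pastSigma x t) ≤ ENNReal.ofReal σ

/-- The sequence `x 0, w 0, w 1, …`. -/
def initAndNoise {n : ℕ} (x w : ℕ → Ω → EuclideanSpace ℝ (Fin n)) :
    ℕ → Ω → EuclideanSpace ℝ (Fin n)
  | 0 => x 0
  | t + 1 => w t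

/-- Persistent zero-mean independent noise: `x 0, w 0, w 1, …` are independent with mean zero. -/
structure IsZeroMeanIndepNoise {n : ℕ} (x w : ℕ → Ω → EuclideanSpace ℝ (Fin n))
    (P : Measure Ω) : Prop where
  indep : iIndepFun (initAndNoise x w) P
  mean_init : ∫ ω, x 0 ω ∂P = 0
  mean_noise : ∀ t, ∫ ω, w t ω ∂P = 0

/-- Expected excitation: `𝔼[φ(x_t) φ(x_t)ᵀ | x_0, …, x_{t-1}] ⪰ λ² I` for `t = 1, …, T`
(`lam` is `λ`, and `t` below is shifted by one). -/
def IsExcited {n m : ℕ} (φ : EuclideanSpace ℝ (Fin n) → EuclideanSpace ℝ (Fin m))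
    (x : ℕ → Ω → EuclideanSpace ℝ (Fin n)) (lam : ℝ) (T : ℕ) (P : Measure Ω) : Prop :=
  ∀ t < T, ∀ᵐ ω ∂P,
    (Matrix.of (fun j k : Fin m =>
        (P[fun ω' => φ (x (t + 1) ω') j * φ (x (t + 1) ω') k | pastSigma x t]) ω)
      - lam ^ 2 • (1 : Matrix (Fin m) (Fin m) ℝ)).PosSemidef

/-- Every disturbance coordinate lies in `[-μ/2, μ/2]` with probability at least `q`. -/
def HasMassNearZero {n : ℕ} (w : ℕ → Ω → EuclideanSpace ℝ (Fin n)) (μ q : ℝ)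
    (P : Measure Ω) : Prop :=
  ∀ t i, ENNReal.ofReal q ≤ P {ω | |w t ω i| ≤ μ / 2}

/-- Every disturbance vector has a symmetric distribution. -/
def IsSymmetricNoise {n : ℕ} (w : ℕ → Ω → EuclideanSpace ℝ (Fin n)) (P : Measure Ω) : Prop :=
  ∀ t, P.map (fun ω => -w t ω) = P.map (w t)

end Probability

/-- The basis function is linear, `φ x = B x` with spectral norm `‖B‖ ≤ L`. -/
def IsLinearBasis {n m : ℕ} (φ : EuclideanSpace ℝ (Fin n) → EuclideanSpace ℝ (Fin m))
    (L : ℝ≥0) : Prop :=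
  ∃ B : Matrix (Fin m) (Fin n) ℝ, ‖B‖ ≤ L ∧ ∀ v, φ v = act B v

/-- The sample-size threshold, without the absolute constant; `ρ` is the spectral norm of `A`. -/
def threshold (n m : ℕ) (L σ q lam ρ δ : ℝ) : ℝ :=
  n ^ 2 * L ^ 4 * σ ^ 4 / (q ^ 2 * lam ^ 4 * (1 - ρ * L) ^ 4)
    * Real.log (m * n / δ) ^ 2
    * Real.log (n * L * σ / (q * lam * (1 - ρ * L) * δ))

/-- The error bound, without the absolute constant; `ρ` is the spectral norm of `A`. -/
def errorBound (n T : ℕ) (μ L σ q lam ρ δ : ℝ) : ℝ :=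
  μ * √n * L * σ / (√T * q * lam ^ 2 * (1 - ρ * L)) * Real.log (n / δ)

end

end HuberSysId

/-! The objective splits over the rows, so one row `i` can be treated at a time. Its gradient at the
true row is `-∑ clip μ (w t i) • φ (x t)`. Every sample with `|w t i| ≤ μ / 2` contributes an exact
quadratic as long as the residual moves by at most `μ / 2`. By convexity, all minimizers lie within
`R` of the truth once twice the gradient norm is below `R` times the curvature on the ball of radius
`R` (`norm_sub_le_of_huber_min`). The curvature is of order `q λ² T` and the gradient of order `μ
√(nT) L σ log (n/δ) / (1 - ρL)`; their quotient is the claimed error.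

Gradient. For symmetric noise it is a martingale, because `clip` is odd. For linear `φ` its drift
unrolls into a deterministic linear function of `x 0, w 0, w 1, …`, whose coefficients are bounded
by a geometric series. So it is again a martingale, up to a bounded linear image of `x 0`
(`exists_sum_clip_smul_eq`).

Curvature. Two martingales of matrices `φφᵀ` are involved: one replaces the mask `|w t i| ≤ μ / 2`
by its probability, at least `q`; the other replaces the next covariance by its conditional mean, at
least `λ² I` (`curvature_le`). Matrices are treated as vectors with the Frobenius norm.

Concentration. All three martingales are handled by one dimension-free inequality in Hilbert space:
with increments `Y`, the process `cosh ‖∑ (Y - E Y)‖ * exp (-∑ (‖Y‖² + E ‖Y‖²))`, with conditional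
expectations, has mean at most one. Only second moments of the increments are needed, so they may be
unbounded; what remains is to bound the square function (`measure_centredSum_ge_le`). This reduces
to sums of `‖x t‖⁴` and `‖w t‖²`, which the contraction reduces to fourth powers of noise norms,
controlled by a truncated Chernoff bound (`measure_sum_min_sq_ge_le`, `pathBound`).

Sample size. Taking traces, excitation forces `m ≤ snr` (`card_le_snr`). Hence the ratio `snr` is at
least one when `m > 0`, and the logarithms in the sample-size condition dominate those produced by
the proof (`snr_of_threshold_le`). -/

namespace HuberSysId

set_option linter.unusedSectionVars false

/-! ### Inequalities for the hyperbolic cosine of a norm. -/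

section CoshNorm

lemma convexOn_log_cosh : ConvexOn ℝ Set.univ (fun u : ℝ => Real.log (Real.cosh u)) := by
  have hd : ∀ u : ℝ, HasDerivAt (fun u : ℝ => Real.log (Real.cosh u))
      (Real.sinh u / Real.cosh u) u :=
    fun u => (Real.hasDerivAt_cosh u).log (Real.cosh_pos u).ne'
  refine MonotoneOn.convexOn_of_deriv convex_univ
    (fun u _ => (hd u).continuousAt.continuousWithinAt)
    (fun u _ => (hd u).differentiableAt.differentiableWithinAt) ?_
  intro u _ v _ huv
  rw [(hd u).deriv, (hd v).deriv, div_le_div_iff₀ (Real.cosh_pos u) (Real.cosh_pos v)]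
  have h : 0 ≤ Real.sinh (v - u) := Real.sinh_nonneg_iff.2 (by linarith)
  rw [Real.sinh_sub] at h
  linarith

variable {H : Type*} [NormedAddCommGroup H]

/-- Convexity of the logarithm, not only of `cosh ‖z‖`, is needed so that Jensen survives
multiplication by an exponential weight. -/
lemma convexOn_log_cosh_norm [NormedSpace ℝ H] :
    ConvexOn ℝ Set.univ (fun z : H => Real.log (Real.cosh ‖z‖)) := by
  refine ⟨convex_univ, fun a _ b _ s t hs ht hst => ?_⟩
  refine le_trans ?_ (convexOn_log_cosh.2 (Set.mem_univ ‖a‖) (Set.mem_univ ‖b‖) hs ht hst)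
  refine Real.log_le_log (Real.cosh_pos _) (Real.cosh_le_cosh.2 ?_)
  have h1 : ‖s • a + t • b‖ ≤ s * ‖a‖ + t * ‖b‖ := by
    refine (norm_add_le _ _).trans ?_
    rw [norm_smul, norm_smul, Real.norm_of_nonneg hs, Real.norm_of_nonneg ht]
  rw [abs_of_nonneg (norm_nonneg _), smul_eq_mul, smul_eq_mul]
  exact h1.trans (le_abs_self _)

/-- Majorisation: of two pairs with equal sum, the more spread one has the larger sum of any convex
function. Here `p` and `m` are convex combinations of `a` and `b` with exchanged weights. -/
lemma pow_add_pow_le_of_add_eq {a b p m : ℝ} (hb : 0 ≤ b) (hpa : p ≤ a) (hma : m ≤ a)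
    (hsum : p + m = a + b) (k : ℕ) : p ^ k + m ^ k ≤ a ^ k + b ^ k := by
  rcases eq_or_lt_of_le (show b ≤ a by linarith) with hab | hab
  · have : p = a := by linarith
    have : m = b := by linarith
    subst_vars; rfl
  set s := (p - b) / (a - b) with hs
  have hd : 0 < a - b := by linarith
  have hs0 : 0 ≤ s := div_nonneg (by linarith) hd.le
  have hs1 : 0 ≤ 1 - s := by
    rw [sub_nonneg, hs, div_le_one hd]; linarith
  have hsd : s * (a - b) = p - b := by rw [hs]; field_simp
  have hp : s • a + (1 - s) • b = p := by simp only [smul_eq_mul]; linarith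
  have hm : (1 - s) • a + s • b = m := by simp only [smul_eq_mul]; linarith
  have ha : a ∈ Set.Ici (0 : ℝ) := by simp only [Set.mem_Ici]; linarith
  have h1 := (convexOn_pow (𝕜 := ℝ) k).2 ha hb hs0 hs1 (by ring)
  have h2 := (convexOn_pow (𝕜 := ℝ) k).2 ha hb hs1 hs0 (by ring)
  rw [hp] at h1
  rw [hm] at h2
  simp only [smul_eq_mul] at h1 h2
  linarith

/-- The symmetrised form of the `cosh` addition formula for norms. -/
lemma cosh_norm_add_add_cosh_norm_sub_le [InnerProductSpace ℝ H] (s d : H) :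
    Real.cosh ‖s + d‖ + Real.cosh ‖s - d‖ ≤ 2 * (Real.cosh ‖s‖ * Real.cosh ‖d‖) := by
  have h2 : 2 * (Real.cosh ‖s‖ * Real.cosh ‖d‖)
      = Real.cosh (‖s‖ + ‖d‖) + Real.cosh (‖s‖ - ‖d‖) := by
    rw [Real.cosh_add, Real.cosh_sub]; ring
  rw [h2]
  -- Both sides are power series in squared norms, compared term by term. By the parallelogram law
  -- the two pairs of squares have the same sum.
  refine hasSum_le (fun k => ?_) ((Real.hasSum_cosh ‖s + d‖).add (Real.hasSum_cosh ‖s - d‖))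
    ((Real.hasSum_cosh (‖s‖ + ‖d‖)).add (Real.hasSum_cosh (‖s‖ - ‖d‖)))
  rw [← add_div, ← add_div]
  refine div_le_div_of_nonneg_right ?_ (by positivity)
  simp only [pow_mul]
  have hp := parallelogram_law_with_norm ℝ s d
  refine pow_add_pow_le_of_add_eq (sq_nonneg _) ?_ ?_ (by nlinarith) k
  · exact pow_le_pow_left₀ (norm_nonneg _) (norm_add_le _ _) 2
  · exact pow_le_pow_left₀ (norm_nonneg _) (norm_sub_le _ _) 2

lemma cosh_le_exp_of_nonneg {u : ℝ} (hu : 0 ≤ u) : Real.cosh u ≤ Real.exp u := by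
  rw [Real.cosh_eq]
  have : Real.exp (-u) ≤ Real.exp u := Real.exp_le_exp.2 (by linarith)
  linarith

/-- The Gaussian factor makes the weighted `cosh` bounded in `d`, which gives integrability without
exponential moments. -/
lemma cosh_norm_mul_exp_neg_le (s d : H) :
    Real.cosh ‖s + d‖ * Real.exp (-(‖d‖ ^ 2 / 2)) ≤ Real.exp (‖s‖ + 1 / 2) := by
  have h1 : Real.cosh ‖s + d‖ ≤ Real.exp (‖s‖ + ‖d‖) := by
    refine (Real.cosh_le_cosh.2 ?_).trans (cosh_le_exp_of_nonneg (by positivity))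
    rw [abs_of_nonneg (norm_nonneg _)]
    exact (norm_add_le _ _).trans (le_abs_self _)
  calc _ ≤ Real.exp (‖s‖ + ‖d‖) * Real.exp (-(‖d‖ ^ 2 / 2)) := by gcongr
    _ = Real.exp (‖s‖ + ‖d‖ + -(‖d‖ ^ 2 / 2)) := (Real.exp_add _ _).symm
    _ ≤ _ := Real.exp_le_exp.2 (by nlinarith [sq_nonneg (‖d‖ - 1)])

/-- Averaged over the sign of `d`, the growth factor is `cosh ‖d‖ ≤ exp (‖d‖² / 2)`, which the
weight cancels exactly. -/
lemma cosh_norm_mul_exp_neg_symm_le [InnerProductSpace ℝ H] (s d : H) :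
    Real.cosh ‖s + d‖ * Real.exp (-(‖d‖ ^ 2 / 2))
      + Real.cosh ‖s - d‖ * Real.exp (-(‖d‖ ^ 2 / 2)) ≤ 2 * Real.cosh ‖s‖ := by
  have h1 := cosh_norm_add_add_cosh_norm_sub_le s d
  have h3 : Real.cosh ‖d‖ * Real.exp (-(‖d‖ ^ 2 / 2)) ≤ 1 := by
    calc _ ≤ Real.exp (‖d‖ ^ 2 / 2) * Real.exp (-(‖d‖ ^ 2 / 2)) :=
          mul_le_mul_of_nonneg_right (Real.cosh_le_exp_half_sq ‖d‖) (Real.exp_pos _).le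
      _ = 1 := by rw [← Real.exp_add, add_neg_cancel, Real.exp_zero]
  have h4 := Real.cosh_pos ‖s‖
  rw [← add_mul]
  calc _ ≤ 2 * (Real.cosh ‖s‖ * Real.cosh ‖d‖) * Real.exp (-(‖d‖ ^ 2 / 2)) :=
        mul_le_mul_of_nonneg_right h1 (Real.exp_pos _).le
    _ = 2 * Real.cosh ‖s‖ * (Real.cosh ‖d‖ * Real.exp (-(‖d‖ ^ 2 / 2))) := by ring
    _ ≤ 2 * Real.cosh ‖s‖ * 1 := mul_le_mul_of_nonneg_left h3 (by positivity)
    _ = _ := mul_one _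

end CoshNorm

/-! ### One step of the self-normalised supermartingale, by symmetrisation. -/

section SelfNormalized

/-- Symmetrisation of a double integral of a function of a difference. -/
lemma lintegral_lintegral_sub_le {S H : Type*} [MeasurableSpace S]
    [NormedAddCommGroup H] [MeasurableSpace H] [BorelSpace H] [SecondCountableTopology H] (ν : Measure S) [IsProbabilityMeasure ν] {Y : S → H}
    (hY : Measurable Y) {F : H → ℝ≥0∞} (hF : Measurable F) {c : ℝ≥0∞}
    (hFc : ∀ d, F d + F (-d) ≤ 2 * c) :
    ∫⁻ z, ∫⁻ y, F (Y z - Y y) ∂ν ∂ν ≤ c := by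
  have hFm : Measurable fun p : S × S => F (Y p.1 - Y p.2) :=
    hF.comp ((hY.comp measurable_fst).sub (hY.comp measurable_snd))
  set I := ∫⁻ z, ∫⁻ y, F (Y z - Y y) ∂ν ∂ν with hI
  have hswap : I = ∫⁻ z, ∫⁻ y, F (Y y - Y z) ∂ν ∂ν :=
    lintegral_lintegral_swap (f := fun z y => F (Y z - Y y)) hFm.aemeasurable
  have hsum : I + I ≤ 2 * c := by
    nth_rewrite 2 [hswap]
    rw [hI, ← lintegral_add_left hFm.lintegral_prod_right]
    calc _ ≤ ∫⁻ _ : S, 2 * c ∂ν := by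
          refine lintegral_mono fun z => ?_
          dsimp only
          rw [← lintegral_add_left (by exact hFm.comp measurable_prodMk_left)]
          calc _ ≤ ∫⁻ _ : S, 2 * c ∂ν := lintegral_mono fun y => by
                have := hFc (Y z - Y y)
                rwa [neg_sub] at this
            _ = _ := by simp
      _ = _ := by simp
  rw [← two_mul] at hsum
  exact (ENNReal.mul_le_mul_iff_right (by norm_num) (by norm_num)).1 hsum

variable {H : Type*} [NormedAddCommGroup H] [InnerProductSpace ℝ H] [CompleteSpace H]
  [MeasurableSpace H] [BorelSpace H] [SecondCountableTopology H]
  {S : Type*} [MeasurableSpace S]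

/-- Replacing the mean by an independent copy only increases the self-normalised `cosh`. -/
lemma cosh_norm_sub_integral_le (ν : Measure S) [IsProbabilityMeasure ν] {Y : S → H}
    (hY : Measurable Y) (hY2 : Integrable (fun y => ‖Y y‖ ^ 2) ν) (s z : H) :
    Real.cosh ‖s + (z - ∫ y, Y y ∂ν)‖ * Real.exp (-(‖z‖ ^ 2 + ∫ y, ‖Y y‖ ^ 2 ∂ν))
      ≤ ∫ y, Real.cosh ‖s + (z - Y y)‖ * Real.exp (-(‖z - Y y‖ ^ 2 / 2)) ∂ν := by
  have hYm : AEStronglyMeasurable Y ν := hY.aestronglyMeasurable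
  have hYL : MemLp Y 2 ν := (memLp_two_iff_integrable_sq_norm hYm).2 hY2
  have hYi : Integrable Y ν := hYL.integrable one_le_two
  have hD : Integrable (fun y => z - Y y) ν := (integrable_const z).sub hYi
  have hZ : Integrable (fun y => s + (z - Y y)) ν := (integrable_const s).add hD
  have hZint : ∫ y, (s + (z - Y y)) ∂ν = s + (z - ∫ y, Y y ∂ν) := by
    rw [integral_add (integrable_const s) hD,
      integral_sub (integrable_const z) hYi]
    simp
  have hcont : Continuous (fun u : H => Real.log (Real.cosh ‖u‖)) :=
    Continuous.log (Real.continuous_cosh.comp continuous_norm) (fun u => (Real.cosh_pos _).ne')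
  have hlogi : Integrable ((fun u : H => Real.log (Real.cosh ‖u‖)) ∘ fun y => s + (z - Y y)) ν := by
    refine hZ.norm.mono' (hcont.comp_aestronglyMeasurable hZ.1) (Filter.Eventually.of_forall ?_)
    intro y
    simp only [Function.comp]
    rw [Real.norm_of_nonneg (Real.log_nonneg (Real.one_le_cosh _))]
    rw [Real.log_le_iff_le_exp (Real.cosh_pos _)]
    exact cosh_le_exp_of_nonneg (norm_nonneg _)
  have hsq : Integrable (fun y => ‖z - Y y‖ ^ 2 / 2) ν :=
    ((memLp_two_iff_integrable_sq_norm hD.1).1 ((memLp_const z).sub hYL)).div_const 2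
  have hsqle : ∫ y, ‖z - Y y‖ ^ 2 / 2 ∂ν ≤ ‖z‖ ^ 2 + ∫ y, ‖Y y‖ ^ 2 ∂ν := by
    have : ‖z‖ ^ 2 + ∫ y, ‖Y y‖ ^ 2 ∂ν = ∫ y, (‖z‖ ^ 2 + ‖Y y‖ ^ 2) ∂ν := by
      rw [integral_add (integrable_const _) hY2]; simp
    rw [this]
    refine integral_mono hsq ((integrable_const _).add hY2) fun y => ?_
    have := norm_sub_le z (Y y)
    have h0 := norm_nonneg (z - Y y)
    dsimp only
    nlinarith [sq_nonneg (‖z‖ - ‖Y y‖)]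
  -- Jensen is applied twice: to `log cosh ‖·‖`, which moves the mean of `Y` outside, and then
  -- (`h2`) to `exp`, which returns to the product with the weight. In between, `hsqle` bounds the
  -- exponent.
  have h1 := convexOn_log_cosh_norm.map_integral_le (μ := ν) hcont.continuousOn isClosed_univ
    (Filter.Eventually.of_forall fun _ => Set.mem_univ _) hZ hlogi
  rw [hZint] at h1
  have hei : Integrable (Real.exp ∘ fun y =>
      Real.log (Real.cosh ‖s + (z - Y y)‖) - ‖z - Y y‖ ^ 2 / 2) ν := by
    refine Integrable.mono' (integrable_const (Real.exp (‖s‖ + 1 / 2)))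
      (Real.continuous_exp.comp_aestronglyMeasurable (hlogi.1.sub hsq.1))
      (Filter.Eventually.of_forall fun y => ?_)
    simp only [Function.comp]
    rw [Real.norm_of_nonneg (Real.exp_pos _).le, sub_eq_add_neg, Real.exp_add,
      Real.exp_log (Real.cosh_pos _)]
    exact cosh_norm_mul_exp_neg_le s _
  have h2 := convexOn_exp.map_integral_le (μ := ν) Real.continuous_exp.continuousOn isClosed_univ
    (Filter.Eventually.of_forall fun _ => Set.mem_univ _) (hlogi.sub hsq) hei
  have key : ∀ c a : ℝ, 0 < c → Real.exp (Real.log c - a) = c * Real.exp (-a) := fun c a hc => by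
    rw [sub_eq_add_neg, Real.exp_add, Real.exp_log hc]
  calc _ = Real.exp (Real.log (Real.cosh ‖s + (z - ∫ y, Y y ∂ν)‖)
          - (‖z‖ ^ 2 + ∫ y, ‖Y y‖ ^ 2 ∂ν)) := (key _ _ (Real.cosh_pos _)).symm
    _ ≤ Real.exp (∫ y, (Real.log (Real.cosh ‖s + (z - Y y)‖) - ‖z - Y y‖ ^ 2 / 2) ∂ν) := by
        have h3 : ∫ y, (Real.log (Real.cosh ‖s + (z - Y y)‖) - ‖z - Y y‖ ^ 2 / 2) ∂ν
            = ∫ y, Real.log (Real.cosh ‖s + (z - Y y)‖) ∂ν - ∫ y, ‖z - Y y‖ ^ 2 / 2 ∂ν :=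
          integral_sub hlogi hsq
        rw [h3]
        exact Real.exp_le_exp.2 (sub_le_sub h1 hsqle)
    _ ≤ _ := h2
    _ = _ := integral_congr_ae (Filter.Eventually.of_forall fun y => key _ _ (Real.cosh_pos _))

/-- One step of the self-normalised `cosh` supermartingale. -/
lemma lintegral_cosh_norm_self_normalized_le (ν : Measure S) [IsProbabilityMeasure ν] {Y : S → H}
    (hY : Measurable Y) (hY2 : Integrable (fun y => ‖Y y‖ ^ 2) ν) (s : H) :
    ∫⁻ z, ENNReal.ofReal (Real.cosh ‖s + (Y z - ∫ y, Y y ∂ν)‖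
        * Real.exp (-(‖Y z‖ ^ 2 + ∫ y, ‖Y y‖ ^ 2 ∂ν))) ∂ν
      ≤ ENNReal.ofReal (Real.cosh ‖s‖) := by
  have hFc : Continuous fun d : H => Real.cosh ‖s + d‖ * Real.exp (-(‖d‖ ^ 2 / 2)) :=
    (Real.continuous_cosh.comp (by fun_prop)).mul (Real.continuous_exp.comp (by fun_prop))
  have hF0 : ∀ d : H, 0 ≤ Real.cosh ‖s + d‖ * Real.exp (-(‖d‖ ^ 2 / 2)) :=
    fun d => mul_nonneg (Real.cosh_pos _).le (Real.exp_pos _).le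
  have hFi : ∀ z, Integrable (fun y =>
      Real.cosh ‖s + (z - Y y)‖ * Real.exp (-(‖z - Y y‖ ^ 2 / 2))) ν := fun z =>
    Integrable.mono' (integrable_const (Real.exp (‖s‖ + 1 / 2)))
      (hFc.measurable.comp (measurable_const.sub hY)).aestronglyMeasurable
      (Filter.Eventually.of_forall fun y => by
        rw [Real.norm_of_nonneg (hF0 _)]; exact cosh_norm_mul_exp_neg_le s _)
  -- Once the mean is replaced by an independent copy, the increment is a symmetric difference, so
  -- the inequality averaged over signs applies.
  refine le_trans (lintegral_mono fun z => ?_) (lintegral_lintegral_sub_le ν hY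
    (F := fun d => ENNReal.ofReal (Real.cosh ‖s + d‖ * Real.exp (-(‖d‖ ^ 2 / 2))))
    hFc.measurable.ennreal_ofReal fun d => ?_)
  · rw [← ofReal_integral_eq_lintegral_ofReal (hFi _) (Filter.Eventually.of_forall fun y => hF0 _)]
    exact ENNReal.ofReal_le_ofReal (cosh_norm_sub_integral_le ν hY hY2 s (Y z))
  · rw [norm_neg, ← ENNReal.ofReal_add (hF0 _) (mul_nonneg (Real.cosh_pos _).le (Real.exp_pos _).le),
      ← sub_eq_add_neg]
    refine (ENNReal.ofReal_le_ofReal (cosh_norm_mul_exp_neg_symm_le s d)).trans ?_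
    rw [ENNReal.ofReal_mul (by norm_num), ENNReal.ofReal_ofNat]

end SelfNormalized

/-! ### Integration against noise independent of the past. -/

section Independence

variable {Ω α β : Type*} {mΩ : MeasurableSpace Ω} [MeasurableSpace α] [MeasurableSpace β]
  {P : Measure Ω}

lemma lintegral_comp_prodMk_of_indepFun [IsProbabilityMeasure P] {X : Ω → α} {W : Ω → β} (hX : Measurable X)
    (hW : Measurable W) (hXW : IndepFun X W P) {F : α × β → ℝ≥0∞} (hF : Measurable F) :
    ∫⁻ ω, F (X ω, W ω) ∂P = ∫⁻ ω, ∫⁻ y, F (X ω, y) ∂(P.map W) ∂P := by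
  have h := (indepFun_iff_map_prod_eq_prod_map_map hX.aemeasurable hW.aemeasurable).1 hXW
  have : IsProbabilityMeasure (P.map W) := Measure.isProbabilityMeasure_map hW.aemeasurable
  rw [← lintegral_map hF (hX.prodMk hW), h, lintegral_prod _ hF.aemeasurable,
    lintegral_map hF.lintegral_prod_right' hX]

/-- A process adapted to a filtration, driven by noise independent of the past. -/
structure IsDriven (𝓕 : ℕ → MeasurableSpace Ω) (h : ℕ → Ω → α) (w : ℕ → Ω → β)
    (P : Measure Ω) : Prop where
  mono : Monotone 𝓕
  le : ∀ t, 𝓕 t ≤ mΩ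
  adapted : ∀ t, Measurable[𝓕 t] (h t)
  noise : ∀ t, Measurable[𝓕 (t + 1)] (w t)
  indep : ∀ t, Indep (𝓕 t) (MeasurableSpace.comap (w t) inferInstance) P

namespace IsDriven

variable {𝓕 : ℕ → MeasurableSpace Ω} {h : ℕ → Ω → α} {w : ℕ → Ω → β}

lemma measurable_noise (hd : IsDriven 𝓕 h w P) (t : ℕ) : Measurable (w t) :=
  (hd.noise t).mono (hd.le _) le_rfl

lemma measurable_state (hd : IsDriven 𝓕 h w P) (t : ℕ) : Measurable (h t) :=
  (hd.adapted t).mono (hd.le _) le_rfl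

lemma indepFun (hd : IsDriven 𝓕 h w P) {γ : Type*} [MeasurableSpace γ] {t : ℕ} {X : Ω → γ}
    (hX : Measurable[𝓕 t] X) : IndepFun X (w t) P :=
  (IndepFun_iff_Indep _ _ _).2 (indep_of_indep_of_le_left (hd.indep t) hX.comap_le)

end IsDriven

end Independence

/-! ### The dimension-free martingale tail bound. -/

section Martingale

variable {Ω α β : Type*} {mΩ : MeasurableSpace Ω} [MeasurableSpace α] [MeasurableSpace β]
  {P : Measure Ω} [IsProbabilityMeasure P]
  {H : Type*} [NormedAddCommGroup H] [InnerProductSpace ℝ H] [CompleteSpace H]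
  [MeasurableSpace H] [BorelSpace H] [SecondCountableTopology H]

/-- The sum of the increments `f_t(h_t, w_t)`, centred given the past. -/
noncomputable def centredSum (P : Measure Ω) (h : ℕ → Ω → α) (w : ℕ → Ω → β) (f : ℕ → α × β → H)
    (T : ℕ) (ω : Ω) : H :=
  ∑ t ∈ Finset.range T, (f t (h t ω, w t ω) - ∫ y, f t (h t ω, y) ∂(P.map (w t)))

/-- The sum of the realised and expected squared increments. -/
noncomputable def squareSum (P : Measure Ω) (h : ℕ → Ω → α) (w : ℕ → Ω → β) (f : ℕ → α × β → H)
    (T : ℕ) (ω : Ω) : ℝ :=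
  ∑ t ∈ Finset.range T, (‖f t (h t ω, w t ω)‖ ^ 2 + ∫ y, ‖f t (h t ω, y)‖ ^ 2 ∂(P.map (w t)))

variable {𝓕 : ℕ → MeasurableSpace Ω} {h : ℕ → Ω → α} {w : ℕ → Ω → β} {f : ℕ → α × β → H}

lemma measurable_integral_section (hf : ∀ t, Measurable (f t)) (hw : ∀ t, Measurable (w t))
    (t : ℕ) : Measurable fun a => ∫ y, f t (a, y) ∂(P.map (w t)) := by
  have : IsProbabilityMeasure (P.map (w t)) := Measure.isProbabilityMeasure_map (hw t).aemeasurable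
  exact ((hf t).stronglyMeasurable.integral_prod_right').measurable

lemma measurable_integral_norm_sq_section (hf : ∀ t, Measurable (f t))
    (hw : ∀ t, Measurable (w t)) (t : ℕ) :
    Measurable fun a => ∫ y, ‖f t (a, y)‖ ^ 2 ∂(P.map (w t)) := by
  have : IsProbabilityMeasure (P.map (w t)) := Measure.isProbabilityMeasure_map (hw t).aemeasurable
  exact (((hf t).norm.pow_const 2).stronglyMeasurable.integral_prod_right').measurable

lemma measurable_centredSum (hd : IsDriven 𝓕 h w P) (hf : ∀ t, Measurable (f t)) (T : ℕ) :
    Measurable[𝓕 T] (centredSum P h w f T) := by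
  unfold centredSum
  refine Finset.measurable_fun_sum _ fun t ht => ?_
  have hlt := Finset.mem_range.1 ht
  have h1 : Measurable[𝓕 T] (h t) := (hd.adapted t).mono (hd.mono hlt.le) le_rfl
  have h2 : Measurable[𝓕 T] (w t) := (hd.noise t).mono (hd.mono hlt) le_rfl
  exact ((hf t).comp (h1.prodMk h2)).sub
    ((measurable_integral_section hf hd.measurable_noise t).comp h1)

lemma measurable_squareSum (hd : IsDriven 𝓕 h w P) (hf : ∀ t, Measurable (f t)) (T : ℕ) :
    Measurable[𝓕 T] (squareSum P h w f T) := by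
  unfold squareSum
  refine Finset.measurable_fun_sum _ fun t ht => ?_
  have hlt := Finset.mem_range.1 ht
  have h1 : Measurable[𝓕 T] (h t) := (hd.adapted t).mono (hd.mono hlt.le) le_rfl
  have h2 : Measurable[𝓕 T] (w t) := (hd.noise t).mono (hd.mono hlt) le_rfl
  have h3 : Measurable[𝓕 T] fun ω => ‖f t (h t ω, w t ω)‖ ^ 2 :=
    ((hf t).norm.pow_const 2).comp (h1.prodMk h2)
  exact h3.add
    ((measurable_integral_norm_sq_section hf hd.measurable_noise t).comp h1)

/-- The self-normalised `cosh` process has expectation at most one. -/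
lemma lintegral_cosh_centredSum_le (hd : IsDriven 𝓕 h w P) (hf : ∀ t, Measurable (f t))
    (hf2 : ∀ t a, Integrable (fun y => ‖f t (a, y)‖ ^ 2) (P.map (w t))) (T : ℕ) :
    ∫⁻ ω, ENNReal.ofReal (Real.cosh ‖centredSum P h w f T ω‖
      * Real.exp (-squareSum P h w f T ω)) ∂P ≤ 1 := by
  induction T with
  | zero => simp [centredSum, squareSum]
  | succ T ih =>
    refine le_trans ?_ ih
    have hm := hd.measurable_noise
    have hprob : IsProbabilityMeasure (P.map (w T)) :=
      Measure.isProbabilityMeasure_map (hm T).aemeasurable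
    -- `X` holds everything known before `w T` is drawn. Independence allows it to be frozen while
    -- the last step is integrated over the law of `w T`.
    set X : Ω → α × H × ℝ := fun ω =>
      (h T ω, centredSum P h w f T ω, squareSum P h w f T ω) with hXdef
    have hX : Measurable[𝓕 T] X := (hd.adapted T).prodMk
      ((measurable_centredSum hd hf T).prodMk (measurable_squareSum hd hf T))
    set G : (α × H × ℝ) × β → ℝ≥0∞ := fun p => ENNReal.ofReal (Real.exp (-p.1.2.2)) *
      ENNReal.ofReal (Real.cosh ‖p.1.2.1 + (f T (p.1.1, p.2) - ∫ y, f T (p.1.1, y) ∂(P.map (w T)))‖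
        * Real.exp (-(‖f T (p.1.1, p.2)‖ ^ 2 + ∫ y, ‖f T (p.1.1, y)‖ ^ 2 ∂(P.map (w T))))) with hG
    have ma : Measurable fun p : (α × H × ℝ) × β => p.1.1 := measurable_fst.comp measurable_fst
    have mf : Measurable fun p : (α × H × ℝ) × β => f T (p.1.1, p.2) :=
      (hf T).comp (ma.prodMk measurable_snd)
    have mi : Measurable fun p : (α × H × ℝ) × β => ∫ y, f T (p.1.1, y) ∂(P.map (w T)) :=
      (measurable_integral_section hf hm T).comp ma
    have mj : Measurable fun p : (α × H × ℝ) × β => ∫ y, ‖f T (p.1.1, y)‖ ^ 2 ∂(P.map (w T)) :=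
      (measurable_integral_norm_sq_section hf hm T).comp ma
    have hGm : Measurable G := by
      have m1 : Measurable fun p : (α × H × ℝ) × β => Real.exp (-p.1.2.2) :=
        Real.measurable_exp.comp (by fun_prop)
      have m2 : Measurable fun p : (α × H × ℝ) × β =>
          Real.cosh ‖p.1.2.1 + (f T (p.1.1, p.2) - ∫ y, f T (p.1.1, y) ∂(P.map (w T)))‖ :=
        Real.measurable_cosh.comp
          ((measurable_fst.comp (measurable_snd.comp measurable_fst)).add (mf.sub mi)).norm
      have m3 : Measurable fun p : (α × H × ℝ) × β =>
          Real.exp (-(‖f T (p.1.1, p.2)‖ ^ 2 + ∫ y, ‖f T (p.1.1, y)‖ ^ 2 ∂(P.map (w T)))) :=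
        Real.measurable_exp.comp ((mf.norm.pow_const 2).add mj).neg
      exact m1.ennreal_ofReal.mul (m2.mul m3).ennreal_ofReal
    calc _ = ∫⁻ ω, G (X ω, w T ω) ∂P := by
          refine lintegral_congr fun ω => ?_
          rw [hG, hXdef]
          dsimp only
          rw [← ENNReal.ofReal_mul (Real.exp_pos _).le, mul_left_comm, ← Real.exp_add]
          simp only [centredSum, squareSum, Finset.sum_range_succ]
          rw [← neg_add]
      _ = ∫⁻ ω, ∫⁻ y, G (X ω, y) ∂(P.map (w T)) ∂P :=
          lintegral_comp_prodMk_of_indepFun (hX.mono (hd.le T) le_rfl) (hm T) (hd.indepFun hX) hGm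
      _ ≤ _ := by
          refine lintegral_mono fun ω => ?_
          rw [hG, hXdef]
          dsimp only
          have hY : Measurable fun y => f T (h T ω, y) := (hf T).comp measurable_prodMk_left
          rw [lintegral_const_mul' _ _ ENNReal.ofReal_ne_top, mul_comm (Real.cosh _),
            ENNReal.ofReal_mul (Real.exp_pos _).le]
          gcongr
          exact lintegral_cosh_norm_self_normalized_le (P.map (w T)) hY (hf2 T _) _

lemma centredSum_const_smul (c : ℝ) (T : ℕ) (ω : Ω) :
    centredSum P h w (fun t p => c • f t p) T ω = c • centredSum P h w f T ω := by
  simp only [centredSum, integral_smul, Finset.smul_sum, smul_sub]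

lemma squareSum_const_smul (c : ℝ) (T : ℕ) (ω : Ω) :
    squareSum P h w (fun t p => c • f t p) T ω = c ^ 2 * squareSum P h w f T ω := by
  simp only [squareSum, norm_smul, mul_pow, integral_const_mul, Finset.mul_sum, mul_add,
    Real.norm_eq_abs, sq_abs]

/-- Dimension-free tail bound for a vector martingale, in terms of its square function. -/
lemma measure_centredSum_ge_le (hd : IsDriven 𝓕 h w P) (hf : ∀ t, Measurable (f t))
    (hf2 : ∀ t a, Integrable (fun y => ‖f t (a, y)‖ ^ 2) (P.map (w t))) (T : ℕ)
    {v δ : ℝ} (hv : 0 < v) (hδ : 0 < δ) :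
    P {ω | √v * (1 + Real.log (2 / δ)) ≤ ‖centredSum P h w f T ω‖ ∧ squareSum P h w f T ω ≤ v}
      ≤ ENNReal.ofReal δ := by
  -- Rescaling by `1 / √v` turns the bound `v` on the square function into one.
  set c : ℝ := (√v)⁻¹ with hc
  have hsv : 0 < √v := Real.sqrt_pos.2 hv
  have hc0 : 0 < c := inv_pos.2 hsv
  have hcv : c ^ 2 * v = 1 := by
    rw [hc, inv_pow, Real.sq_sqrt hv.le, inv_mul_cancel₀ hv.ne']
  have hmain := lintegral_cosh_centredSum_le (f := fun t p => c • f t p) hd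
    (fun t => (hf t).const_smul c)
    (fun t a => by simpa only [norm_smul, mul_pow] using (hf2 t a).const_mul (‖c‖ ^ 2)) T
  simp only [centredSum_const_smul, squareSum_const_smul] at hmain
  have hmeas : Measurable fun ω => ENNReal.ofReal (Real.cosh ‖c • centredSum P h w f T ω‖
      * Real.exp (-(c ^ 2 * squareSum P h w f T ω))) := by
    have h1 : Measurable (centredSum P h w f T) :=
      (measurable_centredSum hd hf T).mono (hd.le T) le_rfl
    have h2 : Measurable (squareSum P h w f T) :=
      (measurable_squareSum hd hf T).mono (hd.le T) le_rfl
    exact ((Real.measurable_cosh.comp (h1.const_smul c).norm).mul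
      (Real.measurable_exp.comp (h2.const_mul _).neg)).ennreal_ofReal
  have hsub : {ω | √v * (1 + Real.log (2 / δ)) ≤ ‖centredSum P h w f T ω‖ ∧
      squareSum P h w f T ω ≤ v} ⊆ {ω | ENNReal.ofReal (1 / δ) ≤
        ENNReal.ofReal (Real.cosh ‖c • centredSum P h w f T ω‖
          * Real.exp (-(c ^ 2 * squareSum P h w f T ω)))} := by
    rintro ω ⟨h1, h2⟩
    refine ENNReal.ofReal_le_ofReal ?_
    have h3 : 1 + Real.log (2 / δ) ≤ ‖c • centredSum P h w f T ω‖ := by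
      rw [norm_smul, Real.norm_of_nonneg hc0.le, hc]
      rw [inv_mul_eq_div, le_div_iff₀ hsv]
      linarith
    have h4 : c ^ 2 * squareSum P h w f T ω ≤ 1 := by
      rw [← hcv]; gcongr
    -- In `1 + log (2 / δ)` the summand `1` pays for the normaliser `exp (-1)`, and the `2` for
    -- `cosh u ≥ exp u / 2`.
    calc 1 / δ = Real.exp (1 + Real.log (2 / δ)) / 2 * Real.exp (-1) := by
          rw [div_mul_eq_mul_div, ← Real.exp_add]
          rw [show 1 + Real.log (2 / δ) + -1 = Real.log (2 / δ) by ring,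
            Real.exp_log (by positivity)]
          ring
      _ ≤ Real.cosh ‖c • centredSum P h w f T ω‖
          * Real.exp (-(c ^ 2 * squareSum P h w f T ω)) := by
          refine mul_le_mul ?_ (Real.exp_le_exp.2 (by linarith)) (Real.exp_pos _).le
            (Real.cosh_pos _).le
          rw [Real.cosh_eq]
          have := Real.exp_le_exp.2 h3
          have := Real.exp_pos (-‖c • centredSum P h w f T ω‖)
          linarith
  refine (measure_mono hsub).trans ?_
  have hmk := mul_meas_ge_le_lintegral₀ (μ := P) hmeas.aemeasurable (ENNReal.ofReal (1 / δ))
  have h5 := hmk.trans hmain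
  calc _ = ENNReal.ofReal δ * (ENNReal.ofReal (1 / δ) * _) := by
        rw [← mul_assoc, ← ENNReal.ofReal_mul hδ.le, mul_one_div_cancel hδ.ne', ENNReal.ofReal_one,
          one_mul]
    _ ≤ ENNReal.ofReal δ * 1 := by gcongr
    _ = _ := mul_one _

end Martingale

/-! ### Consequences of the `ψ₂` bounds. -/

section Psi2

variable {Ω : Type*} {mΩ : MeasurableSpace Ω} {P : Measure Ω}

lemma psi2Norm_le_condPsi2Norm {Ω : Type*} {𝓖 mΩ : MeasurableSpace Ω} {P : Measure Ω}
    [IsProbabilityMeasure P] (X : Ω → ℝ) (h𝓖 : 𝓖 ≤ mΩ) : psi2Norm X P ≤ condPsi2Norm X P 𝓖 := by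
  refine le_iInf fun k => le_iInf fun hk => le_iInf fun h => ?_
  refine iInf_le_of_le k (iInf_le_of_le hk (iInf_le_of_le ?_ le_rfl))
  rw [← ofReal_integral_eq_lintegral_ofReal h.1
    (Filter.Eventually.of_forall fun ω => (Real.exp_pos _).le)]
  refine ENNReal.ofReal_le_ofReal ?_
  rw [← integral_condExp h𝓖]
  calc _ ≤ ∫ _, Real.exp 1 ∂P := integral_mono_ae integrable_condExp (integrable_const _) h.2
    _ = _ := by simp

/-- The strict inequality provides an admissible `j < k`, so attainment of the infimum is not
needed; this is why `2 * σ` is used later. -/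
lemma lintegral_exp_sq_le_of_psi2Norm_lt {X : Ω → ℝ} {k : ℝ}
    (hX : psi2Norm X P < ENNReal.ofReal k) :
    ∫⁻ ω, ENNReal.ofReal (Real.exp (X ω ^ 2 / k ^ 2)) ∂P ≤ ENNReal.ofReal (Real.exp 1) := by
  simp only [psi2Norm, iInf_lt_iff] at hX
  obtain ⟨j, hj, h, hjk⟩ := hX
  have hjk' : j < k := ENNReal.ofReal_lt_ofReal_iff'.1 hjk |>.1
  refine le_trans (lintegral_mono fun ω => ENNReal.ofReal_le_ofReal (Real.exp_le_exp.2 ?_)) h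
  gcongr

/-- Since `u ≤ exp (u - 1)`, every `k > σ` bounds the second moment by `k²`; letting `k` decrease to
`σ` gives the sharp constant, which `card_le_snr` uses. -/
lemma lintegral_sq_le_of_psi2Norm_le {X : Ω → ℝ} {σ : ℝ} (hX : psi2Norm X P ≤ ENNReal.ofReal σ)
    (hσ : 0 < σ) : ∫⁻ ω, ENNReal.ofReal (X ω ^ 2) ∂P ≤ ENNReal.ofReal (σ ^ 2) := by
  have key : ∀ k : ℝ, σ < k →
      ∫⁻ ω, ENNReal.ofReal (X ω ^ 2) ∂P ≤ ENNReal.ofReal (k ^ 2) := by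
    intro k hk
    have hk0 : 0 < k := hσ.trans hk
    have h := lintegral_exp_sq_le_of_psi2Norm_lt
      (hX.trans_lt ((ENNReal.ofReal_lt_ofReal_iff hk0).2 hk))
    calc ∫⁻ ω, ENNReal.ofReal (X ω ^ 2) ∂P
        ≤ ∫⁻ ω, ENNReal.ofReal (k ^ 2 / Real.exp 1)
            * ENNReal.ofReal (Real.exp (X ω ^ 2 / k ^ 2)) ∂P := by
          refine lintegral_mono fun ω => ?_
          dsimp only
          rw [← ENNReal.ofReal_mul (by positivity)]
          refine ENNReal.ofReal_le_ofReal ?_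
          have h1 : X ω ^ 2 / k ^ 2 ≤ Real.exp (X ω ^ 2 / k ^ 2) / Real.exp 1 := by
            rw [← Real.exp_sub]
            linarith [Real.add_one_le_exp (X ω ^ 2 / k ^ 2 - 1)]
          calc X ω ^ 2 = k ^ 2 * (X ω ^ 2 / k ^ 2) := by field_simp
            _ ≤ k ^ 2 * (Real.exp (X ω ^ 2 / k ^ 2) / Real.exp 1) := by gcongr
            _ = _ := by ring
      _ = ENNReal.ofReal (k ^ 2 / Real.exp 1)
            * ∫⁻ ω, ENNReal.ofReal (Real.exp (X ω ^ 2 / k ^ 2)) ∂P :=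
          lintegral_const_mul' _ _ ENNReal.ofReal_ne_top
      _ ≤ ENNReal.ofReal (k ^ 2 / Real.exp 1) * ENNReal.ofReal (Real.exp 1) := by gcongr
      _ = ENNReal.ofReal (k ^ 2) := by
          rw [← ENNReal.ofReal_mul (by positivity), div_mul_cancel₀ _ (Real.exp_pos 1).ne']
  have ht : Filter.Tendsto (fun k : ℝ => ENNReal.ofReal (k ^ 2)) (nhdsWithin σ (Set.Ioi σ))
      (nhds (ENNReal.ofReal (σ ^ 2))) :=
    (ENNReal.continuous_ofReal.comp (continuous_pow 2)).continuousWithinAt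
  exact ge_of_tendsto ht (Filter.eventually_of_mem self_mem_nhdsWithin key)

variable {n : ℕ}

/-- Convexity of `exp` applied to the average over the coordinates; no independence between
coordinates is needed. -/
lemma lintegral_exp_norm_sq_le_of_psi2Norm_lt {ξ : Ω → EuclideanSpace ℝ (Fin n)} (hn : 0 < n)
    (hm : Measurable ξ) {k : ℝ} (hξ : ∀ i, psi2Norm (fun ω => ξ ω i) P < ENNReal.ofReal k) :
    ∫⁻ ω, ENNReal.ofReal (Real.exp (‖ξ ω‖ ^ 2 / (n * k ^ 2))) ∂P ≤ ENNReal.ofReal (Real.exp 1) := by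
  have hn' : (0 : ℝ) < n := by exact_mod_cast hn
  have hpt : ∀ ω, Real.exp (‖ξ ω‖ ^ 2 / (n * k ^ 2))
      ≤ ∑ i : Fin n, (1 / (n : ℝ)) * Real.exp (ξ ω i ^ 2 / k ^ 2) := by
    intro ω
    have h := convexOn_exp.map_sum_le (t := Finset.univ) (w := fun _ : Fin n => 1 / (n : ℝ))
      (p := fun i => ξ ω i ^ 2 / k ^ 2) (fun _ _ => by positivity)
      (by simp [hn'.ne']) (fun _ _ => Set.mem_univ _)
    simp only [smul_eq_mul] at h
    refine le_of_eq_of_le (congrArg Real.exp ?_) h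
    rw [EuclideanSpace.norm_sq_eq, ← Finset.mul_sum, ← Finset.sum_div]
    simp only [Real.norm_eq_abs, sq_abs]
    rw [div_mul_div_comm, one_mul]
  have hc : ∀ i, Measurable fun ω => ξ ω i := fun i => by fun_prop
  calc _ ≤ ∫⁻ ω, ∑ i : Fin n, ENNReal.ofReal (1 / (n : ℝ))
        * ENNReal.ofReal (Real.exp (ξ ω i ^ 2 / k ^ 2)) ∂P := by
        refine lintegral_mono fun ω => ?_
        simp only [← ENNReal.ofReal_mul (one_div_nonneg.2 hn'.le)]
        rw [← ENNReal.ofReal_sum_of_nonneg (fun i _ => by positivity)]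
        exact ENNReal.ofReal_le_ofReal (hpt ω)
    _ = ∑ i : Fin n, ENNReal.ofReal (1 / (n : ℝ))
        * ∫⁻ ω, ENNReal.ofReal (Real.exp (ξ ω i ^ 2 / k ^ 2)) ∂P := by
        rw [lintegral_finsetSum _ fun i _ => by fun_prop]
        simp only [lintegral_const_mul' _ _ ENNReal.ofReal_ne_top]
    _ ≤ ∑ _ : Fin n, ENNReal.ofReal (1 / (n : ℝ)) * ENNReal.ofReal (Real.exp 1) := by
        gcongr with i
        exact lintegral_exp_sq_le_of_psi2Norm_lt (hξ i)
    _ = _ := by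
        rw [Finset.sum_const, Finset.card_univ, Fintype.card_fin, nsmul_eq_mul, ← mul_assoc,
          ← ENNReal.ofReal_natCast, ← ENNReal.ofReal_mul hn'.le, mul_one_div_cancel hn'.ne',
          ENNReal.ofReal_one, one_mul]

lemma lintegral_norm_sq_le_of_psi2Norm_le {ξ : Ω → EuclideanSpace ℝ (Fin n)}
    (hm : Measurable ξ) {σ : ℝ} (hσ : 0 < σ)
    (hξ : ∀ i, psi2Norm (fun ω => ξ ω i) P ≤ ENNReal.ofReal σ) :
    ∫⁻ ω, ENNReal.ofReal (‖ξ ω‖ ^ 2) ∂P ≤ ENNReal.ofReal (n * σ ^ 2) := by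
  have hc : ∀ i, Measurable fun ω => ξ ω i := fun i => by fun_prop
  calc _ = ∫⁻ ω, ∑ i : Fin n, ENNReal.ofReal (ξ ω i ^ 2) ∂P := by
        refine lintegral_congr fun ω => ?_
        rw [EuclideanSpace.norm_sq_eq, ENNReal.ofReal_sum_of_nonneg fun i _ => by positivity]
        simp only [Real.norm_eq_abs, sq_abs]
    _ = ∑ i : Fin n, ∫⁻ ω, ENNReal.ofReal (ξ ω i ^ 2) ∂P :=
        lintegral_finsetSum _ fun i _ => by fun_prop
    _ ≤ ∑ _ : Fin n, ENNReal.ofReal (σ ^ 2) := by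
        gcongr with i
        exact lintegral_sq_le_of_psi2Norm_le (hξ i) hσ
    _ = _ := by
        rw [Finset.sum_const, Finset.card_univ, Fintype.card_fin, nsmul_eq_mul,
          ← ENNReal.ofReal_natCast, ← ENNReal.ofReal_mul (Nat.cast_nonneg n)]

end Psi2

/-! ### Subexponential variables and sums of their truncated squares. -/

section ExpSq

variable {Ω : Type*} {mΩ : MeasurableSpace Ω} {P : Measure Ω} [IsProbabilityMeasure P]

/-- A nonnegative random variable whose exponential has expectation at most `e`. -/
structure IsSubExp (X : Ω → ℝ) (P : Measure Ω) : Prop where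
  measurable : Measurable X
  nonneg : ∀ ω, 0 ≤ X ω
  integrable : Integrable (fun ω => Real.exp (X ω)) P
  integral_le : ∫ ω, Real.exp (X ω) ∂P ≤ Real.exp 1

lemma isSubExp_of_lintegral_le {X : Ω → ℝ} (hX : Measurable X) (h0 : ∀ ω, 0 ≤ X ω)
    (h : ∫⁻ ω, ENNReal.ofReal (Real.exp (X ω)) ∂P ≤ ENNReal.ofReal (Real.exp 1)) :
    IsSubExp X P := by
  have hm : Measurable fun ω => Real.exp (X ω) := Real.measurable_exp.comp hX
  have hnn : 0 ≤ᵐ[P] fun ω => Real.exp (X ω) :=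
    Filter.Eventually.of_forall fun ω => (Real.exp_pos _).le
  refine ⟨hX, h0, ⟨hm.aestronglyMeasurable, ?_⟩, ?_⟩
  · rw [hasFiniteIntegral_iff_ofReal hnn]
    exact h.trans_lt ENNReal.ofReal_lt_top
  · rw [integral_eq_lintegral_of_nonneg_ae hnn hm.aestronglyMeasurable]
    exact ENNReal.toReal_le_of_le_ofReal (Real.exp_pos _).le h

namespace IsSubExp

variable {X : Ω → ℝ}

lemma measure_lt_le (h : IsSubExp X P) (u : ℝ) :
    P {ω | u ≤ X ω} ≤ ENNReal.ofReal (Real.exp (1 - u)) := by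
  have hmk := mul_meas_ge_le_integral_of_nonneg
    (Filter.Eventually.of_forall fun ω => (Real.exp_pos (X ω)).le) h.integrable (Real.exp u)
  have hset : {ω | Real.exp u ≤ Real.exp (X ω)} = {ω | u ≤ X ω} := by
    ext ω; simp
  rw [hset] at hmk
  have h2 := hmk.trans h.integral_le
  rw [← ofReal_measureReal]
  refine ENNReal.ofReal_le_ofReal ?_
  rw [Real.exp_sub, le_div_iff₀ (Real.exp_pos _)]
  linarith

lemma integrable_sq (h : IsSubExp X P) : Integrable (fun ω => X ω ^ 2) P :=
  (h.integrable.const_mul 2).mono' (h.measurable.pow_const 2).aestronglyMeasurable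
    (Filter.Eventually.of_forall fun ω => by
      rw [Real.norm_of_nonneg (sq_nonneg _)]
      linarith [Real.quadratic_le_exp_of_nonneg (h.nonneg ω), h.nonneg ω])

lemma integral_sq_le (h : IsSubExp X P) : ∫ ω, X ω ^ 2 ∂P ≤ 6 := by
  calc ∫ ω, X ω ^ 2 ∂P ≤ ∫ ω, 2 * Real.exp (X ω) ∂P :=
        integral_mono h.integrable_sq (h.integrable.const_mul 2) fun ω => by
          dsimp only
          linarith [Real.quadratic_le_exp_of_nonneg (h.nonneg ω), h.nonneg ω]
    _ ≤ 6 := by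
        rw [integral_const_mul]
        linarith [h.integral_le, Real.exp_one_lt_d9]

lemma integrable_self (h : IsSubExp X P) : Integrable X P :=
  h.integrable.mono' h.measurable.aestronglyMeasurable
    (Filter.Eventually.of_forall fun ω => by
      rw [Real.norm_of_nonneg (h.nonneg ω)]
      linarith [Real.add_one_le_exp (X ω)])

lemma integral_self_le (h : IsSubExp X P) : ∫ ω, X ω ∂P ≤ 1 := by
  calc ∫ ω, X ω ∂P ≤ ∫ ω, Real.exp (X ω) / Real.exp 1 ∂P :=
        integral_mono h.integrable_self (h.integrable.div_const _) fun ω => by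
          dsimp only
          rw [← Real.exp_sub]
          linarith [Real.add_one_le_exp (X ω - 1)]
    _ ≤ 1 := by
        rw [integral_div, div_le_one (Real.exp_pos 1)]
        exact h.integral_le

lemma mgf_min_sq_le (h : IsSubExp X P) {M : ℝ} (hM : 0 < M) :
    mgf (fun ω => min (X ω) M ^ 2) P (1 / (2 * M)) ≤ Real.exp (8 * Real.exp 1 * (1 / (2 * M))) := by
  set θ := 1 / (2 * M) with hθ
  have hθ0 : 0 < θ := by positivity
  have hpt : ∀ ω, Real.exp (θ * min (X ω) M ^ 2) ≤ 1 + 8 * θ * Real.exp (X ω) := by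
    intro ω
    set u := min (X ω) M with hu
    have hu0 : 0 ≤ u := le_min (h.nonneg ω) hM.le
    have h1 : θ * u ^ 2 ≤ u / 2 := by
      have : u ≤ M := min_le_right _ _
      rw [hθ, one_div_mul_eq_div, div_le_div_iff₀ (by positivity) (by norm_num)]
      nlinarith
    have h2 : Real.exp (θ * u ^ 2) ≤ 1 + θ * u ^ 2 * Real.exp (θ * u ^ 2) := by
      have := Real.add_one_le_exp (-(θ * u ^ 2))
      have hpos := Real.exp_pos (θ * u ^ 2)
      have hmul : Real.exp (-(θ * u ^ 2)) * Real.exp (θ * u ^ 2) = 1 := by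
        rw [← Real.exp_add]; simp
      nlinarith
    have h3 : u ^ 2 ≤ 8 * Real.exp (u / 2) := by
      nlinarith [Real.quadratic_le_exp_of_nonneg (show 0 ≤ u / 2 by positivity)]
    calc Real.exp (θ * u ^ 2) ≤ 1 + θ * u ^ 2 * Real.exp (θ * u ^ 2) := h2
      _ ≤ 1 + θ * (8 * Real.exp (u / 2)) * Real.exp (u / 2) := by gcongr
      _ = 1 + 8 * θ * Real.exp u := by
          rw [show u = u / 2 + u / 2 by ring, Real.exp_add]; ring_nf
      _ ≤ _ := by
          have : u ≤ X ω := min_le_left _ _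
          gcongr
  unfold mgf
  calc _ ≤ ∫ ω, (1 + 8 * θ * Real.exp (X ω)) ∂P := by
        refine integral_mono_of_nonneg (Filter.Eventually.of_forall fun ω => (Real.exp_pos _).le)
          ((integrable_const _).add (h.integrable.const_mul _)) (Filter.Eventually.of_forall hpt)
    _ = 1 + 8 * θ * ∫ ω, Real.exp (X ω) ∂P := by
        rw [integral_add (integrable_const _) (h.integrable.const_mul _), integral_const_mul]
        simp
    _ ≤ 1 + 8 * θ * Real.exp 1 := by
        have := h.integral_le
        gcongr
    _ ≤ _ := by linarith [Real.add_one_le_exp (8 * Real.exp 1 * θ)]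

end IsSubExp

lemma measure_exists_ge_le {X : ℕ → Ω → ℝ} (hX : ∀ s, IsSubExp (X s) P) (N : ℕ) {δ : ℝ}
    (hδ : 0 < δ) (hN : 0 < N) :
    P {ω | ∃ s < N, 1 + Real.log (N / δ) ≤ X s ω} ≤ ENNReal.ofReal δ := by
  have hN' : (0 : ℝ) < N := by exact_mod_cast hN
  have hset : {ω | ∃ s < N, 1 + Real.log (N / δ) ≤ X s ω}
      = ⋃ s ∈ Finset.range N, {ω | 1 + Real.log (N / δ) ≤ X s ω} := by
    ext ω; simp
  rw [hset]
  calc _ ≤ ∑ s ∈ Finset.range N, P {ω | 1 + Real.log (N / δ) ≤ X s ω} :=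
        measure_biUnion_finset_le _ _
    _ ≤ ∑ _s ∈ Finset.range N, ENNReal.ofReal (δ / N) := by
        gcongr with s
        refine ((hX s).measure_lt_le _).trans (le_of_eq ?_)
        rw [sub_add_cancel_left, Real.exp_neg, Real.exp_log (by positivity), inv_div]
    _ = _ := by
        rw [Finset.sum_const, Finset.card_range, nsmul_eq_mul, ← ENNReal.ofReal_natCast,
          ← ENNReal.ofReal_mul hN'.le, mul_div_cancel₀ _ hN'.ne']

lemma measure_sum_min_sq_ge_le {X : ℕ → Ω → ℝ} (hX : ∀ s, IsSubExp (X s) P)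
    (hind : iIndepFun X P) (N : ℕ) {M δ : ℝ} (hM : 0 < M) (hδ : 0 < δ) :
    P {ω | 8 * Real.exp 1 * N + 2 * M * Real.log (1 / δ)
      ≤ ∑ s ∈ Finset.range N, min (X s ω) M ^ 2} ≤ ENNReal.ofReal δ := by
  set θ := 1 / (2 * M) with hθ
  have hθ0 : 0 < θ := by positivity
  set Y : ℕ → Ω → ℝ := fun s ω => min (X s ω) M ^ 2 with hY
  have hYm : ∀ s, Measurable (Y s) := fun s => ((hX s).measurable.min measurable_const).pow_const 2
  have hYind : iIndepFun Y P := hind.comp (fun _ u => min u M ^ 2) fun s =>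
    (measurable_id.min measurable_const).pow_const 2
  have hYb : ∀ s ω, Y s ω ≤ M ^ 2 := fun s ω =>
    pow_le_pow_left₀ (le_min ((hX s).nonneg ω) hM.le) (min_le_right _ _) 2
  have hint : Integrable (fun ω => Real.exp (θ * (∑ s ∈ Finset.range N, Y s) ω)) P := by
    refine Integrable.mono' (integrable_const (Real.exp (θ * (N * M ^ 2)))) ?_
      (Filter.Eventually.of_forall fun ω => ?_)
    · have hsm : Measurable (∑ s ∈ Finset.range N, Y s) :=
        Finset.sum_fn (Finset.range N) Y ▸ Finset.measurable_sum (Finset.range N) fun s _ => hYm s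
      exact (Real.measurable_exp.comp (hsm.const_mul θ)).aestronglyMeasurable
    · rw [Real.norm_of_nonneg (Real.exp_pos _).le, Finset.sum_apply]
      refine Real.exp_le_exp.2 ?_
      gcongr
      calc _ ≤ ∑ _s ∈ Finset.range N, M ^ 2 := Finset.sum_le_sum fun s _ => hYb s ω
        _ = _ := by simp
  have hch := measure_ge_le_exp_mul_mgf (μ := P) (X := ∑ s ∈ Finset.range N, Y s)
    (8 * Real.exp 1 * N + 2 * M * Real.log (1 / δ)) hθ0.le hint
  rw [hYind.mgf_sum hYm] at hch
  have hprod : ∏ s ∈ Finset.range N, mgf (Y s) P θ ≤ Real.exp (8 * Real.exp 1 * θ) ^ N := by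
    calc _ ≤ ∏ _s ∈ Finset.range N, Real.exp (8 * Real.exp 1 * θ) :=
          Finset.prod_le_prod (fun s _ => mgf_nonneg) fun s _ => (hX s).mgf_min_sq_le hM
      _ = _ := by simp
  have hfin : P.real {ω | 8 * Real.exp 1 * N + 2 * M * Real.log (1 / δ)
      ≤ (∑ s ∈ Finset.range N, Y s) ω} ≤ δ := by
    refine hch.trans ((mul_le_mul_of_nonneg_left hprod (Real.exp_pos _).le).trans (le_of_eq ?_))
    rw [← Real.exp_nat_mul, ← Real.exp_add]
    have : -θ * (8 * Real.exp 1 * N + 2 * M * Real.log (1 / δ)) + N * (8 * Real.exp 1 * θ)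
        = Real.log δ := by
      rw [one_div, Real.log_inv, hθ]; field_simp; ring
    rw [this, Real.exp_log hδ]
  rw [← ofReal_measureReal]
  simp only [Finset.sum_apply] at hfin
  exact ENNReal.ofReal_le_ofReal hfin

end ExpSq

/-! ### Conditional expectation as integration over the noise. -/

section CondExp

variable {Ω α β : Type*} {𝓖 mΩ : MeasurableSpace Ω} [MeasurableSpace α] [MeasurableSpace β]
  {P : Measure Ω} [IsProbabilityMeasure P]

lemma integrable_integral_comp_prodMk {X : Ω → α} {W : Ω → β} (hX : Measurable X)
    (hW : Measurable W) (hXW : IndepFun X W P) {F : α × β → ℝ} (hF : Measurable F)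
    (hi : Integrable (fun ω => F (X ω, W ω)) P) :
    Integrable (fun ω => ∫ y, F (X ω, y) ∂(P.map W)) P ∧
      ∫ ω, F (X ω, W ω) ∂P = ∫ ω, ∫ y, F (X ω, y) ∂(P.map W) ∂P := by
  have h := (indepFun_iff_map_prod_eq_prod_map_map hX.aemeasurable hW.aemeasurable).1 hXW
  have : IsProbabilityMeasure (P.map W) := Measure.isProbabilityMeasure_map hW.aemeasurable
  have : IsProbabilityMeasure (P.map X) := Measure.isProbabilityMeasure_map hX.aemeasurable
  have hFi : Integrable F ((P.map X).prod (P.map W)) := by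
    rw [← h]
    exact (integrable_map_measure hF.aestronglyMeasurable (hX.prodMk hW).aemeasurable).2 hi
  have hs : AEStronglyMeasurable (fun x => ∫ y, F (x, y) ∂(P.map W)) (P.map X) :=
    hF.stronglyMeasurable.integral_prod_right'.aestronglyMeasurable
  refine ⟨(integrable_map_measure hs hX.aemeasurable).1 hFi.integral_prod_left, ?_⟩
  rw [← integral_map hX.aemeasurable hs, ← integral_prod _ hFi, ← h,
    integral_map (hX.prodMk hW).aemeasurable hF.aestronglyMeasurable]

/-- Conditioning on the past integrates out the noise. -/
lemma condExp_comp_prodMk_ae_eq (h𝓖 : 𝓖 ≤ mΩ) {X : Ω → α} {W : Ω → β} (hX : Measurable[𝓖] X)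
    (hW : Measurable W) (hind : Indep 𝓖 (MeasurableSpace.comap W inferInstance) P)
    {F : α × β → ℝ} (hF : Measurable F) (hi : Integrable (fun ω => F (X ω, W ω)) P) :
    (fun ω => ∫ y, F (X ω, y) ∂(P.map W)) =ᵐ[P] P[fun ω => F (X ω, W ω) | 𝓖] := by
  have : IsProbabilityMeasure (P.map W) := Measure.isProbabilityMeasure_map hW.aemeasurable
  have hXm : Measurable X := hX.mono h𝓖 le_rfl
  have hXW : IndepFun X W P :=
    (IndepFun_iff_Indep _ _ _).2 (indep_of_indep_of_le_left hind hX.comap_le)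
  refine ae_eq_condExp_of_forall_setIntegral_eq h𝓖 hi ?_ ?_ ?_
  · intro s _ _
    exact (integrable_integral_comp_prodMk hXm hW hXW hF hi).1.integrableOn
  · intro s hs _
    have hsm : MeasurableSet s := h𝓖 s hs
    -- Adjoining the indicator of `s` to `X` turns the integral over `s` into a full expectation of
    -- a function of independent variables.
    have hZ : Measurable[𝓖] fun ω => (s.indicator (fun _ => (1 : ℝ)) ω, X ω) :=
      (measurable_const.indicator hs).prodMk hX
    have hZW : IndepFun (fun ω => (s.indicator (fun _ => (1 : ℝ)) ω, X ω)) W P :=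
      (IndepFun_iff_Indep _ _ _).2 (indep_of_indep_of_le_left hind hZ.comap_le)
    have hG : Measurable fun p : (ℝ × α) × β => p.1.1 * F (p.1.2, p.2) :=
      (measurable_fst.comp measurable_fst).mul
        (hF.comp ((measurable_snd.comp measurable_fst).prodMk measurable_snd))
    have hpt : ∀ (g : Ω → ℝ), (fun ω => s.indicator (fun _ => (1 : ℝ)) ω * g ω) = s.indicator g := by
      intro g
      ext ω
      by_cases hω : ω ∈ s <;> simp [hω]
    have hGi : Integrable
        (fun ω => s.indicator (fun _ => (1 : ℝ)) ω * F (X ω, W ω)) P := by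
      rw [hpt fun ω => F (X ω, W ω)]
      exact hi.indicator hsm
    have h2 := (integrable_integral_comp_prodMk (hZ.mono h𝓖 le_rfl) hW hZW hG hGi).2
    dsimp only at h2
    simp only [integral_const_mul] at h2
    rw [hpt fun ω => F (X ω, W ω), hpt fun ω => ∫ y, F (X ω, y) ∂(P.map W),
      integral_indicator hsm, integral_indicator hsm] at h2
    exact h2.symm
  · exact ((hF.stronglyMeasurable.integral_prod_right'.measurable).comp
      hX).stronglyMeasurable.aestronglyMeasurable

end CondExp

/-! ### The dynamical system, its filtrations and excitation. -/

section System

variable {n m : ℕ}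

lemma norm_act_le (A : Matrix (Fin n) (Fin m) ℝ) (v : EuclideanSpace ℝ (Fin m)) :
    ‖act A v‖ ≤ ‖A‖ * ‖v‖ := A.l2_opNorm_mulVec v

lemma act_apply (A : Matrix (Fin n) (Fin m) ℝ) (v : EuclideanSpace ℝ (Fin m)) (i : Fin n) :
    act A v i = inner ℝ (row A i) v := by
  simp [act, row, Matrix.mulVec, dotProduct, PiLp.inner_apply, mul_comm]

lemma continuous_act (A : Matrix (Fin n) (Fin m) ℝ) : Continuous (act A) := by
  unfold act
  fun_prop

variable {A : Matrix (Fin n) (Fin m) ℝ} {φ : EuclideanSpace ℝ (Fin n) → EuclideanSpace ℝ (Fin m)}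
  {L : ℝ≥0}

namespace IsStableSystem

lemma norm_map_le (hs : IsStableSystem A φ L) (v : EuclideanSpace ℝ (Fin n)) :
    ‖φ v‖ ≤ L * ‖v‖ := by
  have := hs.lipschitz.dist_le_mul v 0
  simpa [hs.map_zero] using this

lemma norm_act_map_le (hs : IsStableSystem A φ L) (v : EuclideanSpace ℝ (Fin n)) :
    ‖act A (φ v)‖ ≤ ‖A‖ * L * ‖v‖ := by
  rw [mul_assoc]
  exact (norm_act_le A _).trans (mul_le_mul_of_nonneg_left (hs.norm_map_le v) (norm_nonneg _))

lemma continuous_map (hs : IsStableSystem A φ L) : Continuous φ := hs.lipschitz.continuous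

end IsStableSystem

variable {Ω : Type*} {mΩ : MeasurableSpace Ω} {P : Measure Ω} [IsProbabilityMeasure P]
  {x w : ℕ → Ω → EuclideanSpace ℝ (Fin n)}

/-- The sigma-algebra generated by the initial state and the first `t` disturbances. -/
abbrev noiseSigma (x w : ℕ → Ω → EuclideanSpace ℝ (Fin n)) (t : ℕ) : MeasurableSpace Ω :=
  ⨆ s ∈ Set.Iic t, MeasurableSpace.comap (initAndNoise x w s) inferInstance

lemma IsSystem.measurable_initAndNoise (hsys : IsSystem A φ x w) (t : ℕ) :
    Measurable (initAndNoise x w t) := by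
  cases t with
  | zero => exact hsys.measurable_init
  | succ t => exact hsys.measurable_noise t

lemma measurable_noiseSigma {s t : ℕ} (hst : s ≤ t) :
    Measurable[noiseSigma x w t] (initAndNoise x w s) :=
  measurable_iff_comap_le.2 (le_biSup (fun s => MeasurableSpace.comap (initAndNoise x w s)
    inferInstance) (Set.mem_Iic.2 hst))

lemma IsSystem.measurable_state (hsys : IsSystem A φ x w) (hs : IsStableSystem A φ L) (t : ℕ) :
    Measurable[noiseSigma x w t] (x t) := by
  induction t with
  | zero => exact measurable_noiseSigma (x := x) (w := w) le_rfl
  | succ t ih =>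
    have h1 : Measurable[noiseSigma x w (t + 1)] (x t) :=
      ih.mono (biSup_mono fun s hs => Set.mem_Iic.2 (le_trans (Set.mem_Iic.1 hs) (Nat.le_succ t)))
        le_rfl
    have h2 : Measurable[noiseSigma x w (t + 1)] (w t) :=
      measurable_noiseSigma (x := x) (w := w) (s := t + 1) le_rfl
    have h3 : x (t + 1) = fun ω => act A (φ (x t ω)) + w t ω := funext fun ω => hsys.dynamics t ω
    rw [h3]
    exact (((continuous_act A).comp hs.continuous_map).measurable.comp h1).add h2

lemma isDriven (hsys : IsSystem A φ x w) (hs : IsStableSystem A φ L)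
    (hz : IsZeroMeanIndepNoise x w P) : IsDriven (noiseSigma x w) x w P where
  mono s t hst := biSup_mono fun u hu => Set.mem_Iic.2 (le_trans (Set.mem_Iic.1 hu) hst)
  le t := iSup₂_le fun s _ => (hsys.measurable_initAndNoise s).comap_le
  adapted := hsys.measurable_state hs
  noise t := measurable_noiseSigma (x := x) (w := w) (s := t + 1) le_rfl
  indep t := by
    have h := indep_iSup_of_disjoint (fun s => (hsys.measurable_initAndNoise s).comap_le)
      hz.indep (S := Set.Iic t) (T := {t + 1}) (by simp)
    rw [iSup_singleton] at h
    exact h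

/-- Sub-Gaussianity and excitation are relative to the states, independence to the noise; this
inclusion connects them. -/
lemma pastSigma_le_noiseSigma (hsys : IsSystem A φ x w) (hs : IsStableSystem A φ L) (t : ℕ) :
    pastSigma x t ≤ noiseSigma x w t := by
  refine iSup₂_le fun s hst => ?_
  have h : Measurable[noiseSigma x w t] (x s) := (hsys.measurable_state hs s).mono
    (biSup_mono fun u hu => Set.mem_Iic.2 (le_trans (Set.mem_Iic.1 hu) hst)) le_rfl
  exact h.comap_le

lemma measurable_pastSigma (t : ℕ) : Measurable[pastSigma x t] (x t) :=
  measurable_iff_comap_le.2 (le_biSup (fun s => MeasurableSpace.comap (x s)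
    inferInstance) (Set.mem_Iic.2 le_rfl))

lemma memLp_state (hsys : IsSystem A φ x w) (hs : IsStableSystem A φ L)
    (h0 : MemLp (x 0) 2 P) (hw : ∀ t, MemLp (w t) 2 P) (t : ℕ) : MemLp (x t) 2 P := by
  induction t with
  | zero => exact h0
  | succ t ih =>
    have h3 : x (t + 1) = fun ω => act A (φ (x t ω)) + w t ω := funext fun ω => hsys.dynamics t ω
    rw [h3]
    refine MemLp.add (ih.of_le_mul (c := ‖A‖ * L) ?_ (Filter.Eventually.of_forall fun ω =>
      hs.norm_act_map_le _)) (hw t)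
    exact ((continuous_act A).comp hs.continuous_map).comp_aestronglyMeasurable ih.1

lemma memLp_coord {S : Type*} [MeasurableSpace S] {ν : Measure S}
    {ψ : S → EuclideanSpace ℝ (Fin m)} (hψ : MemLp ψ 2 ν) (j : Fin m) :
    MemLp (fun y => ψ y j) 2 ν :=
  hψ.of_le ((by fun_prop : Continuous fun u : EuclideanSpace ℝ (Fin m) => u j)
    |>.comp_aestronglyMeasurable hψ.1)
    (Filter.Eventually.of_forall fun _ => PiLp.norm_apply_le _ j)

lemma integral_inner_sq {S : Type*} [MeasurableSpace S] {ν : Measure S}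
    {ψ : S → EuclideanSpace ℝ (Fin m)} (hψ : MemLp ψ 2 ν) (v : EuclideanSpace ℝ (Fin m)) :
    ∫ y, inner ℝ v (ψ y) ^ 2 ∂ν = ∑ j, ∑ k, v j * v k * ∫ y, ψ y j * ψ y k ∂ν := by
  have hi : ∀ j k, Integrable (fun y => v j * v k * (ψ y j * ψ y k)) ν := fun j k =>
    ((memLp_coord hψ j).integrable_mul (memLp_coord hψ k)).const_mul _
  have hexp : ∀ y, inner ℝ v (ψ y) ^ 2 = ∑ j, ∑ k, v j * v k * (ψ y j * ψ y k) := by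
    intro y
    rw [PiLp.inner_apply, sq, Finset.sum_mul_sum]
    refine Finset.sum_congr rfl fun j _ => Finset.sum_congr rfl fun k _ => ?_
    simp only [RCLike.inner_apply, conj_trivial]
    ring
  simp only [hexp]
  rw [integral_finsetSum _ fun j _ => integrable_finsetSum _ fun k _ => hi j k]
  refine Finset.sum_congr rfl fun j _ => ?_
  rw [integral_finsetSum _ fun k _ => hi j k]
  exact Finset.sum_congr rfl fun k _ => integral_const_mul _ _

lemma le_sum_of_posSemidef_sub_smul_one {M : Matrix (Fin m) (Fin m) ℝ} {c : ℝ}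
    (hM : (M - c • (1 : Matrix (Fin m) (Fin m) ℝ)).PosSemidef) (v : EuclideanSpace ℝ (Fin m)) :
    c * ‖v‖ ^ 2 ≤ ∑ j, ∑ k, v j * v k * M j k := by
  have hpos := hM.dotProduct_mulVec_nonneg v.ofLp
  simp only [Matrix.sub_mulVec, Matrix.smul_mulVec, Matrix.one_mulVec, dotProduct_sub,
    star_trivial, dotProduct_smul] at hpos
  have hnorm : v.ofLp ⬝ᵥ v.ofLp = ‖v‖ ^ 2 := by
    rw [EuclideanSpace.norm_sq_eq]
    simp [dotProduct, sq]
  have hsum : v.ofLp ⬝ᵥ M *ᵥ v.ofLp = ∑ j, ∑ k, v j * v k * M j k := by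
    simp only [dotProduct, Matrix.mulVec, Finset.mul_sum]
    exact Finset.sum_congr rfl fun j _ => Finset.sum_congr rfl fun k _ => by ring
  rw [hnorm, hsum, smul_eq_mul] at hpos
  linarith

lemma continuous_step (hs : IsStableSystem A φ L) :
    Continuous fun p : EuclideanSpace ℝ (Fin n) × EuclideanSpace ℝ (Fin n) =>
      φ (act A (φ p.1) + p.2) :=
  hs.continuous_map.comp
    (((continuous_act A).comp (hs.continuous_map.comp continuous_fst)).add continuous_snd)

lemma memLp_map_comp (hs : IsStableSystem A φ L) {S : Type*} [MeasurableSpace S] {ν : Measure S}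
    {ψ : S → EuclideanSpace ℝ (Fin n)} (hψ : MemLp ψ 2 ν) : MemLp (fun y => φ (ψ y)) 2 ν :=
  hψ.of_le_mul (hs.continuous_map.comp_aestronglyMeasurable hψ.1)
    (Filter.Eventually.of_forall fun _ => hs.norm_map_le _)

lemma memLp_id_map {w : Ω → EuclideanSpace ℝ (Fin n)} (hm : Measurable w) (hw : MemLp w 2 P) :
    MemLp (fun y => y) 2 (P.map w) :=
  (memLp_map_measure_iff measurable_id.aestronglyMeasurable hm.aemeasurable).2 hw

lemma memLp_step (hs : IsStableSystem A φ L) {w : Ω → EuclideanSpace ℝ (Fin n)}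
    (hm : Measurable w) (hw : MemLp w 2 P) (u : EuclideanSpace ℝ (Fin n)) :
    MemLp (fun y => φ (act A (φ u) + y)) 2 (P.map w) := by
  have hp : IsProbabilityMeasure (P.map w) := Measure.isProbabilityMeasure_map hm.aemeasurable
  have h1 : MemLp (fun _ : EuclideanSpace ℝ (Fin n) => act A (φ u)) 2 (P.map w) := memLp_const _
  exact memLp_map_comp hs (h1.add (memLp_id_map hm hw))

/-- Markov property: given the past, the next state depends only on `x t` and on fresh noise, so the
excitation hypothesis becomes a statement about an integral over the law of `w t`. -/
lemma integral_step_ae_eq_condExp (hsys : IsSystem A φ x w) (hs : IsStableSystem A φ L)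
    (hz : IsZeroMeanIndepNoise x w P) (h0 : MemLp (x 0) 2 P) (hw : ∀ t, MemLp (w t) 2 P)
    (t : ℕ) (j k : Fin m) :
    (fun ω => ∫ y, φ (act A (φ (x t ω)) + y) j * φ (act A (φ (x t ω)) + y) k ∂(P.map (w t)))
      =ᵐ[P] P[fun ω' => φ (x (t + 1) ω') j * φ (x (t + 1) ω') k | pastSigma x t] := by
  have hd := isDriven hsys hs hz
  have hle := pastSigma_le_noiseSigma hsys hs t
  have hφL := memLp_map_comp hs (memLp_state hsys hs h0 hw (t + 1))
  have hp : Integrable (fun ω => φ (x (t + 1) ω) j * φ (x (t + 1) ω) k) P :=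
    (memLp_coord hφL j).integrable_mul (memLp_coord hφL k)
  have hFm : Measurable fun p : EuclideanSpace ℝ (Fin n) × EuclideanSpace ℝ (Fin n) =>
      φ (act A (φ p.1) + p.2) j * φ (act A (φ p.1) + p.2) k := by
    have hc : ∀ j, Continuous fun p : EuclideanSpace ℝ (Fin n) × EuclideanSpace ℝ (Fin n) =>
        φ (act A (φ p.1) + p.2) j := fun j =>
      (by fun_prop : Continuous fun u : EuclideanSpace ℝ (Fin m) => u j).comp (continuous_step hs)
    exact ((hc j).mul (hc k)).measurable
  simp only [hsys.dynamics] at hp ⊢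
  exact condExp_comp_prodMk_ae_eq (hle.trans (hd.le t)) (measurable_pastSigma t)
    (hd.measurable_noise t) (indep_of_indep_of_le_left (hd.indep t) hle) hFm hp

/-- Excitation, as a lower bound on the second moments of the next feature vector. -/
lemma sq_le_integral_inner_sq (hsys : IsSystem A φ x w) (hs : IsStableSystem A φ L)
    (hz : IsZeroMeanIndepNoise x w P) (h0 : MemLp (x 0) 2 P) (hw : ∀ t, MemLp (w t) 2 P)
    {lam : ℝ} {T : ℕ} (hexc : IsExcited φ x lam T P) :
    ∀ᵐ ω ∂P, ∀ t < T, ∀ v : EuclideanSpace ℝ (Fin m), lam ^ 2 * ‖v‖ ^ 2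
      ≤ ∫ y, inner ℝ v (φ (act A (φ (x t ω)) + y)) ^ 2 ∂(P.map (w t)) := by
  refine ae_all_iff.2 fun t => ae_all_iff.2 fun ht => ?_
  have hall : ∀ᵐ ω ∂P, ∀ j k,
      ∫ y, φ (act A (φ (x t ω)) + y) j * φ (act A (φ (x t ω)) + y) k ∂(P.map (w t))
        = (P[fun ω' => φ (x (t + 1) ω') j * φ (x (t + 1) ω') k | pastSigma x t]) ω := by
    exact ae_all_iff.2 fun j => ae_all_iff.2 fun k =>
      integral_step_ae_eq_condExp hsys hs hz h0 hw t j k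
  -- One null set serves all directions `v`, since semidefiniteness of the matrix holds almost
  -- surely.
  filter_upwards [hall, hexc t ht] with ω h1 h3 v
  have h2 : MemLp (fun y => φ (act A (φ (x t ω)) + y)) 2 (P.map (w t)) :=
    memLp_step hs (hsys.measurable_noise t) (hw t) _
  rw [integral_inner_sq h2]
  simp only [h1]
  exact le_sum_of_posSemidef_sub_smul_one h3 v

end System

/-! ### The Huber loss and its deterministic error bound. -/

section Huber

/-- The derivative of the Huber loss. -/
noncomputable def clip (μ z : ℝ) : ℝ := max (-μ) (min z μ)

lemma measurable_clip (μ : ℝ) : Measurable (clip μ) :=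
  measurable_const.max (measurable_id.min measurable_const)

lemma abs_clip_le {μ : ℝ} (hμ : 0 < μ) (z : ℝ) : |clip μ z| ≤ μ :=
  abs_le.2 ⟨le_max_left _ _, max_le (by linarith) (min_le_right _ _)⟩

lemma clip_neg {μ : ℝ} (hμ : 0 < μ) (z : ℝ) : clip μ (-z) = -clip μ z := by
  unfold clip
  rcases le_total z μ with h1 | h1 <;> rcases le_total (-μ) z with h2 | h2
  · rw [min_eq_left h1, max_eq_right h2, min_eq_left (by linarith), max_eq_right (by linarith)]
  · rw [min_eq_left h1, max_eq_left h2, min_eq_right (by linarith), max_eq_right (by linarith),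
      neg_neg]
  · rw [min_eq_right h1, min_eq_left (by linarith), max_eq_left (by linarith),
      max_eq_right (by linarith)]
  · linarith

lemma clip_of_abs_le {μ z : ℝ} (hz : |z| ≤ μ) : clip μ z = z := by
  have := abs_le.1 hz
  rw [clip, min_eq_left this.2, max_eq_right this.1]

/-- Dual description: the Huber loss is the maximum of the affine functions `p * z - p ^ 2 / 2` over
`|p| ≤ μ`, attained at `p = clip μ z` (`huber_eq`). The subgradient inequality and convexity follow
without differentiation. -/
lemma mul_sub_sq_le_huber {μ p : ℝ} (hp : |p| ≤ μ) (z : ℝ) : p * z - p ^ 2 / 2 ≤ huber μ z := by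
  unfold huber
  split_ifs with h
  · nlinarith [sq_nonneg (z - p)]
  · have h1 : p * z ≤ |p| * |z| := by rw [← abs_mul]; exact le_abs_self _
    rw [← sq_abs p]
    nlinarith [abs_nonneg p]

lemma huber_eq {μ : ℝ} (hμ : 0 < μ) (z : ℝ) :
    huber μ z = clip μ z * z - clip μ z ^ 2 / 2 := by
  unfold huber
  split_ifs with h
  · rw [clip_of_abs_le h]; ring
  · rcases le_total 0 z with hz | hz
    · rw [abs_of_nonneg hz] at h ⊢
      rw [clip, min_eq_right (by linarith), max_eq_right (by linarith)]
    · rw [abs_of_nonpos hz] at h ⊢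
      rw [clip, min_eq_left (by linarith), max_eq_left (by linarith)]
      ring

lemma huber_sub_ge {μ : ℝ} (hμ : 0 < μ) (z s : ℝ) :
    huber μ z - clip μ z * s ≤ huber μ (z - s) := by
  have h := mul_sub_sq_le_huber (abs_clip_le hμ z) (z - s)
  rw [huber_eq hμ z]
  linarith

lemma huber_sub_ge_of_small {μ : ℝ} (hμ : 0 < μ) {z s : ℝ} (hz : |z| ≤ μ / 2) (hs : |s| ≤ μ / 2) :
    huber μ z - clip μ z * s + s ^ 2 / 2 ≤ huber μ (z - s) := by
  have h1 : |z - s| ≤ μ := (abs_sub z s).trans (by linarith)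
  rw [clip_of_abs_le (by linarith)]
  simp only [huber, if_pos h1, if_pos (show |z| ≤ μ by linarith)]
  nlinarith

lemma huber_sub_mul_le {μ : ℝ} (hμ : 0 < μ) (z s : ℝ) {τ : ℝ} (h0 : 0 ≤ τ) (h1 : τ ≤ 1) :
    huber μ (z - τ * s) ≤ (1 - τ) * huber μ z + τ * huber μ (z - s) := by
  have ha := mul_sub_sq_le_huber (abs_clip_le hμ (z - τ * s)) z
  have hb := mul_sub_sq_le_huber (abs_clip_le hμ (z - τ * s)) (z - s)
  rw [huber_eq hμ (z - τ * s)]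
  nlinarith [mul_le_mul_of_nonneg_left ha (sub_nonneg.2 h1), mul_le_mul_of_nonneg_left hb h0]

variable {E : Type*} [NormedAddCommGroup E] [InnerProductSpace ℝ E]

/-- Deterministic error bound for Huber regression: a small gradient at the truth and restricted
strong convexity near it force every minimizer to be close to it. -/
lemma norm_sub_le_of_huber_min {μ R c : ℝ} (hμ : 0 < μ) (hR : 0 < R) {T : ℕ} {z : ℕ → ℝ}
    {f : ℕ → E} {a b : E}
    (hmin : ∑ t ∈ Finset.range T, huber μ (inner ℝ b (f t) + z t - inner ℝ a (f t))
      ≤ ∑ t ∈ Finset.range T, huber μ (z t))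
    (hf : ∀ t < T, R * ‖f t‖ ≤ μ / 2)
    (hc : ∀ v : E, c * ‖v‖ ^ 2
      ≤ ∑ t ∈ Finset.range T, if |z t| ≤ μ / 2 then inner ℝ v (f t) ^ 2 else 0)
    (hG : 2 * ‖∑ t ∈ Finset.range T, clip μ (z t) • f t‖ < R * c) : ‖b - a‖ ≤ R := by
  by_contra! hlt
  have hpos : 0 < ‖b - a‖ := hR.trans hlt
  -- The minimizer `a` is pulled back along the segment to the truth `b`, onto the sphere of radius
  -- `R`, where the quadratic lower bound is valid. By convexity the objective there is still at
  -- most its value at the truth.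
  set τ := R / ‖b - a‖ with hτ
  have hτ0 : 0 ≤ τ := by positivity
  have hτ1 : τ ≤ 1 := (div_le_one hpos).2 hlt.le
  set u := τ • (a - b) with hu
  have hun : ‖u‖ = R := by
    rw [hu, norm_smul, Real.norm_of_nonneg hτ0, norm_sub_rev a b, hτ, div_mul_cancel₀ _ hpos.ne']
  have hup : ∑ t ∈ Finset.range T, huber μ (z t - inner ℝ u (f t))
      ≤ ∑ t ∈ Finset.range T, huber μ (z t) := by
    calc _ ≤ ∑ t ∈ Finset.range T, ((1 - τ) * huber μ (z t)
          + τ * huber μ (inner ℝ b (f t) + z t - inner ℝ a (f t))) := by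
          refine Finset.sum_le_sum fun t _ => ?_
          have h := huber_sub_mul_le hμ (z t) (inner ℝ (a - b) (f t)) hτ0 hτ1
          rw [hu, real_inner_smul_left]
          refine h.trans (le_of_eq ?_)
          rw [inner_sub_left]
          congr 3
          ring
      _ ≤ _ := by
          rw [Finset.sum_add_distrib, ← Finset.mul_sum, ← Finset.mul_sum]
          nlinarith [mul_le_mul_of_nonneg_left hmin hτ0]
  have hlow : ∑ t ∈ Finset.range T, huber μ (z t)
      - inner ℝ u (∑ t ∈ Finset.range T, clip μ (z t) • f t)
      + (∑ t ∈ Finset.range T, if |z t| ≤ μ / 2 then inner ℝ u (f t) ^ 2 else 0) / 2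
      ≤ ∑ t ∈ Finset.range T, huber μ (z t - inner ℝ u (f t)) := by
    rw [inner_sum, ← Finset.sum_sub_distrib, Finset.sum_div, ← Finset.sum_add_distrib]
    refine Finset.sum_le_sum fun t ht => ?_
    rw [real_inner_smul_right]
    split_ifs with h
    · refine huber_sub_ge_of_small hμ h ((abs_real_inner_le_norm _ _).trans ?_)
      rw [hun]
      exact hf t (Finset.mem_range.1 ht)
    · simpa using huber_sub_ge hμ (z t) (inner ℝ u (f t))
  have hin : inner ℝ u (∑ t ∈ Finset.range T, clip μ (z t) • f t)
      ≤ R * ‖∑ t ∈ Finset.range T, clip μ (z t) • f t‖ := by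
    rw [← hun]
    exact real_inner_le_norm _ _
  have hcu := hc u
  rw [hun] at hcu
  -- With `G` the gradient norm, the bounds give `c * R² / 2 ≤ R * G`, against `2 * G < R * c`.
  nlinarith [mul_lt_mul_of_pos_left hG hR]

lemma IsHuberMinimizer.row_le {n m T : ℕ} {μ : ℝ}
    {φ : EuclideanSpace ℝ (Fin n) → EuclideanSpace ℝ (Fin m)} {x : ℕ → EuclideanSpace ℝ (Fin n)}
    {a : Fin n → EuclideanSpace ℝ (Fin m)} (ha : IsHuberMinimizer μ φ T x a) (i : Fin n)
    (b : EuclideanSpace ℝ (Fin m)) :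
    ∑ t ∈ Finset.range T, huber μ (x (t + 1) i - inner ℝ (a i) (φ (x t)))
      ≤ ∑ t ∈ Finset.range T, huber μ (x (t + 1) i - inner ℝ b (φ (x t))) := by
  have h := ha (Function.update a i b)
  simp only [huberObjective] at h
  rw [Finset.sum_comm, Finset.sum_comm (s := Finset.range T),
    ← Finset.add_sum_erase _ _ (Finset.mem_univ i),
    ← Finset.add_sum_erase (a := i) (s := Finset.univ) (h := Finset.mem_univ i)] at h
  rw [Function.update_self] at h
  have he : ∑ j ∈ Finset.univ.erase i, ∑ t ∈ Finset.range T,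
      huber μ (x (t + 1) j - inner ℝ (Function.update a i b j) (φ (x t)))
      = ∑ j ∈ Finset.univ.erase i, ∑ t ∈ Finset.range T,
      huber μ (x (t + 1) j - inner ℝ (a j) (φ (x t))) := by
    refine Finset.sum_congr rfl fun j hj => ?_
    rw [Function.update_of_ne (Finset.ne_of_mem_erase hj)]
  rw [he] at h
  linarith

end Huber

/-! ### Contractive scalar recursions. -/

section Recursion

variable {a b : ℕ → ℝ} {r : ℝ}

lemma le_div_of_recursion (hr0 : 0 ≤ r) (hr1 : r < 1) {B : ℝ} {T : ℕ} (h0 : a 0 ≤ b 0)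
    (h : ∀ t, a (t + 1) ≤ r * a t + b (t + 1)) (ha : 0 ≤ a 0) (hb : ∀ t ≤ T, b t ≤ B) :
    ∀ t ≤ T, a t ≤ B / (1 - r) := by
  have hr : 0 < 1 - r := by linarith
  have hB : 0 ≤ B := ha.trans (h0.trans (hb 0 (Nat.zero_le _)))
  intro t
  induction t with
  | zero =>
    intro ht
    refine (h0.trans (hb 0 ht)).trans ?_
    rw [le_div_iff₀ hr]
    nlinarith
  | succ t ih =>
    intro ht
    have h1 := ih (by omega)
    have h2 := h t
    have h3 := hb (t + 1) ht
    calc a (t + 1) ≤ r * (B / (1 - r)) + B := by nlinarith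
      _ = B / (1 - r) := by field_simp; ring

lemma sum_pow_four_le_of_recursion (hr0 : 0 ≤ r) (hr1 : r < 1) (ha : ∀ t, 0 ≤ a t)
    (hb : ∀ t, 0 ≤ b t) (h0 : a 0 ≤ b 0) (h : ∀ t, a (t + 1) ≤ r * a t + b (t + 1)) (N : ℕ) :
    ∑ t ∈ Finset.range (N + 1), a t ^ 4
      ≤ (∑ t ∈ Finset.range (N + 1), b t ^ 4) / (1 - r) ^ 4 := by
  have hr : 0 < 1 - r := by linarith
  have hstep : ∀ t, a (t + 1) ^ 4 ≤ r * a t ^ 4 + b (t + 1) ^ 4 / (1 - r) ^ 3 := by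
    intro t
    -- Convexity of the fourth power for `r * a + (1 - r) * (b / (1 - r))`.
    have hc := (convexOn_pow (𝕜 := ℝ) 4).2 (Set.mem_Ici.2 (ha t))
      (Set.mem_Ici.2 (div_nonneg (hb (t + 1)) hr.le)) hr0 hr.le (by ring)
    simp only [smul_eq_mul] at hc
    rw [mul_div_cancel₀ _ hr.ne'] at hc
    refine (pow_le_pow_left₀ (ha _) (h t) 4).trans (hc.trans (le_of_eq ?_))
    field_simp
  -- The boundary term `r * a N ^ 4` is kept so that the induction closes; it is dropped at the end.
  have key : ∀ N, (1 - r) * ∑ t ∈ Finset.range (N + 1), a t ^ 4 + r * a N ^ 4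
      ≤ (∑ t ∈ Finset.range (N + 1), b t ^ 4) / (1 - r) ^ 3 := by
    intro N
    induction N with
    | zero =>
      simp only [zero_add, Finset.sum_range_one]
      have h4 := pow_le_pow_left₀ (ha 0) h0 4
      rw [le_div_iff₀ (by positivity)]
      have h5 : (1 - r) ^ 3 ≤ 1 := pow_le_one₀ hr.le (by linarith)
      have h6 : 0 ≤ a 0 ^ 4 := by positivity
      nlinarith
    | succ N ih =>
      rw [Finset.sum_range_succ, Finset.sum_range_succ (fun t => b t ^ 4), add_div]
      have := hstep N
      nlinarith
  have hk := key N
  have h7 : 0 ≤ r * a N ^ 4 := mul_nonneg hr0 (by have := ha N; positivity)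
  rw [le_div_iff₀ (by positivity)] at hk ⊢
  calc (∑ t ∈ Finset.range (N + 1), a t ^ 4) * (1 - r) ^ 4
      = ((1 - r) * ∑ t ∈ Finset.range (N + 1), a t ^ 4) * (1 - r) ^ 3 := by ring
    _ ≤ ((1 - r) * ∑ t ∈ Finset.range (N + 1), a t ^ 4 + r * a N ^ 4) * (1 - r) ^ 3 := by
        gcongr; linarith
    _ ≤ _ := hk

end Recursion

/-! ### Unrolling the drift when the features are linear. -/

section Linear

variable {E F : Type*} [NormedAddCommGroup E] [NormedSpace ℝ E] [NormedAddCommGroup F]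
  [NormedSpace ℝ F]

/-- A weighted sum of linear features of a linear system, in terms of the disturbances. -/
lemma exists_sum_smul_eq_sum_noise (K : E →L[ℝ] E) (B : E →L[ℝ] F) {r L μ : ℝ}
    (hK : ‖K‖ ≤ r) (hr : r < 1) (hB : ‖B‖ ≤ L) (hμ : 0 ≤ μ) (T : ℕ) (c : ℕ → ℝ)
    (hc : ∀ t, |c t| ≤ μ) :
    ∃ Q : ℕ → E →L[ℝ] F, (∀ t, ‖Q t‖ ≤ μ * L / (1 - r)) ∧
      ∀ x w : ℕ → E, (∀ t, x (t + 1) = K (x t) + w t) →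
        ∑ t ∈ Finset.range T, c t • B (x t)
          = Q 0 (x 0) + ∑ t ∈ Finset.range T, Q (t + 1) (w t) := by
  have hr' : 0 < 1 - r := by linarith
  have hL : 0 ≤ L := (norm_nonneg _).trans hB
  induction T generalizing c with
  | zero => exact ⟨0, fun t => by simp only [Pi.zero_apply, norm_zero]; positivity, by simp⟩
  | succ T ih =>
    obtain ⟨Q, hQ, hsum⟩ := ih (fun t => c (t + 1)) fun t => hc _
    -- The system is restarted at `x 1 = K (x 0) + w 0`: the former initial coefficient now acts on
    -- `w 0` and, through `K`, on `x 0`. The bound `μ * L / (1 - r)` is the fixed point of `u ↦ μ *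
    -- L + r * u`. The operators are fixed before the trajectory, hence deterministic.
    refine ⟨fun t => Nat.casesOn t (c 0 • B + (Q 0).comp K) Q, fun t => ?_, fun x w hx => ?_⟩
    · cases t with
      | zero =>
        have h1 : ‖c 0 • B‖ ≤ μ * L := by
          rw [norm_smul]
          exact mul_le_mul (hc 0) hB (norm_nonneg _) hμ
        have h2 : ‖(Q 0).comp K‖ ≤ μ * L / (1 - r) * r :=
          (ContinuousLinearMap.opNorm_comp_le _ _).trans
            (mul_le_mul (hQ 0) hK (norm_nonneg _) (by positivity))
        calc ‖c 0 • B + (Q 0).comp K‖ ≤ μ * L + μ * L / (1 - r) * r :=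
              (norm_add_le _ _).trans (add_le_add h1 h2)
          _ = μ * L / (1 - r) := by field_simp; ring
      | succ t => exact hQ t
    · have h := hsum (fun t => x (t + 1)) (fun t => w (t + 1)) fun t => hx (t + 1)
      rw [Finset.sum_range_succ', h, Finset.sum_range_succ']
      have h0 : (c 0 • B + (Q 0).comp K) (x 0) = c 0 • B (x 0) + Q 0 (K (x 0)) := rfl
      have h1 : Q 0 (x (0 + 1)) = Q 0 (K (x 0)) + Q 0 (w 0) := by rw [hx 0, map_add]
      change _ = (c 0 • B + (Q 0).comp K) (x 0)
        + (∑ t ∈ Finset.range T, Q (t + 1) (w (t + 1)) + Q 0 (w 0))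
      rw [h0, h1]
      abel

variable {n m : ℕ}

/-- A matrix, as a continuous linear map of Euclidean spaces. -/
noncomputable def actCLM (A : Matrix (Fin n) (Fin m) ℝ) :
    EuclideanSpace ℝ (Fin m) →L[ℝ] EuclideanSpace ℝ (Fin n) :=
  LinearMap.mkContinuous
    { toFun := act A
      map_add' := fun u v => by simp [act, Matrix.mulVec_add]
      map_smul' := fun c v => by simp [act, Matrix.mulVec_smul] } ‖A‖ (norm_act_le A)

lemma norm_actCLM_le (A : Matrix (Fin n) (Fin m) ℝ) : ‖actCLM A‖ ≤ ‖A‖ :=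
  LinearMap.mkContinuous_norm_le _ (norm_nonneg _) _

end Linear

/-! ### Rank-one matrices as vectors. -/

section Outer

variable {m : ℕ}

/-- The matrix `u uᵀ`, as a vector with the Frobenius norm. -/
noncomputable def outer (u : EuclideanSpace ℝ (Fin m)) : EuclideanSpace ℝ (Fin m × Fin m) :=
  WithLp.toLp 2 fun p => u p.1 * u p.2

/-- Quadratic forms in `v` become linear functionals of `outer`, so one vector bound controls all
directions at once, without a net. -/
lemma inner_outer_outer (u v : EuclideanSpace ℝ (Fin m)) :
    inner ℝ (outer u) (outer v) = inner ℝ u v ^ 2 := by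
  rw [PiLp.inner_apply, PiLp.inner_apply, sq, Finset.sum_mul_sum, Fintype.sum_prod_type]
  refine Finset.sum_congr rfl fun j _ => Finset.sum_congr rfl fun k _ => ?_
  simp only [outer, RCLike.inner_apply, conj_trivial]
  ring

lemma norm_outer (u : EuclideanSpace ℝ (Fin m)) : ‖outer u‖ = ‖u‖ ^ 2 := by
  have h : ‖outer u‖ ^ 2 = (‖u‖ ^ 2) ^ 2 := by
    rw [← real_inner_self_eq_norm_sq, inner_outer_outer, real_inner_self_eq_norm_sq]
  exact (pow_left_inj₀ (norm_nonneg _) (by positivity) two_ne_zero).1 h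

lemma continuous_outer : Continuous (outer (m := m)) := by
  unfold outer
  fun_prop

end Outer

/-! ### Solving the sample-size condition. -/

section SampleSize

/-- Write `T = z * y * K`. Since `log z ≤ 2 * √z`, the quantity `M`, which contains `log T`, is at
most `30 * K * √z`. The hypothesis `30 * c ≤ √z` leaves the second factor `√z` to absorb `30 * c`.
-/
lemma mul_le_of_log_le {c y K M T : ℝ} (hc : 1 ≤ c) (hy : 0 < y) (hK : 1 / 3 ≤ K)
    (hT : (30 * c) ^ 2 * (y * K) ≤ T) (hlog : Real.log y ≤ 8 * K)
    (hM : M ≤ 14 * K + Real.log T) : c * y * M ≤ T := by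
  have hK0 : 0 < K := by linarith
  have hyK : 0 < y * K := by positivity
  set z := T / (y * K) with hz
  have hz1 : (30 * c) ^ 2 ≤ z := by rwa [hz, le_div_iff₀ hyK]
  have hz0 : 0 < z := lt_of_lt_of_le (by positivity) hz1
  have hTz : T = z * (y * K) := by rw [hz, div_mul_cancel₀ _ hyK.ne']
  have hs : 30 * c ≤ √z := Real.le_sqrt_of_sq_le hz1
  have hlz : Real.log z ≤ 2 * √z := by
    have h1 : Real.log z = 2 * Real.log √z := by
      rw [Real.log_sqrt hz0.le]; ring
    have h2 := Real.log_le_sub_one_of_pos (Real.sqrt_pos.2 hz0)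
    linarith
  have hlK : Real.log K ≤ K := by linarith [Real.log_le_sub_one_of_pos hK0]
  have hlT : Real.log T = Real.log z + (Real.log y + Real.log K) := by
    rw [hTz, Real.log_mul hz0.ne' hyK.ne', Real.log_mul hy.ne' hK0.ne']
  have hM2 : M ≤ 30 * (K * √z) := by nlinarith
  have hsq : √z * √z = z := Real.mul_self_sqrt hz0.le
  calc c * y * M ≤ c * y * (30 * (K * √z)) := by gcongr
    _ = y * K * √z * (30 * c) := by ring
    _ ≤ y * K * √z * √z := by gcongr
    _ = T := by rw [hTz, mul_assoc, hsq]; ring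

/-- The signal-to-noise ratio of the system. -/
noncomputable def snr (n : ℕ) (L σ lam ρ : ℝ) : ℝ :=
  n * L ^ 2 * σ ^ 2 / (lam ^ 2 * (1 - ρ * L) ^ 2)

lemma snr_of_threshold_le {n m : ℕ} {L σ q lam ρ δ T c : ℝ} (hn : 0 < n) (hm : 0 < m)
    (hL : 0 < L) (hσ : 0 < σ) (hq : 0 < q) (hq1 : q ≤ 1) (hlam : 0 < lam) (hρ : ρ * L < 1)
    (hδ : 0 < δ) (hδ1 : δ < 1) (hnδ : 2 ≤ n ∨ δ ≤ 1 / 2) (hκ : m ≤ snr n L σ lam ρ) (hc : 1 ≤ c)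
    (hT1 : 1 ≤ T) (hT : (30 * c) ^ 2 * threshold n m L σ q lam ρ δ ≤ T) :
    c * (snr n L σ lam ρ ^ 2 / q ^ 2 * Real.log (n / δ) ^ 2)
      * (1 + Real.log ((T + 1) / (δ / (5 * n)))) ≤ T := by
  have hr : 0 < 1 - ρ * L := by linarith
  set κ := snr n L σ lam ρ with hκdef
  have hn1 : (1 : ℝ) ≤ n := by exact_mod_cast hn
  have hm1 : (1 : ℝ) ≤ m := by exact_mod_cast hm
  have hn0 : (0 : ℝ) < n := by linarith
  have hm0 : (0 : ℝ) < m := by linarith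
  have hκ1 : 1 ≤ κ := hm1.trans hκ
  have hκ0 : 0 < κ := by linarith
  set g := n * L * σ / (q * lam * (1 - ρ * L) * δ) with hg
  have hg0 : 0 < g := by positivity
  have hg2 : g ^ 2 = n * κ / (q ^ 2 * δ ^ 2) := by
    rw [hg, hκdef, snr]; field_simp
  set K := Real.log g with hKdef
  -- The logarithm in the threshold controls `log n`, `log κ`, `-log q` and `-log δ` simultaneously;
  -- `log m` is controlled through `m ≤ κ`.
  have hK2 : 2 * K = Real.log n + Real.log κ - 2 * Real.log q - 2 * Real.log δ := by
    have h : Real.log (g ^ 2) = 2 * K := by rw [Real.log_pow, ← hKdef]; norm_num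
    rw [← h, hg2, Real.log_div (by positivity) (by positivity), Real.log_mul hn0.ne' hκ0.ne',
      Real.log_mul (by positivity) (by positivity), Real.log_pow, Real.log_pow]
    push_cast; ring
  have hlq : Real.log q ≤ 0 := Real.log_nonpos hq.le hq1
  have hlδ : Real.log δ ≤ 0 := Real.log_nonpos hδ.le hδ1.le
  have hln : 0 ≤ Real.log n := Real.log_nonneg hn1
  have hlm : 0 ≤ Real.log m := Real.log_nonneg hm1
  have hlκ : Real.log m ≤ Real.log κ := Real.log_le_log hm0 hκ
  have hl2 := Real.log_two_gt_d9
  have hcase : Real.log 2 ≤ Real.log n - Real.log δ := by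
    rcases hnδ with h | h
    · have h2 : (2 : ℝ) ≤ n := by exact_mod_cast h
      have := Real.log_le_log (by norm_num) h2
      linarith
    · have := Real.log_le_log hδ h
      rw [one_div, Real.log_inv] at this
      linarith
  have hK : 1 / 3 ≤ K := by linarith
  set ℓ := Real.log (m * n / δ) with hℓ
  have hℓe : ℓ = Real.log m + Real.log n - Real.log δ := by
    rw [hℓ, Real.log_div (by positivity) hδ.ne', Real.log_mul hm0.ne' hn0.ne']
  have hℓ1e : Real.log (n / δ) = Real.log n - Real.log δ := Real.log_div hn0.ne' hδ.ne'
  have hℓ0 : 0 < ℓ := by linarith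
  have hℓℓ : Real.log (n / δ) ≤ ℓ := by linarith
  have hℓ10 : 0 ≤ Real.log (n / δ) := by linarith
  set y := κ ^ 2 / q ^ 2 * ℓ ^ 2 with hy
  have hy0 : 0 < y := by positivity
  have hth : threshold n m L σ q lam ρ δ = y * K := by
    rw [threshold, hy, hκdef, snr]
    congr 2
    field_simp
  have hlogy : Real.log y ≤ 8 * K := by
    rw [hy, Real.log_mul (by positivity) (by positivity), Real.log_div (by positivity)
      (by positivity), Real.log_pow, Real.log_pow, Real.log_pow]
    have := Real.log_le_sub_one_of_pos hℓ0
    push_cast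
    linarith
  -- As `T ≥ 1`, the left side is at most `1 + log 10 + log (n / δ) + log T`; here `1 + log 10 ≤ 4 ≤
  -- 12 * K` and `log (n / δ) ≤ 2 * K`.
  have hM : 1 + Real.log ((T + 1) / (δ / (5 * n))) ≤ 14 * K + Real.log T := by
    have h1 : (T + 1) / (δ / (5 * n)) ≤ 10 * (n * T / δ) := by
      rw [div_div_eq_mul_div, mul_div_assoc', div_le_div_iff_of_pos_right hδ]
      nlinarith
    have h2 := Real.log_le_log (by positivity) h1
    have h3 : Real.log 10 ≤ 3 := by
      rw [Real.log_le_iff_le_exp (by norm_num)]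
      have := Real.exp_one_gt_d9
      have h4 : Real.exp 3 = Real.exp 1 ^ 3 := by rw [← Real.exp_nat_mul]; norm_num
      rw [h4]
      calc (10 : ℝ) ≤ 2.7 ^ 3 := by norm_num
        _ ≤ _ := by gcongr; linarith
    rw [Real.log_mul (by norm_num) (by positivity), Real.log_div (by positivity) hδ.ne',
      Real.log_mul hn0.ne' (by positivity)] at h2
    linarith
  have hmain := mul_le_of_log_le hc hy0 hK (hth ▸ hT) hlogy hM
  refine le_trans ?_ hmain
  have hM0 : 0 ≤ 1 + Real.log ((T + 1) / (δ / (5 * n))) := by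
    have : 1 ≤ (T + 1) / (δ / (5 * n)) := by
      rw [le_div_iff₀ (by positivity), one_mul, div_le_iff₀ (by positivity)]
      nlinarith
    linarith [Real.log_nonneg this]
  rw [hy]
  gcongr

end SampleSize

/-! ### Moments of the normalised noise energies. -/

section Noise

variable {Ω : Type*} {mΩ : MeasurableSpace Ω} {P : Measure Ω} [IsProbabilityMeasure P]
  {n m : ℕ} {A : Matrix (Fin n) (Fin m) ℝ}
  {φ : EuclideanSpace ℝ (Fin n) → EuclideanSpace ℝ (Fin m)} {L : ℝ≥0}
  {x w : ℕ → Ω → EuclideanSpace ℝ (Fin n)} {σ : ℝ}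

/-- The squared norms of the initial state and the disturbances, normalised. -/
noncomputable def noiseEnergy (x w : ℕ → Ω → EuclideanSpace ℝ (Fin n)) (S : ℝ) (s : ℕ) (ω : Ω) : ℝ :=
  ‖initAndNoise x w s ω‖ ^ 2 / S

lemma psi2Norm_initAndNoise_le (hsys : IsSystem A φ x w) (hs : IsStableSystem A φ L)
    (hz : IsZeroMeanIndepNoise x w P) (hsub : IsSubGaussian x w σ P) (s : ℕ) (i : Fin n) :
    psi2Norm (fun ω => initAndNoise x w s ω i) P ≤ ENNReal.ofReal σ := by
  cases s with
  | zero => exact hsub.init i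
  | succ t =>
    exact (psi2Norm_le_condPsi2Norm _ ((pastSigma_le_noiseSigma hsys hs t).trans
      ((isDriven hsys hs hz).le t))).trans (hsub.noise t i)

lemma isSubExp_noiseEnergy (hn : 0 < n) (hσ : 0 < σ) (hsys : IsSystem A φ x w)
    (hs : IsStableSystem A φ L) (hz : IsZeroMeanIndepNoise x w P) (hsub : IsSubGaussian x w σ P)
    (s : ℕ) : IsSubExp (noiseEnergy x w (n * (2 * σ) ^ 2) s) P := by
  have hm := hsys.measurable_initAndNoise s
  refine isSubExp_of_lintegral_le ((hm.norm.pow_const 2).div_const _)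
    (fun ω => div_nonneg (sq_nonneg _) (by positivity)) ?_
  exact lintegral_exp_norm_sq_le_of_psi2Norm_lt hn hm fun i =>
    (psi2Norm_initAndNoise_le hsys hs hz hsub s i).trans_lt
      ((ENNReal.ofReal_lt_ofReal_iff (by positivity)).2 (by linarith))

lemma iIndepFun_noiseEnergy (hz : IsZeroMeanIndepNoise x w P) (S : ℝ) :
    iIndepFun (noiseEnergy x w S) P :=
  hz.indep.comp (fun _ u => ‖u‖ ^ 2 / S) fun _ => by fun_prop

/-- Moments of a random vector whose normalised squared norm is subexponential. -/
structure HasNoiseMoments (ν : Measure (EuclideanSpace ℝ (Fin n))) (S : ℝ) : Prop where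
  integrable_sq : Integrable (fun y => ‖y‖ ^ 2) ν
  integral_sq_le : ∫ y, ‖y‖ ^ 2 ∂ν ≤ S
  integrable_four : Integrable (fun y => ‖y‖ ^ 4) ν
  integral_four_le : ∫ y, ‖y‖ ^ 4 ∂ν ≤ 6 * S ^ 2

lemma hasNoiseMoments {S : ℝ} (hS : 0 < S) (hsys : IsSystem A φ x w) {t : ℕ}
    (h : IsSubExp (noiseEnergy x w S (t + 1)) P) : HasNoiseMoments (P.map (w t)) S := by
  have hm := hsys.measurable_noise t
  have e2 : ∀ ω, ‖w t ω‖ ^ 2 = S * noiseEnergy x w S (t + 1) ω := fun ω => by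
    simp only [noiseEnergy, initAndNoise]; field_simp
  have e4 : ∀ ω, ‖w t ω‖ ^ 4 = S ^ 2 * noiseEnergy x w S (t + 1) ω ^ 2 := fun ω => by
    rw [← mul_pow, ← e2]; ring
  have m2 : AEStronglyMeasurable (fun y : EuclideanSpace ℝ (Fin n) => ‖y‖ ^ 2) (P.map (w t)) := by
    fun_prop
  have m4 : AEStronglyMeasurable (fun y : EuclideanSpace ℝ (Fin n) => ‖y‖ ^ 4) (P.map (w t)) := by
    fun_prop
  refine ⟨(integrable_map_measure m2 hm.aemeasurable).2 ?_, ?_,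
    (integrable_map_measure m4 hm.aemeasurable).2 ?_, ?_⟩
  · exact (h.integrable_self.const_mul S).congr (Filter.Eventually.of_forall fun ω => (e2 ω).symm)
  · rw [integral_map hm.aemeasurable m2]
    simp only [e2]
    rw [integral_const_mul]
    nlinarith [h.integral_self_le]
  · exact (h.integrable_sq.const_mul (S ^ 2)).congr
      (Filter.Eventually.of_forall fun ω => (e4 ω).symm)
  · rw [integral_map hm.aemeasurable m4]
    simp only [e4]
    rw [integral_const_mul]
    nlinarith [h.integral_sq_le, sq_nonneg S]

lemma memLp_initAndNoise {S : ℝ} (hS : 0 < S) (hsys : IsSystem A φ x w) {s : ℕ}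
    (h : IsSubExp (noiseEnergy x w S s) P) : MemLp (initAndNoise x w s) 2 P := by
  refine (memLp_two_iff_integrable_sq_norm
    (hsys.measurable_initAndNoise s).aestronglyMeasurable).2 ?_
  refine (h.integrable_self.const_mul S).congr (Filter.Eventually.of_forall fun ω => ?_)
  simp only [noiseEnergy]
  field_simp

end Noise

/-! ### Excitation bounds the number of features. -/

section Signal

variable {Ω : Type*} {mΩ : MeasurableSpace Ω} {P : Measure Ω} [IsProbabilityMeasure P]
  {n m : ℕ} {A : Matrix (Fin n) (Fin m) ℝ}
  {φ : EuclideanSpace ℝ (Fin n) → EuclideanSpace ℝ (Fin m)} {L : ℝ≥0}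
  {x w : ℕ → Ω → EuclideanSpace ℝ (Fin n)} {σ : ℝ}

lemma integral_norm_sq_initAndNoise_le (hσ : 0 < σ) (hsys : IsSystem A φ x w)
    (hs : IsStableSystem A φ L) (hz : IsZeroMeanIndepNoise x w P) (hsub : IsSubGaussian x w σ P)
    (s : ℕ) : ∫ ω, ‖initAndNoise x w s ω‖ ^ 2 ∂P ≤ n * σ ^ 2 := by
  have hm := hsys.measurable_initAndNoise s
  rw [integral_eq_lintegral_of_nonneg_ae (Filter.Eventually.of_forall fun _ => sq_nonneg _)
    (hm.norm.pow_const 2).aestronglyMeasurable]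
  exact ENNReal.toReal_le_of_le_ofReal (by positivity) (lintegral_norm_sq_le_of_psi2Norm_le hm hσ
    fun i => psi2Norm_initAndNoise_le hsys hs hz hsub s i)

/-- Excitation bounds the number of features by the signal-to-noise ratio. -/
lemma card_le_snr (hn : 0 < n) (hσ : 0 < σ) {lam : ℝ} (hlam : 0 < lam) (hsys : IsSystem A φ x w)
    (hs : IsStableSystem A φ L) (hz : IsZeroMeanIndepNoise x w P) (hsub : IsSubGaussian x w σ P)
    {T : ℕ} (hT : 0 < T) (hexc : IsExcited φ x lam T P) : m ≤ snr n L σ lam ‖A‖ := by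
  have hS : (0 : ℝ) < n * (2 * σ) ^ 2 := by positivity
  have hse := isSubExp_noiseEnergy hn hσ hsys hs hz hsub
  have hL2 : ∀ s, MemLp (initAndNoise x w s) 2 P := fun s => memLp_initAndNoise hS hsys (hse s)
  have hx2 : MemLp (x 0) 2 P := hL2 0
  have hr := hs.lt_one
  set r : ℝ := ‖A‖ * L with hrdef
  have hr0 : 0 ≤ r := by positivity
  have hw0 : ∫ y, ‖y‖ ^ 2 ∂(P.map (w 0)) ≤ n * σ ^ 2 := by
    rw [integral_map (hsys.measurable_noise 0).aemeasurable (by fun_prop)]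
    exact integral_norm_sq_initAndNoise_le hσ hsys hs hz hsub 1
  have hmom := hasNoiseMoments hS hsys (hse 1)
  have hprob : IsProbabilityMeasure (P.map (w 0)) :=
    Measure.isProbabilityMeasure_map (hsys.measurable_noise 0).aemeasurable
  have hpt : ∀ᵐ ω ∂P, m * lam ^ 2 ≤ L ^ 2 * ((1 + r) * (r * ‖x 0 ω‖ ^ 2 + n * σ ^ 2)) := by
    filter_upwards [sq_le_integral_inner_sq hsys hs hz hx2 (fun t => hL2 (t + 1)) hexc] with ω hω
    have h2 := memLp_step hs (hsys.measurable_noise 0) (hL2 1) (x 0 ω)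
    have hnorm : ∑ j : Fin m, ∫ y, inner ℝ (EuclideanSpace.single j (1 : ℝ))
        (φ (act A (φ (x 0 ω)) + y)) ^ 2 ∂(P.map (w 0))
        = ∫ y, ‖φ (act A (φ (x 0 ω)) + y)‖ ^ 2 ∂(P.map (w 0)) := by
      rw [← integral_finsetSum]
      · refine integral_congr_ae (Filter.Eventually.of_forall fun y => ?_)
        dsimp only
        rw [EuclideanSpace.norm_sq_eq]
        refine Finset.sum_congr rfl fun j _ => ?_
        rw [EuclideanSpace.inner_single_left]
        simp
      · intro j _
        simp only [EuclideanSpace.inner_single_left, map_one, one_mul]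
        exact (memLp_coord h2 j).integrable_sq
    -- Summing over an orthonormal basis takes the trace of the excitation inequality, here at time
    -- zero.
    calc (m : ℝ) * lam ^ 2 = ∑ j : Fin m, lam ^ 2 * ‖EuclideanSpace.single j (1 : ℝ)‖ ^ 2 := by
          simp
      _ ≤ _ := Finset.sum_le_sum fun j _ => hω 0 hT _
      _ = ∫ y, ‖φ (act A (φ (x 0 ω)) + y)‖ ^ 2 ∂(P.map (w 0)) := hnorm
      _ ≤ ∫ y, (L ^ 2 * ((1 + r) * (r * ‖x 0 ω‖ ^ 2)) + L ^ 2 * (1 + r) * ‖y‖ ^ 2)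
            ∂(P.map (w 0)) := by
          refine integral_mono ((memLp_two_iff_integrable_sq_norm h2.1).1 h2)
            ((integrable_const _).add (hmom.integrable_sq.const_mul _)) fun y => ?_
          dsimp only
          have h3 : ‖φ (act A (φ (x 0 ω)) + y)‖ ≤ L * (r * ‖x 0 ω‖ + ‖y‖) := by
            refine (hs.norm_map_le _).trans (mul_le_mul_of_nonneg_left ?_ L.2)
            exact (norm_add_le _ _).trans (add_le_add (hs.norm_act_map_le _) le_rfl)
          calc _ ≤ (L * (r * ‖x 0 ω‖ + ‖y‖)) ^ 2 := pow_le_pow_left₀ (norm_nonneg _) h3 2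
            _ = L ^ 2 * (r * ‖x 0 ω‖ + ‖y‖) ^ 2 := by ring
            _ ≤ L ^ 2 * ((1 + r) * (r * ‖x 0 ω‖ ^ 2 + ‖y‖ ^ 2)) := by
                refine mul_le_mul_of_nonneg_left ?_ (by positivity)
                -- Cauchy–Schwarz with weights `r` and `1`. After integration it gives `(1 + r) ^
                -- 2`, and `(1 + r) * (1 - r) ≤ 1` yields the ratio without a constant.
                nlinarith [mul_nonneg hr0 (sq_nonneg (‖x 0 ω‖ - ‖y‖))]
            _ = _ := by ring
      _ = L ^ 2 * ((1 + r) * (r * ‖x 0 ω‖ ^ 2)) + L ^ 2 * (1 + r) * ∫ y, ‖y‖ ^ 2 ∂(P.map (w 0)) := by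
          rw [integral_add (integrable_const _) (hmom.integrable_sq.const_mul _),
            integral_const_mul (L ^ 2 * (1 + r) : ℝ)]
          simp
      _ ≤ L ^ 2 * ((1 + r) * (r * ‖x 0 ω‖ ^ 2)) + L ^ 2 * (1 + r) * (n * σ ^ 2) := by gcongr
      _ = _ := by ring
  have hxi : Integrable (fun ω => ‖x 0 ω‖ ^ 2) P :=
    (memLp_two_iff_integrable_sq_norm hx2.1).1 hx2
  have hint : (m : ℝ) * lam ^ 2 ≤ L ^ 2 * ((1 + r) * (r * (n * σ ^ 2) + n * σ ^ 2)) := by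
    calc (m : ℝ) * lam ^ 2 = ∫ _, (m : ℝ) * lam ^ 2 ∂P := by simp
      _ ≤ ∫ ω, L ^ 2 * ((1 + r) * (r * ‖x 0 ω‖ ^ 2 + n * σ ^ 2)) ∂P :=
          integral_mono_ae (integrable_const _)
            ((((hxi.const_mul r).add (integrable_const _)).const_mul _).const_mul _) hpt
      _ = L ^ 2 * ((1 + r) * (r * ∫ ω, ‖x 0 ω‖ ^ 2 ∂P + n * σ ^ 2)) := by
          rw [integral_const_mul, integral_const_mul,
            integral_add (hxi.const_mul r) (integrable_const _), integral_const_mul]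
          simp
      _ ≤ _ := by
          have := integral_norm_sq_initAndNoise_le hσ hsys hs hz hsub 0
          simp only [initAndNoise] at this
          gcongr
  have hr' : 0 < 1 - r := by linarith
  rw [snr, le_div_iff₀ (by positivity)]
  calc (m : ℝ) * (lam ^ 2 * (1 - r) ^ 2) = m * lam ^ 2 * (1 - r) ^ 2 := by ring
    _ ≤ L ^ 2 * ((1 + r) * (r * (n * σ ^ 2) + n * σ ^ 2)) * (1 - r) ^ 2 := by gcongr
    _ = n * L ^ 2 * σ ^ 2 * ((1 + r) * (1 - r)) ^ 2 := by ring
    _ ≤ n * L ^ 2 * σ ^ 2 * 1 := by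
        gcongr
        refine pow_le_one₀ (by nlinarith) (by nlinarith)
    _ = _ := mul_one _

end Signal

/-! ### Deterministic bounds along one trajectory. -/

section PathBound

variable {Ω : Type*} {mΩ : MeasurableSpace Ω} {n m : ℕ} {A : Matrix (Fin n) (Fin m) ℝ}
  {φ : EuclideanSpace ℝ (Fin n) → EuclideanSpace ℝ (Fin m)} {L : ℝ≥0}
  {x w : ℕ → Ω → EuclideanSpace ℝ (Fin n)}

/-- Bounds on the size of one trajectory. -/
structure PathBound (x w : ℕ → Ω → EuclideanSpace ℝ (Fin n)) (r S M : ℝ) (T : ℕ) (ω : Ω) :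
    Prop where
  sum_four : ∑ t ∈ Finset.range (T + 1), ‖x t ω‖ ^ 4 ≤ 50 * T * S ^ 2 / (1 - r) ^ 4
  sum_sq : ∑ t ∈ Finset.range T, ‖x t ω‖ ^ 2 ≤ 8 * T * S / (1 - r) ^ 2
  noise_sq : ∑ t ∈ Finset.range T, ‖w t ω‖ ^ 2 ≤ 8 * T * S
  le : ∀ t ≤ T, ‖x t ω‖ ^ 2 ≤ S * M / (1 - r) ^ 2

/-- The arithmetic–geometric mean inequality centred at `7 * u`, with `7` close to `√50`; the total
`50 / 14 + 7 / 2` is below `8`. -/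
lemma sum_sq_le_of_sum_four_le {a : ℕ → ℝ} {T : ℕ} {u : ℝ} (hu : 0 < u)
    (h : ∑ t ∈ Finset.range T, a t ^ 4 ≤ 50 * T * u ^ 2) :
    ∑ t ∈ Finset.range T, a t ^ 2 ≤ 8 * T * u := by
  have h1 : ∀ t, a t ^ 2 ≤ a t ^ 4 / (14 * u) + 7 * u / 2 := by
    intro t
    have h2 : a t ^ 4 / (14 * u) + 7 * u / 2 - a t ^ 2 = (a t ^ 2 - 7 * u) ^ 2 / (14 * u) := by
      field_simp; ring
    have h3 : 0 ≤ (a t ^ 2 - 7 * u) ^ 2 / (14 * u) := by positivity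
    linarith
  calc _ ≤ ∑ t ∈ Finset.range T, (a t ^ 4 / (14 * u) + 7 * u / 2) :=
        Finset.sum_le_sum fun t _ => h1 t
    _ = (∑ t ∈ Finset.range T, a t ^ 4) / (14 * u) + T * (7 * u / 2) := by
        rw [Finset.sum_add_distrib, ← Finset.sum_div]; simp
    _ ≤ 50 * T * u ^ 2 / (14 * u) + T * (7 * u / 2) := by gcongr
    _ = (50 / 14 + 7 / 2) * (T * u) := by field_simp
    _ ≤ 8 * (T * u) := by
        have : 0 ≤ T * u := by positivity
        nlinarith
    _ = _ := by ring

lemma pathBound (hsys : IsSystem A φ x w) (hs : IsStableSystem A φ L) {S M : ℝ} (hS : 0 < S)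
    {T : ℕ} {ω : Ω} (hM : ∀ s < T + 1, noiseEnergy x w S s ω ≤ M)
    (hsum : ∑ s ∈ Finset.range (T + 1), noiseEnergy x w S s ω ^ 2 ≤ 50 * T) :
    PathBound x w (‖A‖ * L) S M T ω := by
  have hr1 := hs.lt_one
  set r : ℝ := ‖A‖ * L with hr
  have hr0 : 0 ≤ r := by positivity
  have hr' : 0 < 1 - r := by linarith
  have hE : ∀ s, ‖initAndNoise x w s ω‖ ^ 2 = S * noiseEnergy x w S s ω := fun s => by
    simp only [noiseEnergy]; field_simp
  have hrec : ∀ t, ‖x (t + 1) ω‖ ≤ r * ‖x t ω‖ + ‖initAndNoise x w (t + 1) ω‖ := fun t => by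
    rw [hsys.dynamics]
    exact (norm_add_le _ _).trans (add_le_add (hs.norm_act_map_le _) le_rfl)
  have h4 : ∑ s ∈ Finset.range (T + 1), ‖initAndNoise x w s ω‖ ^ 4 ≤ 50 * T * S ^ 2 := by
    calc _ = S ^ 2 * ∑ s ∈ Finset.range (T + 1), noiseEnergy x w S s ω ^ 2 := by
          rw [Finset.mul_sum]
          refine Finset.sum_congr rfl fun s _ => ?_
          rw [← mul_pow, ← hE]; ring
      _ ≤ S ^ 2 * (50 * T) := by gcongr
      _ = _ := by ring
  have hx4 : ∑ t ∈ Finset.range (T + 1), ‖x t ω‖ ^ 4 ≤ 50 * T * S ^ 2 / (1 - r) ^ 4 :=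
    (sum_pow_four_le_of_recursion (a := fun t => ‖x t ω‖) (b := fun s => ‖initAndNoise x w s ω‖)
      hr0 hr1 (fun _ => norm_nonneg _) (fun _ => norm_nonneg _) le_rfl hrec T).trans (by gcongr)
  refine ⟨hx4, ?_, ?_, ?_⟩
  · rw [mul_div_assoc]
    refine sum_sq_le_of_sum_four_le (by positivity) ?_
    rw [div_pow, ← pow_mul, mul_div_assoc']
    rw [Finset.sum_range_succ] at hx4
    have : 0 ≤ ‖x T ω‖ ^ 4 := by positivity
    linarith
  · refine sum_sq_le_of_sum_four_le hS ?_
    rw [Finset.sum_range_succ'] at h4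
    have : 0 ≤ ‖initAndNoise x w 0 ω‖ ^ 4 := by positivity
    simp only [initAndNoise] at h4 this
    linarith
  · intro t ht
    have hM0 : 0 ≤ M := le_trans (div_nonneg (sq_nonneg _) hS.le) (hM 0 (Nat.succ_pos T))
    have h := le_div_of_recursion (a := fun t => ‖x t ω‖)
      (b := fun s => ‖initAndNoise x w s ω‖) hr0 hr1 (B := √(S * M)) (T := T) le_rfl hrec
      (norm_nonneg _) (fun s hsT => by
        refine Real.le_sqrt_of_sq_le ?_
        rw [hE]
        exact mul_le_mul_of_nonneg_left (hM s (by omega)) hS.le) t ht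
    calc ‖x t ω‖ ^ 2 ≤ (√(S * M) / (1 - r)) ^ 2 := pow_le_pow_left₀ (norm_nonneg _) h 2
      _ = _ := by rw [div_pow, Real.sq_sqrt (by positivity)]

end PathBound

/-! ### Increments of the gradient and covariance martingales. -/

section Increments

variable {n m : ℕ} (A : Matrix (Fin n) (Fin m) ℝ)
  (φ : EuclideanSpace ℝ (Fin n) → EuclideanSpace ℝ (Fin m))

/-- The increments of the gradient martingale. -/
noncomputable def gradInc (μ : ℝ) (i : Fin n)
    (Q : ℕ → EuclideanSpace ℝ (Fin n) →L[ℝ] EuclideanSpace ℝ (Fin m)) (t : ℕ)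
    (p : EuclideanSpace ℝ (Fin n) × EuclideanSpace ℝ (Fin n)) : EuclideanSpace ℝ (Fin m) :=
  clip μ (p.2 i) • φ p.1 + Q (t + 1) p.2

/-- The feature covariance of the samples whose disturbance is small. -/
noncomputable def maskInc (μ : ℝ) (i : Fin n) (_t : ℕ)
    (p : EuclideanSpace ℝ (Fin n) × EuclideanSpace ℝ (Fin n)) :
    EuclideanSpace ℝ (Fin m × Fin m) :=
  if |p.2 i| ≤ μ / 2 then outer (φ p.1) else 0

/-- The covariance of the next feature vector. -/
noncomputable def featInc (_t : ℕ)
    (p : EuclideanSpace ℝ (Fin n) × EuclideanSpace ℝ (Fin n)) :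
    EuclideanSpace ℝ (Fin m × Fin m) :=
  outer (φ (act A (φ p.1) + p.2))

variable {A φ} {L : ℝ≥0} {μ : ℝ} {i : Fin n}
  {Q : ℕ → EuclideanSpace ℝ (Fin n) →L[ℝ] EuclideanSpace ℝ (Fin m)}

lemma measurable_abs_coord_le : MeasurableSet
    {p : EuclideanSpace ℝ (Fin n) × EuclideanSpace ℝ (Fin n) | |p.2 i| ≤ μ / 2} :=
  measurableSet_le (by fun_prop) measurable_const

lemma measurable_gradInc (hs : IsStableSystem A φ L) (t : ℕ) :
    Measurable (gradInc φ μ i Q t) := by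
  have h1 : Measurable fun p : EuclideanSpace ℝ (Fin n) × EuclideanSpace ℝ (Fin n) =>
      clip μ (p.2 i) := (measurable_clip μ).comp (by fun_prop)
  have h2 : Measurable fun p : EuclideanSpace ℝ (Fin n) × EuclideanSpace ℝ (Fin n) => φ p.1 :=
    hs.continuous_map.measurable.comp measurable_fst
  exact (h1.smul h2).add ((Q (t + 1)).continuous.measurable.comp measurable_snd)

lemma measurable_maskInc (hs : IsStableSystem A φ L) (t : ℕ) :
    Measurable (maskInc φ μ i t) :=
  Measurable.ite measurable_abs_coord_le
    ((continuous_outer.comp hs.continuous_map).measurable.comp measurable_fst) measurable_const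

lemma measurable_featInc (hs : IsStableSystem A φ L) (t : ℕ) : Measurable (featInc A φ t) :=
  (continuous_outer.comp (continuous_step hs)).measurable

lemma norm_gradInc_sq_le (hs : IsStableSystem A φ L) (hμ : 0 < μ) {C : ℝ}
    (hQ : ∀ t, ‖Q t‖ ≤ C) (t : ℕ) (p : EuclideanSpace ℝ (Fin n) × EuclideanSpace ℝ (Fin n)) :
    ‖gradInc φ μ i Q t p‖ ^ 2 ≤ 2 * (μ * L) ^ 2 * ‖p.1‖ ^ 2 + 2 * C ^ 2 * ‖p.2‖ ^ 2 := by
  have h1 : ‖clip μ (p.2 i) • φ p.1‖ ≤ μ * L * ‖p.1‖ := by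
    rw [norm_smul, mul_assoc]
    exact mul_le_mul (abs_clip_le hμ _) (hs.norm_map_le _) (norm_nonneg _) hμ.le
  have h2 : ‖Q (t + 1) p.2‖ ≤ C * ‖p.2‖ := (Q (t + 1)).le_of_opNorm_le (hQ _) _
  have h3 : ‖gradInc φ μ i Q t p‖ ≤ μ * L * ‖p.1‖ + C * ‖p.2‖ :=
    (norm_add_le _ _).trans (add_le_add h1 h2)
  calc _ ≤ (μ * L * ‖p.1‖ + C * ‖p.2‖) ^ 2 := pow_le_pow_left₀ (norm_nonneg _) h3 2
    _ ≤ _ := by nlinarith [sq_nonneg (μ * L * ‖p.1‖ - C * ‖p.2‖)]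

lemma norm_map_pow_four_le (hs : IsStableSystem A φ L) (u : EuclideanSpace ℝ (Fin n)) :
    ‖outer (φ u)‖ ^ 2 ≤ L ^ 4 * ‖u‖ ^ 4 := by
  rw [norm_outer, ← pow_mul, ← mul_pow]
  exact pow_le_pow_left₀ (norm_nonneg _) (hs.norm_map_le u) 4

lemma norm_maskInc_sq_le (hs : IsStableSystem A φ L) (t : ℕ)
    (p : EuclideanSpace ℝ (Fin n) × EuclideanSpace ℝ (Fin n)) :
    ‖maskInc φ μ i t p‖ ^ 2 ≤ L ^ 4 * ‖p.1‖ ^ 4 := by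
  unfold maskInc
  split_ifs
  · exact norm_map_pow_four_le hs _
  · rw [norm_zero, zero_pow two_ne_zero]; positivity

lemma norm_featInc_sq_le (hs : IsStableSystem A φ L) (t : ℕ)
    (p : EuclideanSpace ℝ (Fin n) × EuclideanSpace ℝ (Fin n)) :
    ‖featInc A φ t p‖ ^ 2 ≤ 8 * (L : ℝ) ^ 4 * ‖p.1‖ ^ 4 + 8 * (L : ℝ) ^ 4 * ‖p.2‖ ^ 4 := by
  refine (norm_map_pow_four_le hs _).trans ?_
  have h1 : ‖act A (φ p.1) + p.2‖ ≤ ‖p.1‖ + ‖p.2‖ := by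
    refine (norm_add_le _ _).trans (add_le_add ((hs.norm_act_map_le _).trans ?_) le_rfl)
    exact mul_le_of_le_one_left (norm_nonneg _) hs.lt_one.le
  have h2 : (‖p.1‖ + ‖p.2‖) ^ 4 ≤ 8 * (‖p.1‖ ^ 4 + ‖p.2‖ ^ 4) := by
    have := add_pow_le (norm_nonneg p.1) (norm_nonneg p.2) 4
    norm_num at this
    exact this
  calc _ ≤ (L : ℝ) ^ 4 * (‖p.1‖ + ‖p.2‖) ^ 4 := by gcongr
    _ ≤ (L : ℝ) ^ 4 * (8 * (‖p.1‖ ^ 4 + ‖p.2‖ ^ 4)) := by gcongr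
    _ = _ := by ring

lemma integrable_norm_sq_of_le {H : Type*} [NormedAddCommGroup H] [MeasurableSpace H] [BorelSpace H]
    [SecondCountableTopology H] {S : Type*} [MeasurableSpace S] {ν : Measure S} {f : S → H}
    (hf : Measurable f) {g : S → ℝ} (hg : Integrable g ν) (h : ∀ y, ‖f y‖ ^ 2 ≤ g y) :
    Integrable (fun y => ‖f y‖ ^ 2) ν :=
  hg.mono' (hf.norm.pow_const 2).aestronglyMeasurable (Filter.Eventually.of_forall fun y => by
    rw [Real.norm_of_nonneg (sq_nonneg _)]; exact h y)

lemma integrable_gradInc_sq (hs : IsStableSystem A φ L) (hμ : 0 < μ) {C : ℝ}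
    (hQ : ∀ t, ‖Q t‖ ≤ C) {ν : Measure (EuclideanSpace ℝ (Fin n))} [IsProbabilityMeasure ν] {S : ℝ}
    (hν : HasNoiseMoments ν S) (t : ℕ) (u : EuclideanSpace ℝ (Fin n)) :
    Integrable (fun y => ‖gradInc φ μ i Q t (u, y)‖ ^ 2) ν :=
  integrable_norm_sq_of_le ((measurable_gradInc hs t).comp measurable_prodMk_left)
    (g := fun y => 2 * (μ * L) ^ 2 * ‖u‖ ^ 2 + 2 * C ^ 2 * ‖y‖ ^ 2)
    ((integrable_const _).add (hν.integrable_sq.const_mul _))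
    fun y => norm_gradInc_sq_le hs hμ hQ t (u, y)

lemma integrable_maskInc_sq (hs : IsStableSystem A φ L)
    {ν : Measure (EuclideanSpace ℝ (Fin n))} [IsProbabilityMeasure ν] (t : ℕ)
    (u : EuclideanSpace ℝ (Fin n)) : Integrable (fun y => ‖maskInc φ μ i t (u, y)‖ ^ 2) ν :=
  integrable_norm_sq_of_le ((measurable_maskInc hs t).comp measurable_prodMk_left)
    (g := fun _ => (L : ℝ) ^ 4 * ‖u‖ ^ 4) (integrable_const _)
    fun y => norm_maskInc_sq_le hs t (u, y)

lemma integrable_featInc_sq (hs : IsStableSystem A φ L)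
    {ν : Measure (EuclideanSpace ℝ (Fin n))} [IsProbabilityMeasure ν] {S : ℝ}
    (hν : HasNoiseMoments ν S) (t : ℕ) (u : EuclideanSpace ℝ (Fin n)) :
    Integrable (fun y => ‖featInc A φ t (u, y)‖ ^ 2) ν :=
  integrable_norm_sq_of_le ((measurable_featInc hs t).comp measurable_prodMk_left)
    (g := fun y => 8 * (L : ℝ) ^ 4 * ‖u‖ ^ 4 + 8 * (L : ℝ) ^ 4 * ‖y‖ ^ 4)
    ((integrable_const _).add (hν.integrable_four.const_mul _))
    fun y => norm_featInc_sq_le hs t (u, y)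

end Increments

/-! ### Square functions of the three martingales. -/

section SquareSum

variable {Ω : Type*} {mΩ : MeasurableSpace Ω} {P : Measure Ω} [IsProbabilityMeasure P]
  {n m : ℕ} {A : Matrix (Fin n) (Fin m) ℝ}
  {φ : EuclideanSpace ℝ (Fin n) → EuclideanSpace ℝ (Fin m)} {L : ℝ≥0}
  {x w : ℕ → Ω → EuclideanSpace ℝ (Fin n)} {μ S M : ℝ} {i : Fin n} {T : ℕ} {ω : Ω}

lemma squareSum_gradInc_le (hsys : IsSystem A φ x w) (hs : IsStableSystem A φ L) (hμ : 0 < μ)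
    (hS : 0 < S) (hν : ∀ t, HasNoiseMoments (P.map (w t)) S)
    {Q : ℕ → EuclideanSpace ℝ (Fin n) →L[ℝ] EuclideanSpace ℝ (Fin m)}
    (hQ : ∀ t, ‖Q t‖ ≤ μ * L / (1 - ‖A‖ * L)) (hp : PathBound x w (‖A‖ * L) S M T ω) :
    squareSum P x w (gradInc φ μ i Q) T ω ≤ 50 * μ ^ 2 * T * (L ^ 2 * S / (1 - ‖A‖ * L) ^ 2) := by
  have hr' : 0 < 1 - ‖A‖ * L := by linarith [hs.lt_one]
  set r : ℝ := ‖A‖ * L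
  set C := μ * L / (1 - r) with hC
  have hterm : ∀ t, ‖gradInc φ μ i Q t (x t ω, w t ω)‖ ^ 2
      + ∫ y, ‖gradInc φ μ i Q t (x t ω, y)‖ ^ 2 ∂(P.map (w t))
      ≤ 4 * (μ * L) ^ 2 * ‖x t ω‖ ^ 2 + 2 * C ^ 2 * ‖w t ω‖ ^ 2 + 2 * C ^ 2 * S := by
    intro t
    have : IsProbabilityMeasure (P.map (w t)) :=
      Measure.isProbabilityMeasure_map (hsys.measurable_noise t).aemeasurable
    have h1 := norm_gradInc_sq_le (i := i) hs hμ hQ t (x t ω, w t ω)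
    have h2 : ∫ y, ‖gradInc φ μ i Q t (x t ω, y)‖ ^ 2 ∂(P.map (w t))
        ≤ ∫ y, (2 * (μ * L) ^ 2 * ‖x t ω‖ ^ 2 + 2 * C ^ 2 * ‖y‖ ^ 2) ∂(P.map (w t)) :=
      integral_mono (integrable_gradInc_sq hs hμ hQ (hν t) t _)
        ((integrable_const _).add ((hν t).integrable_sq.const_mul _))
        fun y => norm_gradInc_sq_le hs hμ hQ t (x t ω, y)
    rw [integral_add (integrable_const _) ((hν t).integrable_sq.const_mul _),
      integral_const_mul (2 * C ^ 2), integral_const, probReal_univ, one_smul] at h2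
    have h3 := mul_le_mul_of_nonneg_left (hν t).integral_sq_le (by positivity : 0 ≤ 2 * C ^ 2)
    dsimp only at h1
    linarith
  calc squareSum P x w (gradInc φ μ i Q) T ω
      ≤ ∑ t ∈ Finset.range T,
        (4 * (μ * L) ^ 2 * ‖x t ω‖ ^ 2 + 2 * C ^ 2 * ‖w t ω‖ ^ 2 + 2 * C ^ 2 * S) :=
        Finset.sum_le_sum fun t _ => hterm t
    _ = 4 * (μ * L) ^ 2 * ∑ t ∈ Finset.range T, ‖x t ω‖ ^ 2
        + 2 * C ^ 2 * ∑ t ∈ Finset.range T, ‖w t ω‖ ^ 2 + T * (2 * C ^ 2 * S) := by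
        rw [Finset.sum_add_distrib, Finset.sum_add_distrib, Finset.mul_sum, Finset.mul_sum]
        simp
    _ ≤ 4 * (μ * L) ^ 2 * (8 * T * S / (1 - r) ^ 2) + 2 * C ^ 2 * (8 * T * S)
        + T * (2 * C ^ 2 * S) := by
        have h1 := hp.sum_sq
        have h2 := hp.noise_sq
        gcongr
    -- The constant is `50 = 4 * 8 + 2 * 8 + 2`.
    _ = _ := by rw [hC]; field_simp; ring

lemma squareSum_maskInc_le (hsys : IsSystem A φ x w) (hs : IsStableSystem A φ L)
    (hp : PathBound x w (‖A‖ * L) S M T ω) :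
    squareSum P x w (maskInc φ μ i) T ω ≤ 100 * T * (L ^ 2 * S / (1 - ‖A‖ * L) ^ 2) ^ 2 := by
  have hr' : 0 < 1 - ‖A‖ * L := by linarith [hs.lt_one]
  have hterm : ∀ t, ‖maskInc φ μ i t (x t ω, w t ω)‖ ^ 2
      + ∫ y, ‖maskInc φ μ i t (x t ω, y)‖ ^ 2 ∂(P.map (w t)) ≤ 2 * (L : ℝ) ^ 4 * ‖x t ω‖ ^ 4 := by
    intro t
    have : IsProbabilityMeasure (P.map (w t)) :=
      Measure.isProbabilityMeasure_map (hsys.measurable_noise t).aemeasurable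
    have h1 := norm_maskInc_sq_le (μ := μ) (i := i) hs t (x t ω, w t ω)
    have h2 : ∫ y, ‖maskInc φ μ i t (x t ω, y)‖ ^ 2 ∂(P.map (w t))
        ≤ ∫ _, (L : ℝ) ^ 4 * ‖x t ω‖ ^ 4 ∂(P.map (w t)) :=
      integral_mono (integrable_maskInc_sq hs t _) (integrable_const _)
        fun y => norm_maskInc_sq_le hs t (x t ω, y)
    rw [integral_const, probReal_univ, one_smul] at h2
    dsimp only at h1
    linarith
  have h4 := hp.sum_four
  rw [Finset.sum_range_succ] at h4
  have h5 : 0 ≤ ‖x T ω‖ ^ 4 := by positivity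
  calc squareSum P x w (maskInc φ μ i) T ω
      ≤ ∑ t ∈ Finset.range T, 2 * (L : ℝ) ^ 4 * ‖x t ω‖ ^ 4 :=
        Finset.sum_le_sum fun t _ => hterm t
    _ = 2 * (L : ℝ) ^ 4 * ∑ t ∈ Finset.range T, ‖x t ω‖ ^ 4 := by rw [Finset.mul_sum]
    _ ≤ 2 * (L : ℝ) ^ 4 * (50 * T * S ^ 2 / (1 - ‖A‖ * L) ^ 4) := by
        gcongr; linarith
    _ = _ := by field_simp; ring

lemma squareSum_featInc_le (hsys : IsSystem A φ x w) (hs : IsStableSystem A φ L)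
    (hν : ∀ t, HasNoiseMoments (P.map (w t)) S) (hp : PathBound x w (‖A‖ * L) S M (T + 1) ω) :
    squareSum P x w (featInc A φ) T ω
      ≤ 500 * (T + 1 : ℕ) * (L ^ 2 * S / (1 - ‖A‖ * L) ^ 2) ^ 2 := by
  have hr' : 0 < 1 - ‖A‖ * L := by linarith [hs.lt_one]
  have hterm : ∀ t, ‖featInc A φ t (x t ω, w t ω)‖ ^ 2
      + ∫ y, ‖featInc A φ t (x t ω, y)‖ ^ 2 ∂(P.map (w t))
      ≤ (L : ℝ) ^ 4 * ‖x (t + 1) ω‖ ^ 4 + 8 * (L : ℝ) ^ 4 * ‖x t ω‖ ^ 4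
        + 48 * (L : ℝ) ^ 4 * S ^ 2 := by
    intro t
    have : IsProbabilityMeasure (P.map (w t)) :=
      Measure.isProbabilityMeasure_map (hsys.measurable_noise t).aemeasurable
    have h1 : ‖featInc A φ t (x t ω, w t ω)‖ ^ 2 ≤ (L : ℝ) ^ 4 * ‖x (t + 1) ω‖ ^ 4 := by
      rw [hsys.dynamics]
      exact norm_map_pow_four_le hs _
    have h2 : ∫ y, ‖featInc A φ t (x t ω, y)‖ ^ 2 ∂(P.map (w t))
        ≤ ∫ y, (8 * (L : ℝ) ^ 4 * ‖x t ω‖ ^ 4 + 8 * (L : ℝ) ^ 4 * ‖y‖ ^ 4) ∂(P.map (w t)) :=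
      integral_mono (integrable_featInc_sq hs (hν t) t _)
        ((integrable_const _).add ((hν t).integrable_four.const_mul _))
        fun y => norm_featInc_sq_le hs t (x t ω, y)
    rw [integral_add (integrable_const _) ((hν t).integrable_four.const_mul _),
      integral_const, probReal_univ, one_smul, integral_const_mul] at h2
    have h3 := mul_le_mul_of_nonneg_left (hν t).integral_four_le
      (by positivity : 0 ≤ 8 * (L : ℝ) ^ 4)
    linarith
  have h4 := hp.sum_four
  have h5 : 0 ≤ ‖x 0 ω‖ ^ 4 := by positivity
  have h6 : 0 ≤ ‖x T ω‖ ^ 4 := by positivity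
  have h7 : 0 ≤ ‖x (T + 1) ω‖ ^ 4 := by positivity
  have ha : ∑ t ∈ Finset.range T, ‖x (t + 1) ω‖ ^ 4
      ≤ 50 * (T + 1 : ℕ) * S ^ 2 / (1 - ‖A‖ * L) ^ 4 := by
    rw [Finset.sum_range_succ, Finset.sum_range_succ'] at h4
    linarith
  have hb : ∑ t ∈ Finset.range T, ‖x t ω‖ ^ 4
      ≤ 50 * (T + 1 : ℕ) * S ^ 2 / (1 - ‖A‖ * L) ^ 4 := by
    rw [Finset.sum_range_succ, Finset.sum_range_succ] at h4
    linarith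
  have hc : S ^ 2 ≤ S ^ 2 / (1 - ‖A‖ * L) ^ 4 := by
    refine le_div_self (by positivity) (by positivity) (pow_le_one₀ hr'.le ?_)
    have : 0 ≤ ‖A‖ * L := by positivity
    linarith
  calc squareSum P x w (featInc A φ) T ω
      ≤ ∑ t ∈ Finset.range T, ((L : ℝ) ^ 4 * ‖x (t + 1) ω‖ ^ 4 + 8 * (L : ℝ) ^ 4 * ‖x t ω‖ ^ 4
        + 48 * (L : ℝ) ^ 4 * S ^ 2) := Finset.sum_le_sum fun t _ => hterm t
    _ = (L : ℝ) ^ 4 * ∑ t ∈ Finset.range T, ‖x (t + 1) ω‖ ^ 4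
        + 8 * (L : ℝ) ^ 4 * ∑ t ∈ Finset.range T, ‖x t ω‖ ^ 4 + T * (48 * (L : ℝ) ^ 4 * S ^ 2) := by
        rw [Finset.sum_add_distrib, Finset.sum_add_distrib, Finset.mul_sum, Finset.mul_sum]
        simp
    _ ≤ (L : ℝ) ^ 4 * (50 * (T + 1 : ℕ) * S ^ 2 / (1 - ‖A‖ * L) ^ 4)
        + 8 * (L : ℝ) ^ 4 * (50 * (T + 1 : ℕ) * S ^ 2 / (1 - ‖A‖ * L) ^ 4)
        + (T + 1 : ℕ) * (48 * (L : ℝ) ^ 4 * (S ^ 2 / (1 - ‖A‖ * L) ^ 4)) := by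
        gcongr
        exact Nat.le_succ T
    -- The constant is `498 = 50 + 8 * 50 + 48`.
    _ = 498 * ((T + 1 : ℕ) * (L ^ 2 * S / (1 - ‖A‖ * L) ^ 2) ^ 2) := by field_simp; ring
    _ ≤ 500 * ((T + 1 : ℕ) * (L ^ 2 * S / (1 - ‖A‖ * L) ^ 2) ^ 2) := by gcongr; norm_num
    _ = _ := by ring

end SquareSum

/-! ### Conditional means: drift of the gradient and curvature. -/

section Centre

variable {Ω : Type*} {mΩ : MeasurableSpace Ω} {P : Measure Ω} [IsProbabilityMeasure P]
  {n m : ℕ} {A : Matrix (Fin n) (Fin m) ℝ}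
  {φ : EuclideanSpace ℝ (Fin n) → EuclideanSpace ℝ (Fin m)} {L : ℝ≥0}
  {x w : ℕ → Ω → EuclideanSpace ℝ (Fin n)} {μ S : ℝ} {i : Fin n}

lemma HasNoiseMoments.integrable_id {ν : Measure (EuclideanSpace ℝ (Fin n))}
    [IsProbabilityMeasure ν] (hν : HasNoiseMoments ν S) : Integrable (fun y => y) ν :=
  ((memLp_two_iff_integrable_sq_norm measurable_id.aestronglyMeasurable).2
    hν.integrable_sq).integrable one_le_two

lemma integrable_clip (hμ : 0 < μ) {ν : Measure (EuclideanSpace ℝ (Fin n))}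
    [IsProbabilityMeasure ν] : Integrable (fun y : EuclideanSpace ℝ (Fin n) => clip μ (y i)) ν := by
  have hm : Measurable fun y : EuclideanSpace ℝ (Fin n) => clip μ (y i) :=
    (measurable_clip μ).comp (by fun_prop)
  exact (integrable_const μ).mono' hm.aestronglyMeasurable
    (Filter.Eventually.of_forall fun y => abs_clip_le hμ _)

/-- The linear part of the increment has mean zero, so adding it leaves the drift unchanged; it
serves to cancel the noise terms of the unrolled drift. -/
lemma integral_gradInc (hsys : IsSystem A φ x w) (hz : IsZeroMeanIndepNoise x w P) (hμ : 0 < μ)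
    (hν : ∀ t, HasNoiseMoments (P.map (w t)) S)
    (Q : ℕ → EuclideanSpace ℝ (Fin n) →L[ℝ] EuclideanSpace ℝ (Fin m)) (t : ℕ)
    (u : EuclideanSpace ℝ (Fin n)) :
    ∫ y, gradInc φ μ i Q t (u, y) ∂(P.map (w t))
      = (∫ y, clip μ (y i) ∂(P.map (w t))) • φ u := by
  have hm := hsys.measurable_noise t
  have hprob : IsProbabilityMeasure (P.map (w t)) :=
    Measure.isProbabilityMeasure_map hm.aemeasurable
  have hmean : ∫ y, y ∂(P.map (w t)) = 0 :=
    (integral_map (f := fun y => y) hm.aemeasurable measurable_id.aestronglyMeasurable).trans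
      (hz.mean_noise t)
  have hid := (hν t).integrable_id
  have h1 : ∫ y, gradInc φ μ i Q t (u, y) ∂(P.map (w t))
      = ∫ y, clip μ (y i) • φ u ∂(P.map (w t)) + ∫ y, Q (t + 1) y ∂(P.map (w t)) :=
    integral_add ((integrable_clip hμ).smul_const (φ u)) ((Q (t + 1)).integrable_comp hid)
  rw [h1, integral_smul_const, (Q (t + 1)).integral_comp_comm hid, hmean, map_zero, add_zero]

lemma integral_clip_eq_zero (hsys : IsSystem A φ x w) (hμ : 0 < μ) (hsym : IsSymmetricNoise w P)
    (t : ℕ) : ∫ y, clip μ (y i) ∂(P.map (w t)) = 0 := by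
  have hm := hsys.measurable_noise t
  have hc : Measurable fun y : EuclideanSpace ℝ (Fin n) => clip μ (y i) :=
    (measurable_clip μ).comp (by fun_prop)
  have h1 : ∫ y, clip μ (y i) ∂(P.map (w t)) = -∫ y, clip μ (y i) ∂(P.map (w t)) := by
    conv_lhs => rw [← hsym t]
    rw [integral_map (φ := fun ω => -w t ω) hm.neg.aemeasurable hc.aestronglyMeasurable,
      integral_map hm.aemeasurable hc.aestronglyMeasurable, ← integral_neg]
    refine integral_congr_ae (Filter.Eventually.of_forall fun ω => ?_)
    dsimp only
    rw [PiLp.neg_apply, clip_neg hμ]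
  linarith

/-- The gradient at the truth is a martingale, up to a bounded function of the initial state. -/
lemma exists_sum_clip_smul_eq (hsys : IsSystem A φ x w) (hs : IsStableSystem A φ L)
    (hz : IsZeroMeanIndepNoise x w P) (hμ : 0 < μ) (hν : ∀ t, HasNoiseMoments (P.map (w t)) S)
    (hcase : IsSymmetricNoise w P ∨ IsLinearBasis φ L) (i : Fin n) (T : ℕ) :
    ∃ Q : ℕ → EuclideanSpace ℝ (Fin n) →L[ℝ] EuclideanSpace ℝ (Fin m),
      (∀ t, ‖Q t‖ ≤ μ * L / (1 - ‖A‖ * L)) ∧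
      ∀ ω, ∑ t ∈ Finset.range T, clip μ (w t ω i) • φ (x t ω)
        = centredSum P x w (gradInc φ μ i Q) T ω + Q 0 (x 0 ω) := by
  set c : ℕ → ℝ := fun t => ∫ y, clip μ (y i) ∂(P.map (w t)) with hc
  have hr' : 0 < 1 - ‖A‖ * L := by linarith [hs.lt_one]
  obtain ⟨Q, hQ, hsum⟩ : ∃ Q : ℕ → EuclideanSpace ℝ (Fin n) →L[ℝ] EuclideanSpace ℝ (Fin m),
      (∀ t, ‖Q t‖ ≤ μ * L / (1 - ‖A‖ * L)) ∧ ∀ ω, ∑ t ∈ Finset.range T, c t • φ (x t ω)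
        = Q 0 (x 0 ω) + ∑ t ∈ Finset.range T, Q (t + 1) (w t ω) := by
    rcases hcase with hsym | ⟨B, hB, hφ⟩
    · refine ⟨0, fun t => ?_, fun ω => ?_⟩
      · rw [Pi.zero_apply, norm_zero]
        positivity
      · simp [hc, integral_clip_eq_zero hsys hμ hsym]
    · have hK : ‖(actCLM A).comp (actCLM B)‖ ≤ ‖A‖ * L :=
        (ContinuousLinearMap.opNorm_comp_le _ _).trans (mul_le_mul (norm_actCLM_le A)
          ((norm_actCLM_le B).trans hB) (norm_nonneg _) (norm_nonneg _))
      have hcb : ∀ t, |c t| ≤ μ := by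
        intro t
        have : IsProbabilityMeasure (P.map (w t)) :=
          Measure.isProbabilityMeasure_map (hsys.measurable_noise t).aemeasurable
        have h := norm_integral_le_of_norm_le_const (μ := P.map (w t)) (C := μ)
          (f := fun y : EuclideanSpace ℝ (Fin n) => clip μ (y i))
          (Filter.Eventually.of_forall fun y => abs_clip_le hμ _)
        simpa using h
      obtain ⟨Q, hQ, h⟩ := exists_sum_smul_eq_sum_noise ((actCLM A).comp (actCLM B)) (actCLM B) hK
        hs.lt_one ((norm_actCLM_le B).trans hB) hμ.le T c hcb
      refine ⟨Q, hQ, fun ω => ?_⟩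
      have h2 := h (fun t => x t ω) (fun t => w t ω) fun t => by
        rw [hsys.dynamics t ω, hφ]
        rfl
      rw [← h2]
      exact Finset.sum_congr rfl fun t _ => by rw [hφ]; rfl
  refine ⟨Q, hQ, fun ω => ?_⟩
  have h1 : centredSum P x w (gradInc φ μ i Q) T ω
      = ∑ t ∈ Finset.range T, clip μ (w t ω i) • φ (x t ω)
        + ∑ t ∈ Finset.range T, Q (t + 1) (w t ω) - ∑ t ∈ Finset.range T, c t • φ (x t ω) := by
    rw [← Finset.sum_add_distrib, ← Finset.sum_sub_distrib]
    refine Finset.sum_congr rfl fun t _ => ?_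
    rw [integral_gradInc hsys hz hμ hν]
    rfl
  rw [h1, hsum ω]
  abel

lemma integral_maskInc {ν : Measure (EuclideanSpace ℝ (Fin n))} [IsProbabilityMeasure ν] (t : ℕ)
    (u : EuclideanSpace ℝ (Fin n)) :
    ∫ y, maskInc φ μ i t (u, y) ∂ν = ν.real {y | |y i| ≤ μ / 2} • outer (φ u) := by
  have hset : MeasurableSet {y : EuclideanSpace ℝ (Fin n) | |y i| ≤ μ / 2} :=
    measurableSet_le (by fun_prop) measurable_const
  rw [← integral_indicator_const _ hset]
  rfl

lemma inner_outer_integral_featInc (hs : IsStableSystem A φ L)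
    {ν : Measure (EuclideanSpace ℝ (Fin n))} [IsProbabilityMeasure ν] (hν : HasNoiseMoments ν S)
    (t : ℕ) (u : EuclideanSpace ℝ (Fin n)) (v : EuclideanSpace ℝ (Fin m)) :
    inner ℝ (outer v) (∫ y, featInc A φ t (u, y) ∂ν)
      = ∫ y, inner ℝ v (φ (act A (φ u) + y)) ^ 2 ∂ν := by
  have hm : Measurable fun y => featInc A φ t (u, y) :=
    (measurable_featInc hs t).comp measurable_prodMk_left
  have hi : Integrable (fun y => featInc A φ t (u, y)) ν :=
    ((memLp_two_iff_integrable_sq_norm hm.aestronglyMeasurable).2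
      (integrable_featInc_sq hs hν t u)).integrable one_le_two
  rw [← integral_inner hi]
  exact integral_congr_ae (Filter.Eventually.of_forall fun y => inner_outer_outer _ _)

lemma le_measureReal_map (hsys : IsSystem A φ x w) {q : ℝ}
    (hmass : HasMassNearZero w μ q P) (t : ℕ) (i : Fin n) :
    q ≤ (P.map (w t)).real {y | |y i| ≤ μ / 2} := by
  have hset : MeasurableSet {y : EuclideanSpace ℝ (Fin n) | |y i| ≤ μ / 2} :=
    measurableSet_le (by fun_prop) measurable_const
  rw [Measure.real, Measure.map_apply (hsys.measurable_noise t) hset]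
  exact (ENNReal.ofReal_le_iff_le_toReal (measure_ne_top _ _)).1 (hmass t i)

/-- Restricted strong convexity, in terms of the two covariance martingales. -/
lemma curvature_le (hsys : IsSystem A φ x w) (hs : IsStableSystem A φ L)
    (hν : ∀ t, HasNoiseMoments (P.map (w t)) S) {q lam : ℝ} (hq : 0 ≤ q)
    (hmass : HasMassNearZero w μ q P) {N : ℕ} {ω : Ω}
    (hexc : ∀ t < N + 1, ∀ v : EuclideanSpace ℝ (Fin m), lam ^ 2 * ‖v‖ ^ 2
      ≤ ∫ y, inner ℝ v (φ (act A (φ (x t ω)) + y)) ^ 2 ∂(P.map (w t)))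
    (v : EuclideanSpace ℝ (Fin m)) :
    (q * (N * lam ^ 2 - ‖centredSum P x w (featInc A φ) N ω‖)
        - ‖centredSum P x w (maskInc φ μ i) (N + 1) ω‖) * ‖v‖ ^ 2
      ≤ ∑ t ∈ Finset.range (N + 1),
        if |w t ω i| ≤ μ / 2 then inner ℝ v (φ (x t ω)) ^ 2 else 0 := by
  have hprob : ∀ t, IsProbabilityMeasure (P.map (w t)) := fun t =>
    Measure.isProbabilityMeasure_map (hsys.measurable_noise t).aemeasurable
  have hcs : ∀ Z : EuclideanSpace ℝ (Fin m × Fin m), -(‖Z‖ * ‖v‖ ^ 2) ≤ inner ℝ (outer v) Z := by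
    intro Z
    have h := (abs_le.1 (abs_real_inner_le_norm (outer v) Z)).1
    rw [norm_outer, mul_comm] at h
    exact h
  have h3 : inner ℝ (outer v) (centredSum P x w (maskInc φ μ i) (N + 1) ω)
      ≤ (∑ t ∈ Finset.range (N + 1), if |w t ω i| ≤ μ / 2 then inner ℝ v (φ (x t ω)) ^ 2 else 0)
        - q * ∑ t ∈ Finset.range (N + 1), inner ℝ v (φ (x t ω)) ^ 2 := by
    rw [centredSum, inner_sum, Finset.mul_sum, ← Finset.sum_sub_distrib]
    refine Finset.sum_le_sum fun t _ => ?_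
    rw [inner_sub_right, integral_maskInc, inner_smul_right, inner_outer_outer]
    refine sub_le_sub (le_of_eq ?_)
      (mul_le_mul_of_nonneg_right (le_measureReal_map hsys hmass t i) (sq_nonneg _))
    unfold maskInc
    dsimp only
    split_ifs
    · exact inner_outer_outer _ _
    · exact inner_zero_right _
  have h4 : inner ℝ (outer v) (centredSum P x w (featInc A φ) N ω)
      ≤ (∑ t ∈ Finset.range N, inner ℝ v (φ (x (t + 1) ω)) ^ 2) - N * (lam ^ 2 * ‖v‖ ^ 2) := by
    have hN : (N : ℝ) * (lam ^ 2 * ‖v‖ ^ 2) = ∑ _t ∈ Finset.range N, lam ^ 2 * ‖v‖ ^ 2 := by simp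
    rw [centredSum, inner_sum, hN, ← Finset.sum_sub_distrib]
    refine Finset.sum_le_sum fun t ht => ?_
    rw [inner_sub_right, inner_outer_integral_featInc hs (hν t)]
    refine sub_le_sub (le_of_eq ?_) (hexc t (by have := Finset.mem_range.1 ht; omega) v)
    rw [hsys.dynamics]
    exact inner_outer_outer _ _
  -- Excitation concerns `x 1, …, x N` only; the sample at `x 0` is nonnegative and discarded, hence
  -- `N` against `N + 1`.
  have h5 : ∑ t ∈ Finset.range N, inner ℝ v (φ (x (t + 1) ω)) ^ 2
      ≤ ∑ t ∈ Finset.range (N + 1), inner ℝ v (φ (x t ω)) ^ 2 := by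
    rw [Finset.sum_range_succ']
    exact le_add_of_nonneg_right (sq_nonneg _)
  have h6 := hcs (centredSum P x w (maskInc φ μ i) (N + 1) ω)
  have h7 := hcs (centredSum P x w (featInc A φ) N ω)
  have h8 : (N * lam ^ 2 - ‖centredSum P x w (featInc A φ) N ω‖) * ‖v‖ ^ 2
      ≤ ∑ t ∈ Finset.range (N + 1), inner ℝ v (φ (x t ω)) ^ 2 := by linarith
  have h9 := mul_le_mul_of_nonneg_left h8 hq
  linarith

end Centre

/-! ### Numerical assembly on the good event. -/

section Assembly

lemma mul_sqrt_le_of_sample_size {κ q ℓ M T : ℝ} (hq : 0 < q)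
    (hM : 0 ≤ M) (hT : 10 ^ 8 * (κ ^ 2 / q ^ 2 * ℓ ^ 2) * M ≤ T) :
    10 ^ 4 * (κ * ℓ * √M) ≤ q * √T := by
  have h1 : (10 ^ 4 * (κ * ℓ * √M) / q) ^ 2 ≤ T := by
    refine le_trans (le_of_eq ?_) hT
    rw [div_pow, mul_pow, mul_pow, mul_pow, Real.sq_sqrt hM]
    field_simp
  have h2 := Real.le_sqrt_of_sq_le h1
  rw [div_le_iff₀ hq] at h2
  linarith

variable {Ω : Type*} {mΩ : MeasurableSpace Ω} {P : Measure Ω} [IsProbabilityMeasure P]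
  {n m : ℕ} {A : Matrix (Fin n) (Fin m) ℝ}
  {φ : EuclideanSpace ℝ (Fin n) → EuclideanSpace ℝ (Fin m)} {L : ℝ≥0}
  {x w : ℕ → Ω → EuclideanSpace ℝ (Fin n)} {σ μ q lam : ℝ}

set_option maxHeartbeats 1000000 in
/-- The error bound on the event that the trajectory and the three martingales are controlled. -/
lemma norm_row_sub_le (hn : 0 < n) (hσ : 0 < σ) (hμ : 0 < μ) (hq : 0 < q) (hq1 : q ≤ 1)
    (hlam : 0 < lam) (hsys : IsSystem A φ x w) (hs : IsStableSystem A φ L) {δ M : ℝ}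
    (hκ : 1 ≤ snr n L σ lam ‖A‖) (hM : 1 ≤ M) (hℓ : 2 / 3 ≤ Real.log (n / δ)) {N : ℕ} {ω : Ω}
    (hbig : 10 ^ 8 * (snr n L σ lam ‖A‖ ^ 2 / q ^ 2 * Real.log (n / δ) ^ 2) * M ≤ (N + 1 : ℕ))
    (hp : PathBound x w (‖A‖ * L) (n * (2 * σ) ^ 2) M (N + 1) ω)
    (hx0 : noiseEnergy x w (n * (2 * σ) ^ 2) 0 ω ≤ M) (i : Fin n)
    {Q : ℕ → EuclideanSpace ℝ (Fin n) →L[ℝ] EuclideanSpace ℝ (Fin m)} {g : EuclideanSpace ℝ (Fin m)}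
    (hQ : ∀ t, ‖Q t‖ ≤ μ * L / (1 - ‖A‖ * L))
    (hG : ∑ t ∈ Finset.range (N + 1), clip μ (w t ω i) • φ (x t ω) = g + Q 0 (x 0 ω))
    {S₃ S₄ β : ℝ} (hβ : β = L ^ 2 * (n * (2 * σ) ^ 2) / (1 - ‖A‖ * L) ^ 2)
    (hg : ‖g‖ ≤ √(50 * μ ^ 2 * (N + 1 : ℕ) * β) * (7 * Real.log (n / δ)))
    (h3 : S₃ ≤ √(100 * (N + 1 : ℕ) * β ^ 2) * (7 * Real.log (n / δ)))
    (h4 : S₄ ≤ √(500 * (N + 1 : ℕ) * β ^ 2) * (7 * Real.log (n / δ)))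
    (hcurv : ∀ v : EuclideanSpace ℝ (Fin m), (q * (N * lam ^ 2 - S₄) - S₃) * ‖v‖ ^ 2
      ≤ ∑ t ∈ Finset.range (N + 1), if |w t ω i| ≤ μ / 2 then inner ℝ v (φ (x t ω)) ^ 2 else 0)
    {a : Fin n → EuclideanSpace ℝ (Fin m)}
    (ha : IsHuberMinimizer μ φ (N + 1) (fun t => x t ω) a) :
    ‖row A i - a i‖ ≤ 1000 * errorBound n (N + 1) μ L σ q lam ‖A‖ δ := by
  have hr' : 0 < 1 - ‖A‖ * L := by linarith [hs.lt_one]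
  have hn' : (0 : ℝ) < n := by exact_mod_cast hn
  set κ := snr n L σ lam ‖A‖ with hκd
  set ℓ := Real.log (n / δ) with hℓd
  set T : ℝ := ((N + 1 : ℕ) : ℝ) with hTd
  have hTpos : 0 < T := by rw [hTd]; positivity
  set r : ℝ := ‖A‖ * L with hr
  have hL : 0 < (L : ℝ) := by
    rcases eq_or_lt_of_le L.coe_nonneg with h | h
    · rw [hκd, snr, ← h] at hκ
      norm_num at hκ
    · exact h
  -- `b` is the feature scale: `b² = β = 4 * κ * lam²`, and `‖φ (x t)‖ ≤ b * √M`.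
  set b := 2 * √n * L * σ / (1 - r) with hb
  have hb0 : 0 < b := by positivity
  have hsn : √(n : ℝ) ^ 2 = n := Real.sq_sqrt hn'.le
  have hbβ : b ^ 2 = β := by
    rw [hb, hβ, div_pow, mul_pow, mul_pow, mul_pow, hsn]; ring
  have hbκ : b ^ 2 = 4 * κ * lam ^ 2 := by
    rw [hbβ, hβ, hκd, snr, ← hr]; field_simp; ring
  set τ := √T with hτ
  have hτ0 : 0 < τ := Real.sqrt_pos.2 hTpos
  have hτT : τ ^ 2 = T := Real.sq_sqrt hTpos.le
  set k := √M with hk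
  have hk1 : 1 ≤ k := Real.one_le_sqrt.2 hM
  have hkM : k ^ 2 = M := Real.sq_sqrt (by linarith)
  have hℓ0 : 0 < ℓ := by linarith
  have key : 10 ^ 4 * (κ * ℓ * k) ≤ q * τ := mul_sqrt_le_of_sample_size hq (by linarith) hbig
  have hκℓ : 10 ^ 4 * (κ * ℓ) ≤ q * τ := by
    have : κ * ℓ ≤ κ * ℓ * k := le_mul_of_one_le_right (by positivity) hk1
    linarith
  have hκℓ' : 10 ^ 4 * (κ * ℓ) ≤ τ := hκℓ.trans (mul_le_of_le_one_left hτ0.le hq1)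
  have hκℓ2 : 2 / 3 ≤ κ * ℓ := hℓ.trans (le_mul_of_one_le_left hℓ0.le hκ)
  have hkτ : k ≤ ℓ * τ := by
    have h1 : 2 / 3 * k ≤ κ * ℓ * k := mul_le_mul_of_nonneg_right hκℓ2 (by linarith)
    have h2 : q * τ ≤ τ := mul_le_of_le_one_left hτ0.le hq1
    have h3 : 2 / 3 * τ ≤ ℓ * τ := mul_le_mul_of_nonneg_right hℓ hτ0.le
    linarith
  have hτ4 : 1000 ≤ τ := by linarith
  have hT8 : T - 1 ≥ 3 / 4 * T := by
    have h1 : 1000 * 1000 ≤ τ ^ 2 := by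
      rw [sq]; exact mul_le_mul hτ4 hτ4 (by norm_num) hτ0.le
    linarith
  have hE : 1000 * errorBound n (N + 1) μ L σ q lam ‖A‖ δ = 500 * μ * b * ℓ / (τ * q * lam ^ 2) := by
    rw [errorBound, hb, ← hTd, ← hτ, ← hr]
    field_simp
    ring
  rw [hE]
  set R := 500 * μ * b * ℓ / (τ * q * lam ^ 2) with hR
  have hR0 : 0 < R := by positivity
  have hsqrt : ∀ c u : ℝ, 0 ≤ c → 0 ≤ u → √(c * T * u ^ 2) = √c * (τ * u) := fun c u hc hu => by
    rw [mul_assoc, Real.sqrt_mul hc, Real.sqrt_mul hTpos.le, Real.sqrt_sq hu]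
  have hβ0 : 0 ≤ β := by rw [← hbβ]; positivity
  have h50 : √(50 : ℝ) ≤ 7.1 := by
    rw [Real.sqrt_le_left (by norm_num)]; norm_num
  have h100 : √(100 : ℝ) ≤ 10 := by
    rw [Real.sqrt_le_left (by norm_num)]; norm_num
  have h500 : √(500 : ℝ) ≤ 23 := by
    rw [Real.sqrt_le_left (by norm_num)]; norm_num
  rw [hsqrt _ _ (by norm_num) hβ0] at h3 h4
  have hg' : ‖g‖ ≤ 7.1 * (τ * (μ * b)) * (7 * ℓ) := by
    refine hg.trans ?_
    rw [show 50 * μ ^ 2 * T * β = 50 * T * (μ * b) ^ 2 by rw [← hbβ]; ring,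
      hsqrt _ _ (by norm_num) (by positivity)]
    gcongr
  have h3' : S₃ ≤ q * lam ^ 2 * T / 8 := by
    calc S₃ ≤ √100 * (τ * β) * (7 * ℓ) := h3
      _ ≤ 10 * (τ * β) * (7 * ℓ) := by gcongr
      _ = 280 * τ * lam ^ 2 * (κ * ℓ) := by rw [← hbβ, hbκ]; ring
      _ ≤ 280 * τ * lam ^ 2 * (q * τ / 10 ^ 4) := by gcongr; linarith
      _ = 280 / 10 ^ 4 * (q * lam ^ 2 * τ ^ 2) := by ring
      _ ≤ 1 / 8 * (q * lam ^ 2 * τ ^ 2) :=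
          mul_le_mul_of_nonneg_right (by norm_num) (by positivity)
      _ = _ := by rw [hτT]; ring
  have h4' : S₄ ≤ lam ^ 2 * T / 8 := by
    calc S₄ ≤ √500 * (τ * β) * (7 * ℓ) := h4
      _ ≤ 23 * (τ * β) * (7 * ℓ) := by gcongr
      _ = 644 * τ * lam ^ 2 * (κ * ℓ) := by rw [← hbβ, hbκ]; ring
      _ ≤ 644 * τ * lam ^ 2 * (τ / 10 ^ 4) := by gcongr; linarith
      _ = 644 / 10 ^ 4 * (lam ^ 2 * τ ^ 2) := by ring
      _ ≤ 1 / 8 * (lam ^ 2 * τ ^ 2) :=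
          mul_le_mul_of_nonneg_right (by norm_num) (by positivity)
      _ = _ := by rw [hτT]; ring
  have hNT : (N : ℝ) = T - 1 := by rw [hTd]; push_cast; ring
  -- Of `3/4` from `N ≥ 3 * T / 4`, the two covariance deviations take `1/8` each.
  have hc : q * lam ^ 2 * T / 2 ≤ q * (N * lam ^ 2 - S₄) - S₃ := by
    have h1 : lam ^ 2 * T * (5 / 8) ≤ N * lam ^ 2 - S₄ := by
      have h2 := mul_le_mul_of_nonneg_right hT8 (sq_nonneg lam)
      rw [hNT]
      linarith
    have h2 := mul_le_mul_of_nonneg_left h1 hq.le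
    linarith
  have hQx : ‖Q 0 (x 0 ω)‖ ≤ μ * b * (ℓ * τ) := by
    have h1 : ‖x 0 ω‖ ≤ 2 * √n * σ * k := by
      rw [noiseEnergy, div_le_iff₀ (by positivity)] at hx0
      refine abs_le_of_sq_le_sq' ?_ (by positivity) |>.2
      calc ‖x 0 ω‖ ^ 2 ≤ M * (n * (2 * σ) ^ 2) := hx0
        _ = √n ^ 2 * (2 * σ) ^ 2 * k ^ 2 := by rw [hsn, hkM]; ring
        _ = _ := by ring
    calc ‖Q 0 (x 0 ω)‖ ≤ μ * L / (1 - r) * (2 * √n * σ * k) :=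
          ((Q 0).le_of_opNorm_le (hQ 0) _).trans (by gcongr)
      _ = μ * b * k := by rw [hb]; ring
      _ ≤ _ := by gcongr
  refine norm_sub_le_of_huber_min (μ := μ) (T := N + 1) (z := fun t => w t ω i)
    (f := fun t => φ (x t ω)) (c := q * lam ^ 2 * T / 2) hμ hR0 ?_ ?_ ?_ ?_
  · have h := ha.row_le i (row A i)
    have he : ∀ t, x (t + 1) ω i = inner ℝ (row A i) (φ (x t ω)) + w t ω i := fun t => by
      rw [hsys.dynamics, PiLp.add_apply, act_apply]
    simpa only [he, add_sub_cancel_left] using h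
  · intro t ht
    have h1 : ‖φ (x t ω)‖ ≤ b * k := by
      refine abs_le_of_sq_le_sq' ?_ (by positivity) |>.2
      calc ‖φ (x t ω)‖ ^ 2 ≤ (L * ‖x t ω‖) ^ 2 :=
            pow_le_pow_left₀ (norm_nonneg _) (hs.norm_map_le _) 2
        _ = L ^ 2 * ‖x t ω‖ ^ 2 := mul_pow _ _ _
        _ ≤ L ^ 2 * (n * (2 * σ) ^ 2 * M / (1 - r) ^ 2) := by
            have := hp.le t ht.le
            gcongr
        _ = b ^ 2 * k ^ 2 := by rw [hbβ, hβ, hkM]; ring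
        _ = (b * k) ^ 2 := (mul_pow _ _ _).symm
    -- This localisation uses the factor `√M` in `key`: the perturbation must stay in the quadratic
    -- zone even at the largest feature.
    calc R * ‖φ (x t ω)‖ ≤ R * (b * k) := by gcongr
      _ = μ * (2000 * (κ * ℓ * k)) / (τ * q) := by
          have : R * (b * k) = 500 * μ * b ^ 2 * ℓ * k / (τ * q * lam ^ 2) := by rw [hR]; ring
          rw [this, hbκ]
          field_simp
          ring
      _ ≤ μ * (τ * q / 2) / (τ * q) := by gcongr; linarith
      _ = μ / 2 := by field_simp
  · intro v
    exact (mul_le_mul_of_nonneg_right hc (sq_nonneg _)).trans (hcurv v)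
  -- In units of `μ * b * ℓ * τ` the gradient is at most `49.7 + 1`, and twice this is below `250`.
  · have hRc : R * (q * lam ^ 2 * T / 2) = 250 * (μ * b * (ℓ * τ)) := by
      rw [hR, ← hτT]; field_simp; norm_num
    rw [hRc, hG]
    have h1 := norm_add_le g (Q 0 (x 0 ω))
    have h2 : 0 < μ * b * (ℓ * τ) := by positivity
    have h3 : 7.1 * (τ * (μ * b)) * (7 * ℓ) = 49.7 * (μ * b * (ℓ * τ)) := by ring
    linarith

/-- The restriction on `δ` for `n = 1` ensures `n / δ ≥ 2`, so additive constants can be absorbed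
into `log (n / δ)`. -/
lemma two_thirds_le_log {δ : ℝ} (hn : 0 < n) (hδ : 0 < δ) (hδ1 : δ < 1)
    (hnδ : 2 ≤ n ∨ δ ≤ 1 / 2) : 2 / 3 ≤ Real.log (n / δ) := by
  have hn1 : (1 : ℝ) ≤ n := by exact_mod_cast hn
  have h2 : 2 ≤ n / δ := by
    rw [le_div_iff₀ hδ]
    rcases hnδ with h | h
    · have : (2 : ℝ) ≤ n := by exact_mod_cast h
      nlinarith
    · linarith
  have := Real.log_le_log (by norm_num) h2
  have := Real.log_two_gt_d9
  linarith

lemma one_add_log_two_div_le {δ : ℝ} (hn : 0 < n) (hδ : 0 < δ) (hℓ : 2 / 3 ≤ Real.log (n / δ)) :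
    1 + Real.log (2 / (δ / (5 * n))) ≤ 7 * Real.log (n / δ) := by
  have hn' : (0 : ℝ) < n := by exact_mod_cast hn
  have h3 : Real.log 10 ≤ 3 := by
    rw [Real.log_le_iff_le_exp (by norm_num)]
    have h := Real.exp_one_gt_d9
    have h4 : Real.exp 3 = Real.exp 1 ^ 3 := by rw [← Real.exp_nat_mul]; norm_num
    rw [h4]
    calc (10 : ℝ) ≤ 2.7 ^ 3 := by norm_num
      _ ≤ _ := by gcongr; linarith
  have he : 2 / (δ / (5 * n)) = 10 * (n / δ) := by field_simp; norm_num
  rw [he, Real.log_mul (by norm_num) (by positivity)]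
  linarith

/-- As `T + 1 ≤ 2 * T`, the first term is at most `16 * e * T < 44 * T`; the sample size makes the
second negligible. -/
lemma sum_min_sq_threshold_le {ℓ M T ε : ℝ} (hℓ : 2 / 3 ≤ ℓ) (hM : 1 ≤ M) (hT : 1 ≤ T)
    (hbig : 10 ^ 8 * ℓ ^ 2 * M ≤ T) (hε : 0 < ε) (hlog : 1 + Real.log (2 / ε) ≤ 7 * ℓ) :
    8 * Real.exp 1 * (T + 1) + 2 * M * Real.log (1 / ε) ≤ 50 * T := by
  have h1 : Real.log (1 / ε) ≤ 7 * ℓ := by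
    have := Real.log_le_log (by positivity) (div_le_div_of_nonneg_right one_le_two hε.le)
    linarith
  have he := Real.exp_one_lt_d9
  have h2 : 2 * M * Real.log (1 / ε) ≤ 2 * M * (7 * ℓ) := by gcongr
  have h3 : M * ℓ ≤ 3 / 2 * (ℓ ^ 2 * M) := by nlinarith [mul_nonneg (by linarith : 0 ≤ M) (by linarith : 0 ≤ ℓ)]
  nlinarith

end Assembly

/-! ### The union bound and the main estimate. -/

section Main

variable {Ω : Type*} {mΩ : MeasurableSpace Ω} {P : Measure Ω} [IsProbabilityMeasure P]
  {n m : ℕ} {A : Matrix (Fin n) (Fin m) ℝ}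
  {φ : EuclideanSpace ℝ (Fin n) → EuclideanSpace ℝ (Fin m)} {L : ℝ≥0}
  {x w : ℕ → Ω → EuclideanSpace ℝ (Fin n)} {σ μ q lam : ℝ}

lemma measure_union_events_le {δ : ℝ} (hn : 0 < n) (hδ : 0 < δ) {E₀ E₁ E₂ E₃ : Set Ω}
    {F G : Fin n → Set Ω} (h0 : P E₀ ≤ ENNReal.ofReal (δ / (5 * n)))
    (h1 : P E₁ ≤ ENNReal.ofReal (δ / (5 * n))) (h2 : P E₂ ≤ ENNReal.ofReal (δ / (5 * n)))
    (h3 : P E₃ = 0) (hF : ∀ i, P (F i) ≤ ENNReal.ofReal (δ / (5 * n)))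
    (hG : ∀ i, P (G i) ≤ ENNReal.ofReal (δ / (5 * n))) :
    P (E₀ ∪ E₁ ∪ E₂ ∪ E₃ ∪ (⋃ i, F i) ∪ ⋃ i, G i) ≤ ENNReal.ofReal δ := by
  have hn1 : (1 : ℝ) ≤ n := by exact_mod_cast hn
  have hun : ∀ D : Fin n → Set Ω, (∀ i, P (D i) ≤ ENNReal.ofReal (δ / (5 * n))) →
      P (⋃ i, D i) ≤ ENNReal.ofReal (n * (δ / (5 * n))) := by
    intro D hD
    calc P (⋃ i, D i) ≤ ∑ i, P (D i) := measure_iUnion_fintype_le _ _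
      _ ≤ ∑ _i : Fin n, ENNReal.ofReal (δ / (5 * n)) := Finset.sum_le_sum fun i _ => hD i
      _ = _ := by
          rw [Finset.sum_const, Finset.card_univ, Fintype.card_fin, nsmul_eq_mul,
            ← ENNReal.ofReal_natCast, ← ENNReal.ofReal_mul (by positivity)]
  have hd : 0 ≤ δ / (5 * n) := by positivity
  have hnd : 0 ≤ n * (δ / (5 * n)) := by positivity
  calc _ ≤ P E₀ + P E₁ + P E₂ + P E₃ + P (⋃ i, F i) + P (⋃ i, G i) := by
        refine (measure_union_le _ _).trans (add_le_add ?_ le_rfl)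
        refine (measure_union_le _ _).trans (add_le_add ?_ le_rfl)
        refine (measure_union_le _ _).trans (add_le_add ?_ le_rfl)
        refine (measure_union_le _ _).trans (add_le_add ?_ le_rfl)
        exact measure_union_le _ _
    _ ≤ ENNReal.ofReal (δ / (5 * n)) + ENNReal.ofReal (δ / (5 * n))
        + ENNReal.ofReal (δ / (5 * n)) + 0 + ENNReal.ofReal (n * (δ / (5 * n)))
        + ENNReal.ofReal (n * (δ / (5 * n))) := by
        gcongr
        · exact h3.le
        · exact hun F hF
        · exact hun G hG
    _ = ENNReal.ofReal (δ / (5 * n) + δ / (5 * n) + δ / (5 * n) + n * (δ / (5 * n))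
        + n * (δ / (5 * n))) := by
        rw [add_zero, ← ENNReal.ofReal_add hd hd, ← ENNReal.ofReal_add (by positivity) hd,
          ← ENNReal.ofReal_add (by positivity) hnd, ← ENNReal.ofReal_add (by positivity) hnd]
    _ ≤ ENNReal.ofReal δ := by
        refine ENNReal.ofReal_le_ofReal ?_
        have h5 : n * (δ / (5 * n)) = δ / 5 := by field_simp
        have h6 : δ / (5 * n) ≤ δ / 5 := by
          refine div_le_div_of_nonneg_left hδ.le (by norm_num) (by linarith)
        rw [h5]
        linarith

lemma le_one_of_hasMassNearZero (hn : 0 < n) (hmass : HasMassNearZero w μ q P) : q ≤ 1 := by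
  have h := (hmass 0 ⟨0, hn⟩).trans prob_le_one
  exact ENNReal.ofReal_le_one.1 h

/-- The error bound for Huber regression, in positive dimensions. -/
lemma measure_error_gt_le (hn : 0 < n) (hm : 0 < m) (hσ : 0 < σ) (hlam : 0 < lam) (hq : 0 < q)
    (hμ : 0 < μ) {δ : ℝ} (hδ : 0 < δ) (hδ1 : δ < 1) {N : ℕ} (hnδ : 2 ≤ n ∨ δ ≤ 1 / 2)
    (hsys : IsSystem A φ x w) (hs : IsStableSystem A φ L) (hsub : IsSubGaussian x w σ P)
    (hz : IsZeroMeanIndepNoise x w P) (hexc : IsExcited φ x lam (N + 1) P)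
    (hmass : HasMassNearZero w μ q P) (hcase : IsSymmetricNoise w P ∨ IsLinearBasis φ L)
    (hthr : (30 * 10 ^ 8) ^ 2 * threshold n m L σ q lam ‖A‖ δ ≤ (N + 1 : ℕ)) :
    P {ω | ¬ ∀ a : Fin n → EuclideanSpace ℝ (Fin m),
        IsHuberMinimizer μ φ (N + 1) (fun t => x t ω) a →
          ∀ i, ‖row A i - a i‖ ≤ 1000 * errorBound n (N + 1) μ L σ q lam ‖A‖ δ}
      ≤ ENNReal.ofReal δ := by
  have hn' : (0 : ℝ) < n := by exact_mod_cast hn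
  have hq1 := le_one_of_hasMassNearZero hn hmass
  set S : ℝ := n * (2 * σ) ^ 2 with hSd
  have hS : 0 < S := by positivity
  have hse := isSubExp_noiseEnergy hn hσ hsys hs hz hsub
  have hν : ∀ t, HasNoiseMoments (P.map (w t)) S := fun t => hasNoiseMoments hS hsys (hse (t + 1))
  have hL2 : ∀ s, MemLp (initAndNoise x w s) 2 P := fun s => memLp_initAndNoise hS hsys (hse s)
  have hd := isDriven hsys hs hz
  have hprob : ∀ t, IsProbabilityMeasure (P.map (w t)) := fun t =>
    Measure.isProbabilityMeasure_map (hsys.measurable_noise t).aemeasurable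
  have hsnr : m ≤ snr n L σ lam ‖A‖ :=
    card_le_snr hn hσ hlam hsys hs hz hsub (Nat.succ_pos N) hexc
  have hκ : 1 ≤ snr n L σ lam ‖A‖ := le_trans (by exact_mod_cast hm) hsnr
  have hr' : 0 < 1 - ‖A‖ * L := by linarith [hs.lt_one]
  have hL : 0 < (L : ℝ) := by
    rcases eq_or_lt_of_le L.coe_nonneg with h | h
    · rw [snr, ← h] at hκ
      norm_num at hκ
    · exact h
  set T : ℝ := ((N + 1 : ℕ) : ℝ) with hTd
  have hT1 : 1 ≤ T := by rw [hTd]; push_cast; linarith [Nat.cast_nonneg (α := ℝ) N]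
  set ε := δ / (5 * n) with hε
  have hε0 : 0 < ε := by positivity
  set ℓ := Real.log (n / δ) with hℓd
  have hℓ : 2 / 3 ≤ ℓ := two_thirds_le_log hn hδ hδ1 hnδ
  have hlog : 1 + Real.log (2 / ε) ≤ 7 * ℓ := one_add_log_two_div_le hn hδ hℓ
  set M := 1 + Real.log ((T + 1) / ε) with hMd
  have hε1 : ε ≤ 1 := by
    rw [hε, div_le_one (by positivity)]
    have : (1 : ℝ) ≤ n := by exact_mod_cast hn
    linarith
  have hM : 1 ≤ M := by
    have : 1 ≤ (T + 1) / ε := by rw [le_div_iff₀ hε0]; linarith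
    linarith [Real.log_nonneg this]
  have hbig : 10 ^ 8 * (snr n L σ lam ‖A‖ ^ 2 / q ^ 2 * ℓ ^ 2) * M ≤ T :=
    snr_of_threshold_le hn hm hL hσ hq hq1 hlam hs.lt_one hδ hδ1 hnδ hsnr (by norm_num) hT1 hthr
  have hbig' : 10 ^ 8 * ℓ ^ 2 * M ≤ T := by
    refine le_trans ?_ hbig
    have h1 : 1 ≤ snr n L σ lam ‖A‖ ^ 2 / q ^ 2 := by
      rw [← div_pow]
      exact one_le_pow₀ ((one_le_div hq).2 (hq1.trans hκ))
    have h2 : ℓ ^ 2 ≤ snr n L σ lam ‖A‖ ^ 2 / q ^ 2 * ℓ ^ 2 :=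
      le_mul_of_one_le_left (sq_nonneg _) h1
    gcongr
  set β := (L : ℝ) ^ 2 * S / (1 - ‖A‖ * L) ^ 2 with hβ
  have hβ0 : 0 < β := by positivity
  choose Q hQ hQsum using exists_sum_clip_smul_eq hsys hs hz hμ hν hcase (T := N + 1)
  -- The bad events: a large noise energy, a large sum of truncated squared energies, deviation of
  -- the next-feature covariance, failure of excitation (null), and for each row deviation of the
  -- gradient and of the masked covariance.
  set E₀ := {ω | ∃ s < N + 1 + 1, M ≤ noiseEnergy x w S s ω}
  set E₁ := {ω | 8 * Real.exp 1 * (N + 1 + 1 : ℕ) + 2 * M * Real.log (1 / ε)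
      ≤ ∑ s ∈ Finset.range (N + 1 + 1), min (noiseEnergy x w S s ω) M ^ 2}
  set E₂ := {ω | √(500 * T * β ^ 2) * (1 + Real.log (2 / ε)) ≤ ‖centredSum P x w (featInc A φ) N ω‖
      ∧ squareSum P x w (featInc A φ) N ω ≤ 500 * T * β ^ 2}
  set E₃ := {ω | ¬ ∀ t < N + 1, ∀ v : EuclideanSpace ℝ (Fin m), lam ^ 2 * ‖v‖ ^ 2
      ≤ ∫ y, inner ℝ v (φ (act A (φ (x t ω)) + y)) ^ 2 ∂(P.map (w t))}
  set F : Fin n → Set Ω := fun i => {ω | √(50 * μ ^ 2 * T * β) * (1 + Real.log (2 / ε))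
        ≤ ‖centredSum P x w (gradInc φ μ i (Q i)) (N + 1) ω‖
      ∧ squareSum P x w (gradInc φ μ i (Q i)) (N + 1) ω ≤ 50 * μ ^ 2 * T * β} with hF
  set G : Fin n → Set Ω := fun i => {ω | √(100 * T * β ^ 2) * (1 + Real.log (2 / ε))
        ≤ ‖centredSum P x w (maskInc φ μ i) (N + 1) ω‖
      ∧ squareSum P x w (maskInc φ μ i) (N + 1) ω ≤ 100 * T * β ^ 2} with hG
  have hT0 : 0 < T := by linarith
  have p0 : P E₀ ≤ ENNReal.ofReal ε := by
    have h := measure_exists_ge_le hse (N + 1 + 1) hε0 (Nat.succ_pos _)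
    rwa [Nat.cast_succ (N + 1)] at h
  have p1 : P E₁ ≤ ENNReal.ofReal ε :=
    measure_sum_min_sq_ge_le hse (iIndepFun_noiseEnergy hz S) (N + 1 + 1) (by linarith) hε0
  have p2 : P E₂ ≤ ENNReal.ofReal ε :=
    measure_centredSum_ge_le hd (measurable_featInc hs)
      (fun t u => integrable_featInc_sq hs (hν t) t u) N (by positivity) hε0
  have p3 : P E₃ = 0 :=
    ae_iff.1 (sq_le_integral_inner_sq hsys hs hz (hL2 0) (fun t => hL2 (t + 1)) hexc)
  have pF : ∀ i, P (F i) ≤ ENNReal.ofReal ε := fun i =>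
    measure_centredSum_ge_le hd (measurable_gradInc hs)
      (fun t u => integrable_gradInc_sq hs hμ (hQ i) (hν t) t u) (N + 1) (by positivity) hε0
  have pG : ∀ i, P (G i) ≤ ENNReal.ofReal ε := fun i =>
    measure_centredSum_ge_le hd (measurable_maskInc hs)
      (fun t u => integrable_maskInc_sq hs t u) (N + 1) (by positivity) hε0
  refine le_trans (measure_mono fun ω hω => ?_) (measure_union_events_le hn hδ p0 p1 p2 p3 pF pG)
  by_contra hgood
  refine hω fun a ha i => ?_
  simp only [Set.mem_union, Set.mem_iUnion, not_or, not_exists] at hgood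
  obtain ⟨⟨⟨⟨⟨g0, g1⟩, g2⟩, g3⟩, gF⟩, gG⟩ := hgood
  have hle : ∀ s < N + 1 + 1, noiseEnergy x w S s ω ≤ M := fun s hs' => by
    by_contra! h
    exact g0 ⟨s, hs', h.le⟩
  have hsum : ∑ s ∈ Finset.range (N + 1 + 1), noiseEnergy x w S s ω ^ 2 ≤ 50 * (N + 1 : ℕ) := by
    -- Outside `E₀` the truncation at `M` is inactive.
    have h1 : ∑ s ∈ Finset.range (N + 1 + 1), noiseEnergy x w S s ω ^ 2
        = ∑ s ∈ Finset.range (N + 1 + 1), min (noiseEnergy x w S s ω) M ^ 2 :=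
      Finset.sum_congr rfl fun s hs' => by rw [min_eq_left (hle s (Finset.mem_range.1 hs'))]
    rw [h1]
    refine (not_le.1 g1).le.trans ?_
    rw [Nat.cast_succ (N + 1)]
    exact sum_min_sq_threshold_le hℓ hM hT1 hbig' hε0 hlog
  have hp := pathBound hsys hs hS hle hsum
  have hstrict : ∀ {c u v : ℝ}, 0 ≤ v → ¬ (√v * (1 + Real.log (2 / ε)) ≤ c ∧ u ≤ v) → u ≤ v →
      c ≤ √v * (7 * ℓ) := by
    intro c u v _ h hu
    have h1 : c < √v * (1 + Real.log (2 / ε)) := by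
      by_contra! h2
      exact h ⟨h2, hu⟩
    exact h1.le.trans (mul_le_mul_of_nonneg_left hlog (Real.sqrt_nonneg _))
  exact norm_row_sub_le hn hσ hμ hq hq1 hlam hsys hs hκ hM hℓ hbig hp (hle 0 (Nat.succ_pos _)) i
    (hQ i) (hQsum i ω) hβ
    (hstrict (by positivity) (gF i) (squareSum_gradInc_le hsys hs hμ hS hν (hQ i) hp))
    (hstrict (by positivity) (gG i) (squareSum_maskInc_le hsys hs hp))
    (hstrict (by positivity) g2 (squareSum_featInc_le hsys hs hν hp))
    (curvature_le hsys hs hν hq.le hmass (not_not.1 g3)) ha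

end Main

end HuberSysId

open HuberSysId in
theorem theorem1 :
    -- absolute constants
    ∃ C₁ C₂ : ℝ, 0 < C₁ ∧ 0 < C₂ ∧
      ∀ (n m : ℕ) (Ω : Type*) [MeasurableSpace Ω] (P : Measure Ω) [IsProbabilityMeasure P]
        (A : Matrix (Fin n) (Fin m) ℝ)
        (φ : EuclideanSpace ℝ (Fin n) → EuclideanSpace ℝ (Fin m))
        (x w : ℕ → Ω → EuclideanSpace ℝ (Fin n))
        (L : ℝ≥0) (σ lam q μ δ : ℝ) (T : ℕ),
        0 < σ → 0 < lam → 0 < q → 0 < μ → 0 < δ → δ < 1 → 0 < T →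
        (2 ≤ n ∨ δ ≤ 1 / 2) →
        IsSystem A φ x w →
        IsStableSystem A φ L →
        IsSubGaussian x w σ P →
        IsZeroMeanIndepNoise x w P →
        IsExcited φ x lam T P →
        HasMassNearZero w μ q P →
        (IsSymmetricNoise w P ∨ IsLinearBasis φ L) →
        C₁ * threshold n m L σ q lam ‖A‖ δ ≤ T →
        -- the exceptional event has (outer) probability at most `δ`
        P {ω | ¬ ∀ a : Fin n → EuclideanSpace ℝ (Fin m),
            IsHuberMinimizer μ φ T (fun t => x t ω) a →
              ∀ i, ‖row A i - a i‖ ≤ C₂ * errorBound n T μ L σ q lam ‖A‖ δ}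
          ≤ ENNReal.ofReal δ := by
  -- `10 ^ 8` is the square of the margin `10 ^ 4` in `mul_sqrt_le_of_sample_size`; `(30 * c) ^ 2`
  -- is the price of absorbing `log T`.
  refine ⟨(30 * 10 ^ 8) ^ 2, 1000, by norm_num, by norm_num, ?_⟩
  intro n m Ω _ P _ A φ x w L σ lam q μ δ T hσ hlam hq hμ hδ hδ1 hT hnδ hsys hs hsub hz hexc hmass
    hcase hthr
  obtain ⟨N, rfl⟩ := Nat.exists_eq_succ_of_ne_zero hT.ne'
  rcases Nat.eq_zero_or_pos n with rfl | hn
  · simp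
  -- For `m = 0` the ratio `snr` need not be at least one, but all rows are zero vectors.
  rcases Nat.eq_zero_or_pos m with rfl | hm
  · have hr' : 0 < 1 - ‖A‖ * L := by linarith [hs.lt_one]
    have hlog : 0 ≤ Real.log (n / δ) := by linarith [two_thirds_le_log hn hδ hδ1 hnδ]
    have hb : 0 ≤ 1000 * errorBound n (N + 1) μ L σ q lam ‖A‖ δ := by
      unfold errorBound
      positivity
    have hempty : {ω | ¬ ∀ a : Fin n → EuclideanSpace ℝ (Fin 0),
        IsHuberMinimizer μ φ (N + 1) (fun t => x t ω) a →
          ∀ i, ‖row A i - a i‖ ≤ 1000 * errorBound n (N + 1) μ L σ q lam ‖A‖ δ} = ∅ := by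
      refine Set.eq_empty_of_forall_notMem fun ω hω => hω fun a _ i => ?_
      rwa [Subsingleton.elim (row A i - a i) 0, norm_zero]
    rw [Nat.succ_eq_add_one, hempty, measure_empty]
    exact zero_le
  · exact measure_error_gt_le hn hm hσ hlam hq hμ hδ hδ1 hnδ hsys hs hsub hz hexc hmass hcase hthr
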